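/- Let $d\in\{2,3\}$, let $\Omega\subset\mathbb R^d$ be a bounded domain, $T>0$ and $r\ge 1$ an integer. Write $\langle\cdot,\cdot\rangle$, $\|\cdot\|$ for the inner product and norm of $L^2(\Omega)$ (scalars, vectors or matrices), $V=H^1_0(\Omega)^d$, $Q=\{q\in L^2(\Omega):\int_\Omega q\,dx=0\}$, $a(u,v)=\langle\nabla u,\nabla v\rangle$ and $b(v,q)=-\langle\nabla\cdot v,q\rangle$. Continuous problem. Let $(u,p)$, with $u(t)\in V$ and $p(t)\in Q$, solve $$\partial_t u-\Delta u+\nabla p=f,\qquad \nabla\cdot u=0\quad\text{in }\Omega\times(0,T],\qquad u(0)=u_0,\qquad u=0\ \text{ on }\partial\Omega\times[0,T],$$ and be regular up to $t=0$: $u\in C^4([0,T];L^2(\Omega)^d)\cap C^2([0,T];H^{r+1}(\Omega)^d)$, $p\in C^2([0,T];H^r(\Omega))$, $f\in C^3([0,T];L^2(\Omega)^d)$. Discrete spaces. Let $V_h\subset V$ and $Q_h\subset Q$ be finite-dimensional subspaces (conforming finite element spaces with mesh size $h>0$) such that, with constants $\beta>0$ and $C_a$, $$\beta\le\inf_{q_h\in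 Q_h\setminus\{0\}}\ \sup_{v_h\in V_h\setminus\{0\}}\frac{b(v_h,q_h)}{\|v_h\|_{H^1}\|q_h\|},$$ for every $v\in V\cap H^{r+1}(\Omega)^d$ there is $i_hv\in V_h$ with $\|v-i_hv\|+h\|\nabla(v-i_hv)\|\le C_a h^{r+1}\|v\|_{H^{r+1}}$, and for every $q\in Q\cap H^r(\Omega)$ there is $j_hq\in Q_h$ with $\|q-j_hq\|\le C_a h^r\|q\|_{H^r}$. Put $V_h^{\mathrm{div}}=\{v_h\in V_h: b(v_h,q_h)=0\ \forall q_h\in Q_h\}$. The Stokes projection $R_h(w,q)=(R_h^u(w,q),R_h^p(w,q))\in V_h\times Q_h$ of $(w,q)$ is defined by $a(R_h^u(w,q),v_h)+b(v_h,R_h^p(w,q))=a(w,v_h)+b(v_h,q)$ for all $v_h\in V_h$ and $b(R_h^u(w,q),q_h)=0$ for all $q_h\in Q_h$. Discrete solution. Let $0=t_0<t_1<\dots<t_N=T$, $I_n=(t_{n-1},t_n]$, $\tau_n=t_n-t_{n-1}$, $\tau=\max_n\tau_n$, and let $u_{0,h}\in V_h^{\mathrm{div}}$. Let $u_{\tau,h}:[0,T]\to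 V_h$ be continuous and piecewise linear with $u_{\tau,h}(0)=u_{0,h}$, and let $p_{\tau,h}:(0,T]\to Q_h$ be linear on each $I_n$ (possibly discontinuous at the $t_n$), such that for $n=1,\dots,N$ and all $v_h\in V_h$, $q_h\in Q_h$ $$\int_{I_n}\big(\langle\partial_tu_{\tau,h},v_h\rangle+a(u_{\tau,h},v_h)+b(v_h,p_{\tau,h})\big)\,dt=\frac{\tau_n}{2}\langle f(t_{n-1})+f(t_n),v_h\rangle,\qquad \int_{I_n}b(u_{\tau,h},q_h)\,dt=0.$$ The pressure solution set consists of all $p_{\tau,h}$ for which $(u_{\tau,h},p_{\tau,h})$ is such a solution. Post-processing by collocation. Let $\vartheta_n(t)=\alpha_n(t-t_{n-1})(t-t_n)$ with $\vartheta_n'(t_{n-1})=1$. For each $n$ let $\tilde u^n_{\tau,h}=u_{\tau,h}+c_n\vartheta_n$ and $\tilde p^n_{\tau,h}=p_{\tau,h}+d_n\vartheta_n'$ on $I_n$, with $c_n\in V_h^{\mathrm{div}}$ and $d_n\in Q_h$, extended to $t_{n-1}$ as polynomials in time ($\tilde u^n_{\tau,h}$ with values in $V_h^{\mathrm{div}}$),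 such that $$\langle\partial_t\tilde u^n_{\tau,h}(t_{n-1}),v_h\rangle+a(\tilde u^n_{\tau,h}(t_{n-1}),v_h)+b(v_h,\tilde p^n_{\tau,h}(t_{n-1}))=\langle f(t_{n-1}),v_h\rangle,\qquad b(\tilde u^n_{\tau,h}(t_{n-1}),q_h)=0$$ for all $v_h\in V_h$, $q_h\in Q_h$. Let $\tilde p_{\tau,h}$ and $\partial_t\tilde u_{\tau,h}$ be the global trajectories on $[0,T]$ that equal $\tilde p^n_{\tau,h}$, $\partial_t\tilde u^n_{\tau,h}$ on $I_n$, and equal $\tilde p^1_{\tau,h}(0)$, $\partial_t\tilde u^1_{\tau,h}(0)$ at $t=0$. Discrete errors. Let $R^1_\tau w$ be the continuous, piecewise linear interpolant in time with $R^1_\tau w(t_n)=w(t_n)$ for $n=0,\dots,N$, and $$e^u_{\tau,h}=R_h^u(R^1_\tau u,R^1_\tau p)-u_{\tau,h},\qquad E^u_{\tau,h}=R_h^u(R^1_\tau\partial_tu,R^1_\tau\partial_tp)-\partial_t\tilde u_{\tau,h}.$$ Theorem. There is a constant $C$, which may depend on $\Omega,T,r,u,p,f,\beta,C_a$, but not on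 $h$, $V_h$, $Q_h$, the time mesh or the discrete data and solutions, such that for all $h>0$, all spaces $V_h,Q_h$ as above, all time meshes, all $u_{0,h}\in V_h^{\mathrm{div}}$ and every discrete solution $(u_{\tau,h},p_{\tau,h})$, the post-processing exists, the post-processed pressure $\tilde p_{\tau,h}$ is continuous on $[0,T]$ with values in $Q_h$, is linear in time on each $I_n$, lies in the pressure solution set, and satisfies $$\Big(\int_0^T\|p(t)-\tilde p_{\tau,h}(t)\|^2\,dt\Big)^{1/2}\le C\Big(\|\nabla e^u_{\tau,h}(0)\|+\tau\,\|\nabla E^u_{\tau,h}(0)\|+\tau^2+h^r\Big).$$ -/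

import Mathlib

open MeasureTheory TopologicalSpace Set
open scoped Distributions LineDeriv

namespace StokesFE

noncomputable section

/-! ## Function spaces on an open set `Ω ⊆ ℝ^d` -/

/-- Physical space `ℝ^d`. -/
abbrev Pt (d : ℕ) := EuclideanSpace ℝ (Fin d)

/-- `L²(Ω)`. -/
abbrev L2 {d : ℕ} (Ω : Opens (Pt d)) := Lp ℝ 2 (volume.restrict (Ω : Set (Pt d)))

/-- `L²(Ω)^d` with its Hilbert norm. -/
abbrev VecL2 {d : ℕ} (Ω : Opens (Pt d)) := PiLp 2 (fun _ : Fin d => L2 Ω)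

/-- The iterated partial derivative `∂_{w 0} ∂_{w 1} ⋯ ∂_{w (j-1)} φ` of a test function. -/
def testDeriv {d : ℕ} {Ω : Opens (Pt d)} {j : ℕ} (w : Fin j → Fin d) (φ : 𝓓(Ω, ℝ)) : 𝓓(Ω, ℝ) :=
  ∂^{fun k => (EuclideanSpace.single (w k) (1 : ℝ) : Pt d)} φ

/-- `g ∈ L²(Ω)` is the weak derivative `∂_{w 0} ⋯ ∂_{w (j-1)} v` of `v ∈ L²(Ω)`. -/
def HasWeakDeriv {d : ℕ} (Ω : Opens (Pt d)) {j : ℕ} (w : Fin j → Fin d) (v g : L2 Ω) : Prop :=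
  ∀ φ : 𝓓(Ω, ℝ), ∫ x in (Ω : Set (Pt d)), v x * testDeriv w φ x =
    (-1) ^ j * ∫ x in (Ω : Set (Pt d)), g x * φ x

/-- The partial derivatives of order at most `m`, each indexed by the finite sequence of
coordinate directions in which one differentiates. -/
abbrev DerivIdx (d m : ℕ) := Σ j : Fin (m + 1), (Fin j → Fin d)

/-- The index of the function itself (no derivative). -/
def DerivIdx.zero (d m : ℕ) : DerivIdx d m := ⟨⟨0, Nat.succ_pos m⟩, Fin.elim0⟩

theorem integrable_mul_test {d : ℕ} {Ω : Opens (Pt d)} (v : L2 Ω) (φ : 𝓓(Ω, ℝ)) :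
    Integrable (fun x => v x * φ x) (volume.restrict (Ω : Set (Pt d))) :=
  MemLp.integrable_mul (p := 2) (q := 2) (Lp.memLp v)
    ((φ.continuous.memLp_of_hasCompactSupport φ.hasCompactSupport).restrict _)

theorem HasWeakDeriv.add {d : ℕ} {Ω : Opens (Pt d)} {j : ℕ} {w : Fin j → Fin d}
    {v₁ v₂ g₁ g₂ : L2 Ω} (h₁ : HasWeakDeriv Ω w v₁ g₁) (h₂ : HasWeakDeriv Ω w v₂ g₂) :
    HasWeakDeriv Ω w (v₁ + v₂) (g₁ + g₂) := by
  intro φ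
  have e : ∀ (a b : L2 Ω) (ψ : 𝓓(Ω, ℝ)), ∫ x in (Ω : Set (Pt d)), (a + b : L2 Ω) x * ψ x =
      (∫ x in (Ω : Set (Pt d)), a x * ψ x) + ∫ x in (Ω : Set (Pt d)), b x * ψ x := by
    intro a b ψ
    rw [← integral_add (integrable_mul_test a ψ) (integrable_mul_test b ψ)]
    refine integral_congr_ae ?_
    filter_upwards [Lp.coeFn_add a b] with x hx
    rw [hx, Pi.add_apply, add_mul]
  rw [e, e, h₁ φ, h₂ φ, mul_add]

theorem HasWeakDeriv.smul {d : ℕ} {Ω : Opens (Pt d)} {j : ℕ} {w : Fin j → Fin d}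
    {v g : L2 Ω} (c : ℝ) (h : HasWeakDeriv Ω w v g) :
    HasWeakDeriv Ω w (c • v) (c • g) := by
  intro φ
  have e : ∀ (a : L2 Ω) (ψ : 𝓓(Ω, ℝ)), ∫ x in (Ω : Set (Pt d)), (c • a : L2 Ω) x * ψ x =
      c * ∫ x in (Ω : Set (Pt d)), a x * ψ x := by
    intro a ψ
    rw [← integral_const_mul]
    refine integral_congr_ae ?_
    filter_upwards [Lp.coeFn_smul c a] with x hx
    rw [hx, Pi.smul_apply, smul_eq_mul, mul_assoc]
  rw [e, e, h φ]; ring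

theorem HasWeakDeriv.zero {d : ℕ} {Ω : Opens (Pt d)} {j : ℕ} {w : Fin j → Fin d} :
    HasWeakDeriv Ω w (0 : L2 Ω) 0 := by
  intro φ
  have e : ∀ ψ : 𝓓(Ω, ℝ), ∫ x in (Ω : Set (Pt d)), (0 : L2 Ω) x * ψ x = 0 := by
    intro ψ
    refine integral_eq_zero_of_ae ?_
    filter_upwards [Lp.coeFn_zero ℝ 2 (volume.restrict (Ω : Set (Pt d)))] with x hx
    rw [hx]; simp
  rw [e, e, mul_zero]

/-- The families of `L²` functions that consist of a function and of its weak derivatives of order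
at most `m`. -/
def sobSubmodule {d : ℕ} (Ω : Opens (Pt d)) (m : ℕ) :
    Submodule ℝ (PiLp 2 (fun _ : DerivIdx d m => L2 Ω)) where
  carrier := {J | ∀ a : DerivIdx d m, HasWeakDeriv Ω a.2 (J (DerivIdx.zero d m)) (J a)}
  add_mem' := fun hx hy a => (hx a).add (hy a)
  zero_mem' := fun _ => HasWeakDeriv.zero
  smul_mem' := fun c _ hx a => (hx a).smul c

/-- The Sobolev space `H^m(Ω)`: an element is an `L²` function together with its weak
derivatives of order at most `m` (they are determined by the function), and the norm is
`‖v‖_m = (∑_{j ≤ m} ∑_{i₁,…,i_j} ‖∂_{i₁} ⋯ ∂_{i_j} v‖²)^{1/2}`. -/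
def Sob {d : ℕ} (Ω : Opens (Pt d)) (m : ℕ) : Type := sobSubmodule Ω m

instance {d : ℕ} (Ω : Opens (Pt d)) (m : ℕ) : NormedAddCommGroup (Sob Ω m) :=
  inferInstanceAs (NormedAddCommGroup (sobSubmodule Ω m))

instance {d : ℕ} (Ω : Opens (Pt d)) (m : ℕ) : InnerProductSpace ℝ (Sob Ω m) :=
  inferInstanceAs (InnerProductSpace ℝ (sobSubmodule Ω m))

/-- The family of the weak derivatives `(∂_w v)_w` of `v ∈ H^m(Ω)`. -/
def Sob.jet {d : ℕ} {Ω : Opens (Pt d)} {m : ℕ} :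
    Sob Ω m →ₗᵢ[ℝ] PiLp 2 (fun _ : DerivIdx d m => L2 Ω) :=
  (sobSubmodule Ω m).subtypeₗᵢ

/-- The underlying `L²` function of an element of `H^m(Ω)`. -/
def Sob.toL2 {d : ℕ} {Ω : Opens (Pt d)} {m : ℕ} (v : Sob Ω m) : L2 Ω :=
  v.jet (DerivIdx.zero d m)

/-- The first weak partial derivative `∂_i v`, for `v ∈ H^m(Ω)` and `m ≥ 1`. -/
def Sob.partial {d : ℕ} {Ω : Opens (Pt d)} {m : ℕ} (hm : 1 ≤ m) (i : Fin d) (v : Sob Ω m) :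
    L2 Ω :=
  v.jet ⟨⟨1, Nat.lt_succ_of_le hm⟩, fun _ => i⟩

/-- The Laplacian `Δ v = ∑_i ∂_i ∂_i v`, for `v ∈ H^m(Ω)` and `m ≥ 2`. -/
def Sob.laplacian {d : ℕ} {Ω : Opens (Pt d)} {m : ℕ} (hm : 2 ≤ m) (v : Sob Ω m) : L2 Ω :=
  ∑ i : Fin d, v.jet ⟨⟨2, Nat.lt_succ_of_le hm⟩, fun _ => i⟩

/-- The embedding `H^m(Ω) ⊆ H^k(Ω)` for `k ≤ m`. -/
def Sob.restrict {d : ℕ} {Ω : Opens (Pt d)} {m k : ℕ} (h : k ≤ m) : Sob Ω m →ₗ[ℝ] Sob Ω k where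
  toFun v := ⟨WithLp.toLp 2 fun a : DerivIdx d k =>
      v.jet ⟨Fin.castLE (Nat.succ_le_succ h) a.1, a.2⟩, fun a =>
        v.2 ⟨Fin.castLE (Nat.succ_le_succ h) a.1, a.2⟩⟩
  map_add' _ _ := rfl
  map_smul' _ _ := rfl

/-- `H^1_0(Ω)`: the closure in `H^1(Ω)` of the (classes of) test functions. -/
def H10 {d : ℕ} (Ω : Opens (Pt d)) : Submodule ℝ (Sob Ω 1) :=
  (Submodule.span ℝ {v : Sob Ω 1 | ∃ φ : 𝓓(Ω, ℝ), ∀ a : DerivIdx d 1,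
    v.jet a =ᵐ[volume.restrict (Ω : Set (Pt d))] testDeriv a.2 φ}).topologicalClosure

/-- `H^m(Ω)^d` with its Hilbert norm. -/
abbrev VecSob {d : ℕ} (Ω : Opens (Pt d)) (m : ℕ) := PiLp 2 (fun _ : Fin d => Sob Ω m)

/-- The underlying `L²` vector field. -/
def VecSob.toL2 {d : ℕ} {Ω : Opens (Pt d)} {m : ℕ} (v : VecSob Ω m) : VecL2 Ω :=
  WithLp.toLp 2 fun i => (v i).toL2

/-- A field in `H^m(Ω)^d`, `m ≥ 1`, viewed in `H^1(Ω)^d`. -/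
def VecSob.toH1 {d : ℕ} {Ω : Opens (Pt d)} {m : ℕ} (hm : 1 ≤ m) (v : VecSob Ω m) : VecSob Ω 1 :=
  WithLp.toLp 2 fun i => Sob.restrict hm (v i)

/-- The velocity space `V = H^1_0(Ω)^d`. -/
def V {d : ℕ} (Ω : Opens (Pt d)) : Submodule ℝ (VecSob Ω 1) where
  carrier := {v | ∀ i, v i ∈ H10 Ω}
  add_mem' := fun hx hy i => (H10 Ω).add_mem (hx i) (hy i)
  zero_mem' := fun _ => (H10 Ω).zero_mem
  smul_mem' := fun c _ hx i => (H10 Ω).smul_mem c (hx i)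

/-- Membership in the pressure space `Q = L²_0(Ω)`. -/
def MeanZero {d : ℕ} {Ω : Opens (Pt d)} (q : L2 Ω) : Prop :=
  ∫ x in (Ω : Set (Pt d)), q x = 0

/-- The divergence of a field in `H^1(Ω)^d`. -/
def div {d : ℕ} {Ω : Opens (Pt d)} (v : VecSob Ω 1) : L2 Ω :=
  ∑ i : Fin d, (v i).partial le_rfl i

/-- `a(u, v) = ⟨∇u, ∇v⟩`. -/
def aForm {d : ℕ} {Ω : Opens (Pt d)} (u v : VecSob Ω 1) : ℝ :=
  ∑ i : Fin d, ∑ j : Fin d, inner ℝ ((u i).partial le_rfl j) ((v i).partial le_rfl j)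

/-- `‖∇v‖`. -/
def gradNorm {d : ℕ} {Ω : Opens (Pt d)} (v : VecSob Ω 1) : ℝ := Real.sqrt (aForm v v)

/-- `b(v, q) = -⟨∇·v, q⟩`. -/
def bForm {d : ℕ} {Ω : Opens (Pt d)} (v : VecSob Ω 1) (q : L2 Ω) : ℝ := -inner ℝ (div v) q

theorem bForm_add {d : ℕ} {Ω : Opens (Pt d)} (v w : VecSob Ω 1) (q : L2 Ω) :
    bForm (v + w) q = bForm v q + bForm w q := by
  have : div (v + w) = div v + div w := by
    unfold div; rw [← Finset.sum_add_distrib]; rfl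
  rw [bForm, this, inner_add_left, neg_add]; rfl

theorem bForm_smul {d : ℕ} {Ω : Opens (Pt d)} (c : ℝ) (v : VecSob Ω 1) (q : L2 Ω) :
    bForm (c • v) q = c * bForm v q := by
  have : div (c • v) = c • div v := by
    unfold div; rw [Finset.smul_sum]; rfl
  rw [bForm, this, real_inner_smul_left, bForm, mul_neg]

/-! ## The continuous problem -/

/-- `(u, p)` solves `∂ₜu - Δu + ∇p = f`, `∇·u = 0` in `Ω × (0,T]`, `u(0) = u₀` in `Ω`, `u = 0` on
`∂Ω × [0,T]`, with `p(t) ∈ L²_0(Ω)`. The trajectories have values in `H^{r+1}(Ω)^d` and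
`H^r(Ω)`, `r ≥ 1`, and the equations hold in `L²(Ω)`. -/
structure IsStokesSolution {d : ℕ} (Ω : Opens (Pt d)) (T : ℝ) {r : ℕ} (hr : 1 ≤ r)
    (f : ℝ → VecL2 Ω) (u₀ : VecL2 Ω) (u : ℝ → VecSob Ω (r + 1)) (p : ℝ → Sob Ω r) : Prop where
  momentum : ∀ t ∈ Ioc 0 T, ∀ i : Fin d,
    (derivWithin (fun s => (u s).toL2) (Icc 0 T) t) i
      - (u t i).laplacian (Nat.succ_le_succ hr) + (p t).partial hr i = f t i
  incompressible : ∀ t ∈ Ioc 0 T, div ((u t).toH1 (Nat.le_add_left 1 r)) = 0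
  initial : (u 0).toL2 = u₀
  boundary : ∀ t ∈ Icc 0 T, (u t).toH1 (Nat.le_add_left 1 r) ∈ V Ω
  mean_zero : ∀ t ∈ Icc 0 T, MeanZero (p t).toL2

/-- Regularity up to `t = 0`: `u ∈ C⁴([0,T]; L²) ∩ C²([0,T]; H^{r+1})`, `p ∈ C²([0,T]; H^r)`,
`f ∈ C³([0,T]; L²)`. -/
structure IsRegular {d : ℕ} {Ω : Opens (Pt d)} (T : ℝ) {r : ℕ}
    (f : ℝ → VecL2 Ω) (u : ℝ → VecSob Ω (r + 1)) (p : ℝ → Sob Ω r) : Prop where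
  velocity_L2 : ContDiffOn ℝ 4 (fun t => (u t).toL2) (Icc 0 T)
  velocity : ContDiffOn ℝ 2 u (Icc 0 T)
  pressure : ContDiffOn ℝ 2 p (Icc 0 T)
  force : ContDiffOn ℝ 3 f (Icc 0 T)

/-! ## Discretization in space -/

/-- A pair of conforming finite element spaces `V_h ⊆ V`, `Q_h ⊆ Q` with mesh size `h`, inf-sup
constant `β`, and approximation order `r` with constant `Ca`. -/
structure IsFEPair {d : ℕ} (Ω : Opens (Pt d)) (r : ℕ) (β Ca h : ℝ)
    (Vh : Submodule ℝ (VecSob Ω 1)) (Qh : Submodule ℝ (L2 Ω)) : Prop where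
  finite_V : FiniteDimensional ℝ Vh
  finite_Q : FiniteDimensional ℝ Qh
  conforming_V : Vh ≤ V Ω
  conforming_Q : ∀ q ∈ Qh, MeanZero q
  inf_sup : ∀ q ∈ Qh, q ≠ 0 → ∃ v ∈ Vh, v ≠ 0 ∧ β ≤ bForm v q / (‖v‖ * ‖q‖)
  approx_V : ∀ v : VecSob Ω (r + 1), v.toH1 (Nat.le_add_left 1 r) ∈ V Ω → ∃ w ∈ Vh,
    ‖(v.toH1 (Nat.le_add_left 1 r) - w).toL2‖ + h * gradNorm (v.toH1 (Nat.le_add_left 1 r) - w)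
      ≤ Ca * h ^ (r + 1) * ‖v‖
  approx_Q : ∀ q : Sob Ω r, MeanZero q.toL2 → ∃ s ∈ Qh, ‖q.toL2 - s‖ ≤ Ca * h ^ r * ‖q‖

/-- The discretely divergence-free functions `V_h^div`. -/
def discDivFree {d : ℕ} {Ω : Opens (Pt d)} (Vh : Submodule ℝ (VecSob Ω 1))
    (Qh : Submodule ℝ (L2 Ω)) : Submodule ℝ (VecSob Ω 1) where
  carrier := {v | v ∈ Vh ∧ ∀ q ∈ Qh, bForm v q = 0}
  add_mem' := fun hx hy => ⟨Vh.add_mem hx.1 hy.1, fun q hq => by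
    rw [bForm_add, hx.2 q hq, hy.2 q hq, add_zero]⟩
  zero_mem' := ⟨Vh.zero_mem, fun q _ => by
    have := bForm_smul (0 : ℝ) (0 : VecSob Ω 1) q
    rwa [zero_smul, zero_mul] at this⟩
  smul_mem' := fun c _ hx => ⟨Vh.smul_mem c hx.1, fun q hq => by
    rw [bForm_smul, hx.2 q hq, mul_zero]⟩

/-- `x = (û, p̂)` is the Stokes projection of `(w, q)`. -/
def IsStokesProj {d : ℕ} {Ω : Opens (Pt d)} (Vh : Submodule ℝ (VecSob Ω 1))
    (Qh : Submodule ℝ (L2 Ω)) (w : VecSob Ω 1) (q : L2 Ω) (x : VecSob Ω 1 × L2 Ω) : Prop :=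
  x.1 ∈ Vh ∧ x.2 ∈ Qh ∧
  (∀ v ∈ Vh, aForm x.1 v + bForm v x.2 = aForm w v + bForm v q) ∧
  ∀ s ∈ Qh, bForm x.1 s = 0

/-- The Stokes projection `R_h(w, q) = (R_h^u(w, q), R_h^p(w, q))`. -/
def stokesProj {d : ℕ} {Ω : Opens (Pt d)} (Vh : Submodule ℝ (VecSob Ω 1))
    (Qh : Submodule ℝ (L2 Ω)) (w : VecSob Ω 1) (q : L2 Ω) : VecSob Ω 1 × L2 Ω :=
  Classical.epsilon (IsStokesProj Vh Qh w q)

/-! ## Discretization in time -/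

/-- A time mesh `0 = t 0 < t 1 < ⋯ < t N = T`; its `n`-th interval is `(t n, t (n+1)]`, `n < N`.
The values `t n` with `n > N` play no role. -/
structure TimeMesh (T : ℝ) where
  N : ℕ
  t : ℕ → ℝ
  lt : ∀ n < N, t n < t (n + 1)
  first : t 0 = 0
  last : t N = T

namespace TimeMesh

variable {T : ℝ} (M : TimeMesh T)

/-- The `n`-th time interval `(t n, t (n+1)]`. -/
def I (n : ℕ) : Set ℝ := Ioc (M.t n) (M.t (n + 1))

/-- The closed `n`-th time interval. -/
def Ibar (n : ℕ) : Set ℝ := Icc (M.t n) (M.t (n + 1))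

/-- The mesh size `τ`, the maximal length of the intervals. -/
def tau : ℝ := ⨆ n : Fin M.N, (M.t (n + 1) - M.t n)

open Classical in
/-- The global trajectory built from local ones: at `t ∈ (t n, t (n+1)]` it takes the value of the
`n`-th local trajectory, and at `t = 0` that of the first one. -/
def glue {E : Type*} (w : ℕ → ℝ → E) (s : ℝ) : E :=
  if h : ∃ n < M.N, s ∈ M.I n then w h.choose s else w 0 s

/-- The interpolant `R_τ^1 w`: continuous, piecewise linear, equal to `w` at the mesh points. -/
def interp {E : Type*} [AddCommGroup E] [Module ℝ E] (w : ℝ → E) : ℝ → E :=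
  M.glue fun n s => w (M.t n) +
    ((s - M.t n) / (M.t (n + 1) - M.t n)) • (w (M.t (n + 1)) - w (M.t n))

end TimeMesh

/-- `w ∈ ℙ_k(J; B)`: on `J`, `w` is a polynomial of degree at most `k` with coefficients in `B`. -/
def IsPolyOn {E : Type*} [AddCommGroup E] [Module ℝ E] (k : ℕ) (B : Submodule ℝ E) (J : Set ℝ)
    (w : ℝ → E) : Prop :=
  ∃ W : ℕ → E, (∀ j, W j ∈ B) ∧ ∀ s ∈ J, w s = ∑ j ∈ Finset.range (k + 1), s ^ j • W j

/-- `w ∈ Y^k_τ(B)`: piecewise polynomial in time. -/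
def InY {T : ℝ} (M : TimeMesh T) {E : Type*} [AddCommGroup E] [Module ℝ E] (k : ℕ)
    (B : Submodule ℝ E) (w : ℝ → E) : Prop :=
  ∀ n < M.N, IsPolyOn k B (M.I n) w

/-- `w ∈ X^k_τ(B)`: continuous on `[0,T]` with values in `B` and piecewise polynomial. -/
def InX {T : ℝ} (M : TimeMesh T) {E : Type*} [NormedAddCommGroup E] [NormedSpace ℝ E] (k : ℕ)
    (B : Submodule ℝ E) (w : ℝ → E) : Prop :=
  (∀ s ∈ Icc 0 T, w s ∈ B) ∧ ContinuousOn w (Icc 0 T) ∧ InY M k B w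

/-- The two-point Gauss--Lobatto formula (trapezoidal rule) for a continuous `g` on `[a,b]`. -/
def gaussLobatto (a b : ℝ) (g : ℝ → ℝ) : ℝ := (b - a) / 2 * (g a + g b)

/-- `(U, P) ∈ X^1_τ(V_h) × Y^1_τ(Q_h)` is a solution of the fully discrete scheme with initial
value `u0h`: on every time interval the variational equations hold for all test functions that are
constant in time. The continuity of `U` contains the condition `U⁺(t n) = U(t n)`. -/
structure IsDiscreteSolution {d : ℕ} {Ω : Opens (Pt d)} {T : ℝ} (M : TimeMesh T)
    (Vh : Submodule ℝ (VecSob Ω 1)) (Qh : Submodule ℝ (L2 Ω)) (f : ℝ → VecL2 Ω)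
    (u0h : VecSob Ω 1) (U : ℝ → VecSob Ω 1) (P : ℝ → L2 Ω) : Prop where
  velocity : InX M 1 Vh U
  pressure : InY M 1 Qh P
  initial : U 0 = u0h
  momentum : ∀ n < M.N, ∀ v ∈ Vh,
    ∫ s in (M.t n)..(M.t (n + 1)),
      (inner ℝ (deriv U s).toL2 v.toL2 + aForm (U s) v + bForm v (P s)) =
    gaussLobatto (M.t n) (M.t (n + 1)) fun s => inner ℝ (f s) v.toL2
  incompressible : ∀ n < M.N, ∀ q ∈ Qh, ∫ s in (M.t n)..(M.t (n + 1)), bForm (U s) q = 0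

/-! ## Post-processing by collocation -/

/-- `ϑ(s) = α (s - a)(s - b)` with `α` such that `ϑ'(a) = 1`. -/
def bubble (a b s : ℝ) : ℝ := (s - a) * (s - b) / (a - b)

/-- Local post-processing on `(a, b]` of a discrete solution `(U, P)`: `Ut = U + ϑ c` and
`Pt = P + ϑ' e` on `(a, b]` with `c ∈ V_h^div`, `e ∈ Q_h`, both are polynomials on `[a, b]` (so
their values, and the derivative of `Ut`, at `a` are the right-sided limits), and the collocation
conditions hold at `a`. -/
structure IsLocalPostProcessing {d : ℕ} {Ω : Opens (Pt d)} (a b : ℝ)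
    (Vh : Submodule ℝ (VecSob Ω 1)) (Qh : Submodule ℝ (L2 Ω)) (f : ℝ → VecL2 Ω)
    (U : ℝ → VecSob Ω 1) (P : ℝ → L2 Ω) (Ut : ℝ → VecSob Ω 1) (Pt : ℝ → L2 Ω) : Prop where
  velocity_eq : ∃ c ∈ discDivFree Vh Qh, ∀ s ∈ Ioc a b, Ut s = U s + bubble a b s • c
  pressure_eq : ∃ e ∈ Qh, ∀ s ∈ Ioc a b, Pt s = P s + deriv (bubble a b) s • e
  velocity : IsPolyOn 2 (discDivFree Vh Qh) (Icc a b) Ut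
  pressure : IsPolyOn 1 Qh (Icc a b) Pt
  collocation : ∀ v ∈ Vh,
    inner ℝ (derivWithin Ut (Icc a b) a).toL2 v.toL2 + aForm (Ut a) v + bForm v (Pt a) =
      inner ℝ (f a) v.toL2
  collocation_div : ∀ q ∈ Qh, bForm (Ut a) q = 0

/-- `Ut n`, `Pt n` are the local post-processed trajectories on the `n`-th interval, for all `n`. -/
def IsPostProcessing {d : ℕ} {Ω : Opens (Pt d)} {T : ℝ} (M : TimeMesh T)
    (Vh : Submodule ℝ (VecSob Ω 1)) (Qh : Submodule ℝ (L2 Ω)) (f : ℝ → VecL2 Ω)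
    (U : ℝ → VecSob Ω 1) (P : ℝ → L2 Ω) (Ut : ℕ → ℝ → VecSob Ω 1) (Pt : ℕ → ℝ → L2 Ω) : Prop :=
  ∀ n < M.N, IsLocalPostProcessing (M.t n) (M.t (n + 1)) Vh Qh f U P (Ut n) (Pt n)

/-! ## Discrete errors -/

/-- The discrete velocity error `e^u_{τ,h} = R_h^u(R_τ^1 u, R_τ^1 p) - u_{τ,h}`. -/
def discreteError {d : ℕ} {Ω : Opens (Pt d)} {T : ℝ} (M : TimeMesh T)
    (Vh : Submodule ℝ (VecSob Ω 1)) (Qh : Submodule ℝ (L2 Ω)) {r : ℕ}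
    (u : ℝ → VecSob Ω (r + 1)) (p : ℝ → Sob Ω r) (U : ℝ → VecSob Ω 1) (s : ℝ) : VecSob Ω 1 :=
  (stokesProj Vh Qh ((M.interp u s).toH1 (Nat.le_add_left 1 r)) (M.interp p s).toL2).1 - U s

/-- The discrete error of the time derivative,
`E^u_{τ,h} = R_h^u(R_τ^1 ∂ₜu, R_τ^1 ∂ₜp) - ∂ₜũ_{τ,h}`. -/
def discreteDerivError {d : ℕ} {Ω : Opens (Pt d)} {T : ℝ} (M : TimeMesh T)
    (Vh : Submodule ℝ (VecSob Ω 1)) (Qh : Submodule ℝ (L2 Ω)) {r : ℕ}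
    (u : ℝ → VecSob Ω (r + 1)) (p : ℝ → Sob Ω r) (Ut : ℕ → ℝ → VecSob Ω 1) (s : ℝ) :
    VecSob Ω 1 :=
  (stokesProj Vh Qh ((M.interp (derivWithin u (Icc 0 T)) s).toH1 (Nat.le_add_left 1 r))
    (M.interp (derivWithin p (Icc 0 T)) s).toL2).1
  - M.glue (fun n => derivWithin (Ut n) (M.Ibar n)) s

end

end StokesFE

/-! Structure of the post-processing. On each interval `bubble` has slopes 1 and -1 at the end
points and slope 0 at the midpoint. The correction therefore changes neither the mean of the two end
slopes of the velocity nor the midpoint value of the pressure. Together with the scheme, collocation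
at the left end thus forces collocation at the right end (`IsLocalPostProcessing.nodal`). The
collocation equation at `t n` determines the velocity derivative and the pressure from `U (t n)`
alone (`nodal_unique`), so neighbouring pieces agree at mesh points and the pressure is continuous.
Averaging the two nodal equations of an interval gives back the scheme, which is now a trapezoidal
rule for nodal values `z n`, `π n` (`IsNodal`).

Error analysis. Let `e n`, `E n`, `η n` be the Stokes projections of `u`, `∂ₜu`, `p` minus the
discrete nodal values. Then `⟨E, v⟩ + a(e, v) + b(v, η) = -⟨ρ, v⟩` with `ρ` the projection error of
`∂ₜu`, and `e (n+1) - e n = τ_n (mean of E + δ n)`. The inf-sup condition bounds `η` by `‖E‖ + ‖ρ‖ +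
‖∇e‖`, so `E` is needed in `L²` in time. Its affine interpolant is controlled by its mean and its
jump on each interval. The mean, and `∇e` with it, comes from testing averaged equations with `e
(n+1) - e n` (`energy_first`). The jump comes from testing differenced equations with the jump
itself (`energy_second`), which is where `τ ‖∇E(0)‖` enters.

The defect `δ n` is the Stokes projection of the exact trapezoidal defect divided by `τ_n`. In `L²`
it is of order `τ²` up to projection error, thanks to the extra time regularity there. In the
stronger norms only order `τ` is available, but on `V_h^div` the functional `a(δ n, ·)` is an `L²`
product with the Stokes operator applied to the exact defect, and `energy_second` supplies another
factor `τ`. The term `h^r` comes from quasi-optimality of the Stokes projection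
(`IsStokesProj.quasi_optimal`) and the Poincaré inequality. -/

namespace StokesFE

noncomputable section

variable {d : ℕ} {Ω : Opens (Pt d)} {m : ℕ}

/-! ## Continuous linear maps between the function spaces -/

/-- The weak derivative with index `a`, as a continuous linear map `H^m(Ω) → L²(Ω)`. -/
def Sob.jetL (a : DerivIdx d m) : Sob Ω m →L[ℝ] L2 Ω :=
  (PiLp.proj 2 (fun _ : DerivIdx d m => L2 Ω) a).comp Sob.jet.toContinuousLinearMap

/-- A family of continuous linear maps into Hilbert spaces, as a map into their `ℓ²` product. -/
def piL {ι E F : Type*} [Fintype ι] [NormedAddCommGroup E] [NormedSpace ℝ E]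
    [NormedAddCommGroup F] [NormedSpace ℝ F] (A : ι → E →L[ℝ] F) :
    E →L[ℝ] PiLp 2 (fun _ : ι => F) :=
  (PiLp.continuousLinearEquiv 2 ℝ (fun _ : ι => F)).symm.toContinuousLinearMap.comp
    (ContinuousLinearMap.pi A)

theorem piL_apply {ι E F : Type*} [Fintype ι] [NormedAddCommGroup E] [NormedSpace ℝ E]
    [NormedAddCommGroup F] [NormedSpace ℝ F] (A : ι → E →L[ℝ] F) (x : E) (i : ι) :
    piL A x i = A i x := rfl

/-- The first weak partial derivative as a continuous linear map. -/
def Sob.partialL (hm : 1 ≤ m) (i : Fin d) : Sob Ω m →L[ℝ] L2 Ω :=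
  Sob.jetL ⟨⟨1, Nat.lt_succ_of_le hm⟩, fun _ => i⟩

/-- The embedding `H^m(Ω) → H^1(Ω)` as a continuous linear map. -/
def Sob.restrictL (hm : 1 ≤ m) : Sob Ω m →L[ℝ] Sob Ω 1 where
  toLinearMap := Sob.restrict hm
  cont := by
    refine (Sob.jet (Ω := Ω) (m := 1)).isometry.isUniformInducing.isInducing.continuous_iff.2 ?_
    exact (PiLp.continuous_toLp 2 (fun _ : DerivIdx d 1 => L2 Ω)).comp (continuous_pi fun a =>
      (Sob.jetL (Ω := Ω) ⟨Fin.castLE (Nat.succ_le_succ hm) a.1, a.2⟩).continuous)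

/-- The underlying `L²` vector field as a continuous linear map. -/
def VecSob.toL2L : VecSob Ω m →L[ℝ] VecL2 Ω :=
  piL fun i => (Sob.jetL (DerivIdx.zero d m)).comp (PiLp.proj 2 (fun _ : Fin d => Sob Ω m) i)

theorem VecSob.toL2L_apply (v : VecSob Ω m) : VecSob.toL2L v = v.toL2 := rfl

/-- The embedding `H^m(Ω)^d → H^1(Ω)^d` as a continuous linear map. -/
def VecSob.toH1L (hm : 1 ≤ m) : VecSob Ω m →L[ℝ] VecSob Ω 1 :=
  piL fun i => (Sob.restrictL hm).comp (PiLp.proj 2 (fun _ : Fin d => Sob Ω m) i)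

/-- The weak gradient of a vector field. -/
def gradL : VecSob Ω 1 →L[ℝ] PiLp 2 (fun _ : Fin d × Fin d => L2 Ω) :=
  piL fun k => (Sob.partialL le_rfl k.2).comp (PiLp.proj 2 (fun _ : Fin d => Sob Ω 1) k.1)

/-- The divergence as a continuous linear map. -/
def divL : VecSob Ω 1 →L[ℝ] L2 Ω :=
  ∑ i : Fin d, (Sob.partialL le_rfl i).comp (PiLp.proj 2 (fun _ : Fin d => Sob Ω 1) i)

theorem divL_apply (v : VecSob Ω 1) : divL v = div v := by
  simp only [divL, _root_.sum_apply]
  rfl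

theorem aForm_eq_inner (u v : VecSob Ω 1) : aForm u v = inner ℝ (gradL u) (gradL v) := by
  rw [PiLp.inner_apply, Fintype.sum_prod_type]
  rfl

theorem gradNorm_eq (v : VecSob Ω 1) : gradNorm v = ‖gradL v‖ := by
  rw [gradNorm, aForm_eq_inner, real_inner_self_eq_norm_sq, Real.sqrt_sq (norm_nonneg _)]

theorem bForm_eq_inner (v : VecSob Ω 1) (q : L2 Ω) : bForm v q = -inner ℝ (divL v) q := by
  rw [divL_apply]; rfl

theorem Sob.norm_sq_eq (v : Sob Ω 1) :
    ‖v‖ ^ 2 = ‖v.toL2‖ ^ 2 + ∑ i : Fin d, ‖v.partial le_rfl i‖ ^ 2 := by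
  have h : ‖v‖ = ‖v.jet‖ := (Sob.jet.norm_map v).symm
  rw [h, PiLp.norm_sq_eq_of_L2, Fintype.sum_sigma]
  -- The derivative indices split into order 0, a single empty word, and order 1, words of length
  -- one, identified with `Fin d`.
  erw [Fin.sum_univ_two]
  congr 1
  · exact Fintype.sum_unique (ι := Fin 0 → Fin d) _
  · exact Fintype.sum_equiv (Equiv.funUnique (Fin 1) (Fin d)) _ _ fun w => by
      have : w = fun _ => w 0 := funext fun k => by rw [Subsingleton.elim k 0]
      conv_lhs => rw [this]
      rfl

theorem norm_sq_eq_toL2_add_grad (v : VecSob Ω 1) :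
    ‖v‖ ^ 2 = ‖v.toL2‖ ^ 2 + ‖gradL v‖ ^ 2 := by
  rw [PiLp.norm_sq_eq_of_L2, PiLp.norm_sq_eq_of_L2, PiLp.norm_sq_eq_of_L2, Fintype.sum_prod_type,
    ← Finset.sum_add_distrib]
  exact Finset.sum_congr rfl fun i _ => Sob.norm_sq_eq (v i)

theorem norm_toL2_le (v : VecSob Ω 1) : ‖v.toL2‖ ≤ ‖v‖ :=
  (sq_le_sq₀ (norm_nonneg _) (norm_nonneg _)).1 (by rw [norm_sq_eq_toL2_add_grad]; nlinarith [sq_nonneg ‖gradL v‖])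

theorem norm_gradL_le (v : VecSob Ω 1) : ‖gradL v‖ ≤ ‖v‖ :=
  (sq_le_sq₀ (norm_nonneg _) (norm_nonneg _)).1 (by rw [norm_sq_eq_toL2_add_grad]; nlinarith [sq_nonneg ‖v.toL2‖])

theorem norm_div_le (v : VecSob Ω 1) : ‖divL v‖ ≤ d * ‖gradL v‖ := by
  rw [divL_apply]
  calc ‖div v‖ ≤ ∑ i : Fin d, ‖(v i).partial le_rfl i‖ := norm_sum_le _ _
    _ ≤ ∑ _i : Fin d, ‖gradL v‖ := Finset.sum_le_sum fun i _ => PiLp.norm_apply_le (gradL v) (i, i)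
    _ = d * ‖gradL v‖ := by simp

/-! ## Test functions, weak derivatives and the Poincaré inequality -/

theorem testDeriv_one (w : Fin 1 → Fin d) (φ : 𝓓(Ω, ℝ)) (x : Pt d) :
    testDeriv w φ x = fderiv ℝ φ x (EuclideanSpace.single (w 0) (1 : ℝ)) := by
  change (TestFunction.lineDerivCLM ℝ (EuclideanSpace.single (w 0) (1 : ℝ)) φ : 𝓓(Ω, ℝ)) x = _
  rw [TestFunction.lineDerivCLM_apply_of_le (by simp)]
  exact (φ.contDiff.differentiable (by simp)).differentiableAt.lineDeriv_eq_fderiv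

theorem testDeriv_const_two (i : Fin d) (φ : 𝓓(Ω, ℝ)) :
    testDeriv (fun _ : Fin 2 => i) φ = testDeriv (fun _ : Fin 1 => i) (testDeriv (fun _ : Fin 1 => i) φ) :=
  rfl

theorem testDeriv_add {j : ℕ} (w : Fin j → Fin d) (φ ψ : 𝓓(Ω, ℝ)) :
    testDeriv w (φ + ψ) = testDeriv w φ + testDeriv w ψ :=
  LineDeriv.iteratedLineDerivOp_add _ _ _

theorem testDeriv_smul {j : ℕ} (w : Fin j → Fin d) (c : ℝ) (φ : 𝓓(Ω, ℝ)) :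
    testDeriv w (c • φ) = c • testDeriv w φ :=
  LineDeriv.iteratedLineDerivOp_smul _ _ _

/-- `v ∈ H^1(Ω)` is the class of the test function `φ`. -/
def IsTest (v : Sob Ω 1) (φ : 𝓓(Ω, ℝ)) : Prop :=
  ∀ a : DerivIdx d 1, v.jet a =ᵐ[volume.restrict (Ω : Set (Pt d))] testDeriv a.2 φ

theorem exists_isTest_of_mem_span {v : Sob Ω 1}
    (hv : v ∈ Submodule.span ℝ {v : Sob Ω 1 | ∃ φ : 𝓓(Ω, ℝ), IsTest v φ}) :
    ∃ φ : 𝓓(Ω, ℝ), IsTest v φ := by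
  induction hv using Submodule.span_induction with
  | mem x h => exact h
  | zero =>
    refine ⟨0, fun a => ?_⟩
    have h0 : testDeriv a.2 (0 : 𝓓(Ω, ℝ)) = 0 := LineDeriv.iteratedLineDerivOp_zero _
    rw [map_zero, h0]
    exact Lp.coeFn_zero ℝ 2 (volume.restrict (Ω : Set (Pt d)))
  | add x y _ _ hx hy =>
    obtain ⟨φ, hφ⟩ := hx
    obtain ⟨ψ, hψ⟩ := hy
    refine ⟨φ + ψ, fun a => ?_⟩
    rw [map_add, testDeriv_add]
    filter_upwards [hφ a, hψ a, Lp.coeFn_add (x.jet a) (y.jet a)] with z h1 h2 h3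
    rw [PiLp.add_apply, h3, Pi.add_apply, h1, h2]; rfl
  | smul c x _ hx =>
    obtain ⟨φ, hφ⟩ := hx
    refine ⟨c • φ, fun a => ?_⟩
    rw [map_smul, testDeriv_smul]
    filter_upwards [hφ a, Lp.coeFn_smul c (x.jet a)] with z h1 h2
    rw [PiLp.smul_apply, h2, Pi.smul_apply, h1]; rfl

/-- A closed property that holds for test functions holds on `H^1_0(Ω)`. -/
theorem H10_induction {P : Sob Ω 1 → Prop} (hP : IsClosed {v | P v})
    (h : ∀ (v : Sob Ω 1) (φ : 𝓓(Ω, ℝ)), IsTest v φ → P v) {v : Sob Ω 1} (hv : v ∈ H10 Ω) :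
    P v := by
  have : v ∈ {v | P v} := by
    refine closure_minimal ?_ hP (show v ∈ closure _ from hv)
    intro x hx
    obtain ⟨φ, hφ⟩ := exists_isTest_of_mem_span hx
    exact h x φ hφ
  exact this

theorem inner_eq_integral (a b : L2 Ω) :
    inner ℝ a b = ∫ x in (Ω : Set (Pt d)), a x * b x := by
  rw [MeasureTheory.L2.inner_def]
  exact integral_congr_ae (Filter.Eventually.of_forall fun x => by simp [mul_comm])

theorem IsTest.toL2_ae {v : Sob Ω 1} {φ : 𝓓(Ω, ℝ)} (h : IsTest v φ) :
    v.toL2 =ᵐ[volume.restrict (Ω : Set (Pt d))] φ := h (DerivIdx.zero d 1)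

theorem IsTest.partial_ae {v : Sob Ω 1} {φ : 𝓓(Ω, ℝ)} (h : IsTest v φ) (i : Fin d) :
    v.partial le_rfl i =ᵐ[volume.restrict (Ω : Set (Pt d))] testDeriv (fun _ : Fin 1 => i) φ :=
  h ⟨1, fun _ => i⟩

/-- Integration by parts against `H^1_0(Ω)`. -/
theorem inner_partial_of_hasWeakDeriv {i : Fin d} {g g' : L2 Ω}
    (hg : HasWeakDeriv Ω (fun _ : Fin 1 => i) g g') {v : Sob Ω 1} (hv : v ∈ H10 Ω) :
    inner ℝ g (v.partial le_rfl i) = -inner ℝ g' v.toL2 := by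
  refine H10_induction (P := fun v => inner ℝ g (v.partial le_rfl i) = -inner ℝ g' v.toL2) ?_ ?_ hv
  · exact isClosed_eq (continuous_const.inner (Sob.partialL le_rfl i).continuous)
      (continuous_const.inner (Sob.jetL (DerivIdx.zero d 1)).continuous).neg
  · intro v φ h
    have h1 := hg φ
    rw [pow_one, neg_one_mul] at h1
    rw [inner_eq_integral, inner_eq_integral]
    refine Eq.trans ?_ (h1.trans ?_)
    · exact integral_congr_ae ((h.partial_ae i).mono fun x hx => by simp only [hx])
    · exact congrArg _ (integral_congr_ae (h.toL2_ae.mono fun x hx => by simp only [hx]))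

theorem Sob.hasWeakDeriv_partial (hm : 1 ≤ m) (i : Fin d) (v : Sob Ω m) :
    HasWeakDeriv Ω (fun _ : Fin 1 => i) v.toL2 (v.partial hm i) :=
  v.2 ⟨⟨1, Nat.lt_succ_of_le hm⟩, fun _ => i⟩

/-- Testing the first derivative with `∂_i φ` compares the two orders: the second-order entry of the
jet is the weak derivative of the first-order one. -/
theorem Sob.hasWeakDeriv_second (hm : 2 ≤ m) (i : Fin d) (v : Sob Ω m) :
    HasWeakDeriv Ω (fun _ : Fin 1 => i) (v.partial (one_le_two.trans hm) i)
      (v.jet ⟨⟨2, Nat.lt_succ_of_le hm⟩, fun _ => i⟩) := by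
  intro φ
  have h1 := v.hasWeakDeriv_partial (one_le_two.trans hm) i (testDeriv (fun _ : Fin 1 => i) φ)
  have h2 : ∫ x in (Ω : Set (Pt d)), v.toL2 x * testDeriv (fun _ : Fin 2 => i) φ x =
      (-1) ^ 2 * ∫ x in (Ω : Set (Pt d)), (v.jet ⟨⟨2, Nat.lt_succ_of_le hm⟩, fun _ => i⟩) x * φ x :=
    v.2 ⟨⟨2, Nat.lt_succ_of_le hm⟩, fun _ => i⟩ φ
  rw [testDeriv_const_two, h1] at h2
  linarith

theorem eq_zero_of_forall_test {g : L2 Ω}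
    (h : ∀ φ : 𝓓(Ω, ℝ), ∫ x in (Ω : Set (Pt d)), g x * φ x = 0) : g = 0 := by
  refine (Lp.eq_zero_iff_ae_eq_zero).2 ?_
  have hloc : LocallyIntegrableOn (g : Pt d → ℝ) (Ω : Set (Pt d)) volume :=
    locallyIntegrableOn_of_locallyIntegrable_restrict
      ((Lp.memLp g).locallyIntegrable (by norm_num))
  have := Ω.isOpen.ae_eq_zero_of_integral_contDiff_smul_eq_zero hloc fun φ hφ hc hs => by
    rw [← h ⟨φ, hφ, hc, hs⟩, ← setIntegral_eq_integral_of_forall_compl_eq_zero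
      (s := (Ω : Set (Pt d)))]
    · exact integral_congr_ae (Filter.Eventually.of_forall fun x => mul_comm _ _)
    · intro x hx
      rw [image_eq_zero_of_notMem_tsupport fun hx' => hx (hs hx'), zero_smul]
  exact (ae_restrict_iff' Ω.isOpen.measurableSet).2 this

theorem Sob.partial_eq_zero {v : Sob Ω 1} (h : v.toL2 = 0) (i : Fin d) :
    v.partial le_rfl i = 0 := by
  refine eq_zero_of_forall_test fun φ => ?_
  have h1 := v.hasWeakDeriv_partial le_rfl i φ
  have h0 : ∫ x in (Ω : Set (Pt d)), v.toL2 x * testDeriv (fun _ : Fin 1 => i) φ x = 0 := by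
    refine integral_eq_zero_of_ae ?_
    rw [h]
    filter_upwards [Lp.coeFn_zero ℝ 2 (volume.restrict (Ω : Set (Pt d)))] with x hx
    rw [hx]; simp
  rw [h0] at h1
  linarith

/-- Weak derivatives are determined by the function, so the `L²` product is definite on `H^1`. This
makes the mass matrix of a discrete space invertible. -/
theorem VecSob.eq_zero_of_toL2 {v : VecSob Ω 1} (h : v.toL2 = 0) : v = 0 := by
  have h2 : gradL v = 0 := by
    ext1 k
    exact Sob.partial_eq_zero (congrArg (fun w : VecL2 Ω => w k.1) h) k.2
  have h3 := norm_sq_eq_toL2_add_grad v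
  rw [h, h2] at h3
  simpa using h3

/-- The product of a coordinate and a test function. -/
def coordMul (i : Fin d) (φ : 𝓓(Ω, ℝ)) : 𝓓(Ω, ℝ) where
  toFun x := x i * φ x
  contDiff' := by
    have := φ.contDiff
    fun_prop
  hasCompactSupport' := φ.hasCompactSupport.mul_left
  tsupport_subset' := (tsupport_mul_subset_right).trans φ.tsupport_subset

theorem coordMul_apply (i : Fin d) (φ : 𝓓(Ω, ℝ)) (x : Pt d) : coordMul i φ x = x i * φ x := rfl

theorem testDeriv_coordMul (i : Fin d) (φ : 𝓓(Ω, ℝ)) (x : Pt d) :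
    testDeriv (fun _ : Fin 1 => i) (coordMul i φ) x =
      φ x + x i * testDeriv (fun _ : Fin 1 => i) φ x := by
  rw [testDeriv_one, testDeriv_one]
  have h1 : HasFDerivAt (fun y : Pt d => y i) (EuclideanSpace.proj i : Pt d →L[ℝ] ℝ) x :=
    (EuclideanSpace.proj i : Pt d →L[ℝ] ℝ).hasFDerivAt
  have h2 : HasFDerivAt φ (fderiv ℝ φ x) x :=
    (φ.contDiff.differentiable (by simp)).differentiableAt.hasFDerivAt
  have h3 : HasFDerivAt (coordMul i φ) _ x := h1.mul h2
  rw [h3.fderiv]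
  simp
  ring

theorem norm_sq_eq_integral (a : L2 Ω) :
    ‖a‖ ^ 2 = ∫ x in (Ω : Set (Pt d)), a x * a x := by
  rw [← inner_eq_integral, real_inner_self_eq_norm_sq]

/-- Integration by parts against `x_i φ` gives `∫ φ² = -2 ∫ x_i φ ∂_i φ`, and `|x_i| ≤ R` on `Ω`. -/
theorem poincare_test {R : ℝ} (hR : ∀ x ∈ (Ω : Set (Pt d)), ‖x‖ ≤ R) (i : Fin d) {v : Sob Ω 1}
    {φ : 𝓓(Ω, ℝ)} (h : IsTest v φ) :
    ‖v.toL2‖ ^ 2 ≤ (2 * R) ^ 2 * ‖v.partial le_rfl i‖ ^ 2 := by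
  set w : Fin 1 → Fin d := fun _ => i with hw
  have hψ : ∀ ψ χ : 𝓓(Ω, ℝ), Integrable (fun x => ψ x * χ x) (volume.restrict (Ω : Set (Pt d))) :=
    fun ψ χ => MemLp.integrable_mul (p := 2) (q := 2)
      ((ψ.continuous.memLp_of_hasCompactSupport ψ.hasCompactSupport).restrict _)
      ((χ.continuous.memLp_of_hasCompactSupport χ.hasCompactSupport).restrict _)
  have key := v.hasWeakDeriv_partial le_rfl i (coordMul i φ)
  have e1 : ∫ x in (Ω : Set (Pt d)), v.toL2 x * testDeriv w (coordMul i φ) x =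
      (∫ x in (Ω : Set (Pt d)), φ x * φ x) +
        ∫ x in (Ω : Set (Pt d)), coordMul i φ x * testDeriv w φ x := by
    rw [← integral_add (hψ φ φ) (hψ _ _)]
    refine integral_congr_ae (h.toL2_ae.mono fun x hx => ?_)
    simp only [hx, hw, testDeriv_coordMul, coordMul_apply]
    ring
  have e2 : ∫ x in (Ω : Set (Pt d)), (v.partial le_rfl i) x * coordMul i φ x =
      ∫ x in (Ω : Set (Pt d)), coordMul i φ x * testDeriv w φ x := by
    refine integral_congr_ae ((h.partial_ae i).mono fun x hx => ?_)
    simp only [hx, hw, mul_comm]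
  rw [e1, e2] at key
  have n1 : ‖v.toL2‖ ^ 2 = ∫ x in (Ω : Set (Pt d)), φ x * φ x := by
    rw [norm_sq_eq_integral]
    exact integral_congr_ae (h.toL2_ae.mono fun x hx => by simp only [hx])
  have n2 : ‖v.partial le_rfl i‖ ^ 2 =
      ∫ x in (Ω : Set (Pt d)), testDeriv w φ x * testDeriv w φ x := by
    rw [norm_sq_eq_integral]
    exact integral_congr_ae ((h.partial_ae i).mono fun x hx => by simp only [hx, hw])
  -- Young's inequality with weight `1/2`, so that half of `∫ φ²` is absorbed and the constant
  -- becomes `4 R²`.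
  have bound : -2 * ∫ x in (Ω : Set (Pt d)), coordMul i φ x * testDeriv w φ x ≤
      (1 / 2) * (∫ x in (Ω : Set (Pt d)), φ x * φ x) +
        2 * R ^ 2 * ∫ x in (Ω : Set (Pt d)), testDeriv w φ x * testDeriv w φ x := by
    rw [← integral_const_mul, ← integral_const_mul, ← integral_const_mul,
      ← integral_add ((hψ φ φ).const_mul _) ((hψ _ _).const_mul _)]
    refine setIntegral_mono_on ((hψ _ _).const_mul _)
      (((hψ φ φ).const_mul _).add ((hψ _ _).const_mul _)) Ω.isOpen.measurableSet fun x hx => ?_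
    have hxi : |x i| ≤ R := (PiLp.norm_apply_le x i).trans (hR x hx)
    have hxi2 : x i ^ 2 ≤ R ^ 2 := sq_le_sq' (abs_le.1 hxi).1 (abs_le.1 hxi).2
    simp only [coordMul_apply]
    nlinarith [sq_nonneg (φ x + 2 * (x i * testDeriv w φ x)),
      mul_le_mul_of_nonneg_right hxi2 (sq_nonneg (testDeriv w φ x))]
  rw [n1, n2]
  norm_num at key
  linarith

/-- The Poincaré inequality on `H^1_0(Ω)`. -/
theorem poincare_H10 {R : ℝ} (hR : ∀ x ∈ (Ω : Set (Pt d)), ‖x‖ ≤ R) (i : Fin d) {v : Sob Ω 1}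
    (hv : v ∈ H10 Ω) : ‖v.toL2‖ ^ 2 ≤ (2 * R) ^ 2 * ‖v.partial le_rfl i‖ ^ 2 :=
  H10_induction (P := fun v => ‖v.toL2‖ ^ 2 ≤ (2 * R) ^ 2 * ‖v.partial le_rfl i‖ ^ 2)
    (isClosed_le ((Sob.jetL (DerivIdx.zero d 1)).continuous.norm.pow 2)
      (((Sob.partialL le_rfl i).continuous.norm.pow 2).const_mul _))
    (fun _ _ h => poincare_test hR i h) hv

/-- One direction of differentiation suffices; direction 0 is used for every component, which
requires `0 < d`. -/
theorem exists_poincare (hd : 0 < d) (hbdd : Bornology.IsBounded (Ω : Set (Pt d))) :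
    ∃ CP : ℝ, 0 < CP ∧ ∀ v ∈ V Ω, ‖v.toL2‖ ≤ CP * ‖gradL v‖ := by
  obtain ⟨R, hR0, hR⟩ := hbdd.exists_pos_norm_le
  refine ⟨2 * R, by positivity, fun v hv => ?_⟩
  refine (sq_le_sq₀ (norm_nonneg _) (by positivity)).1 ?_
  rw [mul_pow, PiLp.norm_sq_eq_of_L2, PiLp.norm_sq_eq_of_L2, Fintype.sum_prod_type, Finset.mul_sum]
  refine Finset.sum_le_sum fun i _ => (poincare_H10 hR ⟨0, hd⟩ (hv i)).trans ?_
  refine mul_le_mul_of_nonneg_left ?_ (by positivity)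
  exact Finset.single_le_sum (f := fun j => ‖gradL v (i, j)‖ ^ 2) (fun j _ => by positivity)
    (Finset.mem_univ (⟨0, hd⟩ : Fin d))

theorem isClosed_V : IsClosed (V Ω : Set (VecSob Ω 1)) := by
  have : (V Ω : Set (VecSob Ω 1)) = ⋂ i : Fin d, (fun v : VecSob Ω 1 => v i) ⁻¹' (H10 Ω) := by
    ext v
    rw [mem_iInter]; rfl
  rw [this]
  exact isClosed_iInter fun i => (Submodule.isClosed_topologicalClosure _).preimage
    (PiLp.proj (𝕜 := ℝ) 2 (fun _ : Fin d => Sob Ω 1) i).continuous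

/-- The operator `(w, q) ↦ -Δw + ∇q`. -/
def stokesOp {r : ℕ} (hr : 1 ≤ r) : VecSob Ω (r + 1) × Sob Ω r →L[ℝ] VecL2 Ω :=
  piL fun i =>
    (Sob.partialL hr i).comp (ContinuousLinearMap.snd ℝ _ _) -
      ∑ j : Fin d, ((Sob.jetL ⟨⟨2, Nat.lt_succ_of_le (Nat.succ_le_succ hr)⟩, fun _ => j⟩).comp
        (PiLp.proj 2 (fun _ : Fin d => Sob Ω (r + 1)) i)).comp (ContinuousLinearMap.fst ℝ _ _)

theorem stokesOp_apply {r : ℕ} (hr : 1 ≤ r) (w : VecSob Ω (r + 1)) (q : Sob Ω r) (i : Fin d) :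
    stokesOp hr (w, q) i =
      q.partial hr i - (w i).laplacian (Nat.succ_le_succ hr) := by
  simp only [stokesOp, piL_apply, _root_.sub_apply, _root_.sum_apply]
  rfl

/-- Componentwise integration by parts against `H^1_0`. It gives the weak form of the momentum
equation, and it shows that `a(w, ·) + b(·, q)` is bounded in the `L²` norm of the test function, as
needed for the defect in `energy_second`. -/
theorem inner_stokesOp {r : ℕ} (hr : 1 ≤ r) (w : VecSob Ω (r + 1)) (q : Sob Ω r)
    {v : VecSob Ω 1} (hv : v ∈ V Ω) :
    inner ℝ (stokesOp hr (w, q)) v.toL2 =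
      aForm (w.toH1 (Nat.le_add_left 1 r)) v + bForm v q.toL2 := by
  rw [PiLp.inner_apply, aForm, bForm, div, sum_inner, ← Finset.sum_neg_distrib,
    ← Finset.sum_add_distrib]
  refine Finset.sum_congr rfl fun i _ => ?_
  rw [stokesOp_apply, inner_sub_left, Sob.laplacian, sum_inner]
  have h1 := inner_partial_of_hasWeakDeriv (q.hasWeakDeriv_partial hr i) (hv i)
  have h2 : ∀ j : Fin d, inner ℝ ((w.toH1 (Nat.le_add_left 1 r) i).partial le_rfl j)
      ((v i).partial le_rfl j) = -inner ℝ
      ((w i).jet ⟨⟨2, Nat.lt_succ_of_le (Nat.succ_le_succ hr)⟩, fun _ => j⟩) (v i).toL2 := fun j =>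
    inner_partial_of_hasWeakDeriv ((w i).hasWeakDeriv_second (Nat.succ_le_succ hr) j) (hv i)
  rw [Finset.sum_congr rfl fun j _ => h2 j, Finset.sum_neg_distrib,
    real_inner_comm q.toL2, h1]
  change inner ℝ (q.partial hr i) (v i).toL2 - ∑ j : Fin d, inner ℝ ((w i).jet
    ⟨⟨2, Nat.lt_succ_of_le (Nat.succ_le_succ hr)⟩, fun _ => j⟩) (v i).toL2 = _
  ring

end

end StokesFE

namespace StokesFE

noncomputable section

variable {d : ℕ} {Ω : Opens (Pt d)}

/-! ## Finite-dimensional saddle point problems -/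

/-- The Gram map `W → W*` is injective because `G` is, hence surjective by equality of dimensions.
It is applied with `G` the gradient (Stokes projection) and with `G` the embedding into `L²`
(collocation). -/
theorem exists_inner_representative {X H : Type*} [AddCommGroup X] [Module ℝ X]
    [NormedAddCommGroup H] [InnerProductSpace ℝ H] (G : X →ₗ[ℝ] H) (W : Submodule ℝ X)
    [FiniteDimensional ℝ W] (hG : ∀ x ∈ W, G x = 0 → x = 0) (l : X →ₗ[ℝ] ℝ) :
    ∃ x ∈ W, ∀ v ∈ W, inner ℝ (G x) (G v) = l v := by
  let A : W →ₗ[ℝ] Module.Dual ℝ W := (innerₗ H).compl₁₂ (G.comp W.subtype) (G.comp W.subtype)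
  have hA : Function.Injective A := by
    refine (injective_iff_map_eq_zero A).2 fun x hx => ?_
    have h1 : inner ℝ (G x) (G x) = (0 : ℝ) := congrArg (fun k : Module.Dual ℝ W => k x) hx
    exact Subtype.ext (hG x x.2 (inner_self_eq_zero.1 h1))
  obtain ⟨x, hx⟩ := (LinearMap.injective_iff_surjective_of_finrank_eq_finrank
    (Subspace.dual_finrank_eq (K := ℝ) (V := W)).symm).1 hA (l.comp W.subtype)
  exact ⟨x, x.2, fun v hv => congrArg (fun k : Module.Dual ℝ W => k ⟨v, hv⟩) hx⟩

/-- The form `b` as a bilinear map. -/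
def bLin : VecSob Ω 1 →ₗ[ℝ] L2 Ω →ₗ[ℝ] ℝ := -(innerₗ (L2 Ω)).comp divL.toLinearMap

theorem bLin_apply (v : VecSob Ω 1) (q : L2 Ω) : bLin v q = bForm v q := by
  rw [bForm_eq_inner]; rfl

theorem bForm_sub_left (v w : VecSob Ω 1) (q : L2 Ω) :
    bForm (v - w) q = bForm v q - bForm w q := by
  simp only [← bLin_apply, map_sub, LinearMap.sub_apply]

theorem bForm_sub_right (v : VecSob Ω 1) (q s : L2 Ω) :
    bForm v (q - s) = bForm v q - bForm v s := by
  simp only [← bLin_apply, map_sub]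

theorem bForm_add_right (v : VecSob Ω 1) (q s : L2 Ω) :
    bForm v (q + s) = bForm v q + bForm v s := by
  simp only [← bLin_apply, map_add]

theorem bForm_smul_right (c : ℝ) (v : VecSob Ω 1) (q : L2 Ω) :
    bForm v (c • q) = c * bForm v q := by
  simp only [← bLin_apply, map_smul, smul_eq_mul]

theorem abs_bForm_le (v : VecSob Ω 1) (q : L2 Ω) : |bForm v q| ≤ d * ‖gradL v‖ * ‖q‖ := by
  rw [bForm_eq_inner, abs_neg]
  exact (abs_real_inner_le_norm _ _).trans
    (mul_le_mul_of_nonneg_right (norm_div_le v) (norm_nonneg _))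

variable {Vh : Submodule ℝ (VecSob Ω 1)} {Qh : Submodule ℝ (L2 Ω)}

/-- A functional on `V_h` that vanishes on `V_h^div` is of the form `b(·, y)` with `y ∈ Q_h`. -/
theorem exists_pressure [FiniteDimensional ℝ Vh] [FiniteDimensional ℝ Qh]
    (l : VecSob Ω 1 →ₗ[ℝ] ℝ) (hl : ∀ v ∈ discDivFree Vh Qh, l v = 0) :
    ∃ y ∈ Qh, ∀ v ∈ Vh, bForm v y = l v := by
  let F : Vh →ₗ[ℝ] Module.Dual ℝ Qh := bLin.compl₁₂ Vh.subtype Qh.subtype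
  -- The range of the transpose is the annihilator of the kernel, and the kernel is `V_h^div`.
  -- Reflexivity of the finite-dimensional `Q_h` then turns the preimage into an element `y`. The
  -- inf-sup condition is not needed for existence.
  have h1 : l.comp Vh.subtype ∈ F.dualMap.range := by
    rw [LinearMap.range_dualMap_eq_dualAnnihilator_ker, Submodule.mem_dualAnnihilator]
    intro w hw
    refine hl w ⟨w.2, fun q hq => ?_⟩
    rw [← bLin_apply]
    exact congrArg (fun k : Module.Dual ℝ Qh => k ⟨q, hq⟩) (LinearMap.mem_ker.1 hw)
  obtain ⟨ψ, hψ⟩ := h1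
  obtain ⟨y, hy⟩ := (Module.evalEquiv ℝ Qh).surjective ψ
  refine ⟨y, y.2, fun v hv => ?_⟩
  have h2 := congrArg (fun k : Module.Dual ℝ Vh => k ⟨v, hv⟩) hψ
  rw [← hy] at h2
  rw [← bLin_apply]
  exact h2

theorem IsFEPair.mul_norm_le {r : ℕ} {β Ca h : ℝ} (hFE : IsFEPair Ω r β Ca h Vh Qh) {y : L2 Ω}
    (hy : y ∈ Qh) {K : ℝ} (hK : 0 ≤ K) (h : ∀ v ∈ Vh, bForm v y ≤ K * ‖v‖) : β * ‖y‖ ≤ K := by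
  rcases eq_or_ne y 0 with rfl | hne
  · simpa using hK
  obtain ⟨v, hv, hv0, hb⟩ := hFE.inf_sup y hy hne
  have p1 : 0 < ‖v‖ := norm_pos_iff.2 hv0
  have p2 : 0 < ‖y‖ := norm_pos_iff.2 hne
  rw [le_div_iff₀ (mul_pos p1 p2)] at hb
  have := hb.trans (h v hv)
  refine le_of_mul_le_mul_right ?_ p1
  linarith

theorem IsFEPair.eq_zero_of_bForm {r : ℕ} {β Ca h : ℝ} (hFE : IsFEPair Ω r β Ca h Vh Qh)
    (hβ : 0 < β) {y : L2 Ω} (hy : y ∈ Qh) (h : ∀ v ∈ Vh, bForm v y = 0) : y = 0 := by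
  have h1 := hFE.mul_norm_le hy le_rfl fun v hv => by rw [h v hv, zero_mul]
  have : ‖y‖ ≤ 0 := by
    by_contra hc
    have := mul_pos hβ (not_le.1 hc)
    linarith
  exact norm_le_zero_iff.1 this

/-- The pressure bound from the inf-sup condition for a functional of the form
`⟨E, ·⟩ + a(e, ·)`. -/
theorem IsFEPair.mul_norm_pressure_le {r : ℕ} {β Ca h : ℝ} (hFE : IsFEPair Ω r β Ca h Vh Qh)
    {y : L2 Ω} (hy : y ∈ Qh) (E : VecL2 Ω) (e : VecSob Ω 1)
    (h : ∀ v ∈ Vh, inner ℝ E v.toL2 + aForm e v + bForm v y = 0) :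
    β * ‖y‖ ≤ ‖E‖ + ‖gradL e‖ := by
  refine hFE.mul_norm_le hy (by positivity) fun v hv => ?_
  have h1 := h v hv
  rw [aForm_eq_inner] at h1
  have h2 := (abs_le.1 (abs_real_inner_le_norm E v.toL2)).1
  have h3 := (abs_le.1 (abs_real_inner_le_norm (gradL e) (gradL v))).1
  have h4 := mul_le_mul_of_nonneg_left (norm_toL2_le v) (norm_nonneg E)
  have h5 := mul_le_mul_of_nonneg_left (norm_gradL_le v) (norm_nonneg (gradL e))
  linarith

theorem discDivFree_le : discDivFree Vh Qh ≤ Vh := fun _ hx => hx.1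

instance [FiniteDimensional ℝ Vh] : FiniteDimensional ℝ (discDivFree Vh Qh) :=
  Submodule.finiteDimensional_of_le discDivFree_le

/-! ## The Stokes projection -/

/-- The velocity is found first on `V_h^div`, where the pressure drops out; the remaining residual
vanishes there and is therefore represented by a pressure. -/
theorem exists_isStokesProj [FiniteDimensional ℝ Vh] [FiniteDimensional ℝ Qh]
    (hV : ∀ v ∈ Vh, gradL v = 0 → v = 0) (w : VecSob Ω 1) (q : L2 Ω) :
    ∃ x, IsStokesProj Vh Qh w q x := by
  let l : VecSob Ω 1 →ₗ[ℝ] ℝ :=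
    (innerₗ _ (gradL w)).comp gradL.toLinearMap + bLin.flip q
  have hl : ∀ v, l v = aForm w v + bForm v q := fun v => by
    rw [aForm_eq_inner, ← bLin_apply]; rfl
  obtain ⟨X, hX, hXv⟩ := exists_inner_representative gradL.toLinearMap (discDivFree Vh Qh)
    (fun x hx => hV x hx.1) l
  obtain ⟨Y, hY, hYv⟩ := exists_pressure (Vh := Vh) (Qh := Qh)
    (l - (innerₗ _ (gradL X)).comp gradL.toLinearMap) fun v hv => sub_eq_zero.2 (hXv v hv).symm
  refine ⟨(X, Y), hX.1, hY, fun v hv => ?_, hX.2⟩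
  have h1 : bForm v Y = l v - inner ℝ (gradL X) (gradL v) := hYv v hv
  rw [← hl, h1, aForm_eq_inner]
  ring

theorem IsStokesProj.add {w₁ w₂ : VecSob Ω 1} {q₁ q₂ : L2 Ω} {x₁ x₂ : VecSob Ω 1 × L2 Ω}
    (h₁ : IsStokesProj Vh Qh w₁ q₁ x₁) (h₂ : IsStokesProj Vh Qh w₂ q₂ x₂) :
    IsStokesProj Vh Qh (w₁ + w₂) (q₁ + q₂) (x₁ + x₂) := by
  refine ⟨Vh.add_mem h₁.1 h₂.1, Qh.add_mem h₁.2.1 h₂.2.1, fun v hv => ?_, fun s hs => ?_⟩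
  · have e₁ := h₁.2.2.1 v hv
    have e₂ := h₂.2.2.1 v hv
    simp only [aForm_eq_inner, Prod.fst_add, Prod.snd_add, map_add, inner_add_left,
      bForm_add_right] at *
    linarith
  · rw [Prod.fst_add, bForm_add, h₁.2.2.2 s hs, h₂.2.2.2 s hs, add_zero]

theorem IsStokesProj.smul (c : ℝ) {w : VecSob Ω 1} {q : L2 Ω} {x : VecSob Ω 1 × L2 Ω}
    (h : IsStokesProj Vh Qh w q x) : IsStokesProj Vh Qh (c • w) (c • q) (c • x) := by
  refine ⟨Vh.smul_mem c h.1, Qh.smul_mem c h.2.1, fun v hv => ?_, fun s hs => ?_⟩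
  · have e := h.2.2.1 v hv
    simp only [aForm_eq_inner, Prod.smul_fst, Prod.smul_snd, map_smul, real_inner_smul_left,
      bForm_smul_right] at *
    linear_combination c * e
  · rw [Prod.smul_fst, bForm_smul, h.2.2.2 s hs, mul_zero]

theorem IsStokesProj.sub {w₁ w₂ : VecSob Ω 1} {q₁ q₂ : L2 Ω} {x₁ x₂ : VecSob Ω 1 × L2 Ω}
    (h₁ : IsStokesProj Vh Qh w₁ q₁ x₁) (h₂ : IsStokesProj Vh Qh w₂ q₂ x₂) :
    IsStokesProj Vh Qh (w₁ - w₂) (q₁ - q₂) (x₁ - x₂) := by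
  have := h₁.add (h₂.smul (-1))
  simpa only [neg_one_smul, ← sub_eq_add_neg] using this

theorem IsStokesProj.mem_discDivFree {w : VecSob Ω 1} {q : L2 Ω} {x : VecSob Ω 1 × L2 Ω}
    (h : IsStokesProj Vh Qh w q x) : x.1 ∈ discDivFree Vh Qh := ⟨h.1, h.2.2.2⟩

/-- Quasi-optimality of the Stokes projection of a divergence-free field. -/
theorem IsStokesProj.quasi_optimal {r : ℕ} {β Ca h : ℝ} (hβ : 0 < β)
    (hFE : IsFEPair Ω r β Ca h Vh Qh) {w : VecSob Ω 1} {q : L2 Ω} {x : VecSob Ω 1 × L2 Ω}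
    (hx : IsStokesProj Vh Qh w q x) (hw : div w = 0) {i : VecSob Ω 1} (hi : i ∈ Vh) {j : L2 Ω}
    (hj : j ∈ Qh) {e : ℝ} (h1 : ‖gradL (w - i)‖ ≤ e) (h2 : ‖q - j‖ ≤ e) :
    ‖gradL (w - x.1)‖ ≤ (1 + (2 + d / β) * (1 + d)) * e ∧
      ‖q - x.2‖ ≤ (1 + (3 + d / β) * (1 + d) / β) * e := by
  have he : 0 ≤ e := (norm_nonneg _).trans h1
  set X := x.1 - i with hX
  set Y := x.2 - j with hY
  have hXV : X ∈ Vh := Vh.sub_mem hx.1 hi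
  have hYQ : Y ∈ Qh := Qh.sub_mem hx.2.1 hj
  -- The norm of the functional `a(w - i, ·) + b(·, q - j)` with respect to `‖∇v‖`; the `d` comes
  -- from `‖∇·v‖ ≤ d ‖∇v‖`.
  set ε := (1 + (d : ℝ)) * e with hε
  have hε0 : 0 ≤ ε := by positivity
  have heε : e ≤ ε := by rw [hε]; nlinarith [mul_nonneg (Nat.cast_nonneg (α := ℝ) d) he]
  set g := ‖gradL X‖ with hg
  have eqn : ∀ v ∈ Vh, inner ℝ (gradL X) (gradL v) + bForm v Y =
      inner ℝ (gradL (w - i)) (gradL v) + bForm v (q - j) := fun v hv => by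
    have := hx.2.2.1 v hv
    simp only [hX, hY, aForm_eq_inner, map_sub, inner_sub_left, bForm_sub_right] at *
    linarith
  have rhs : ∀ v : VecSob Ω 1, inner ℝ (gradL (w - i)) (gradL v) + bForm v (q - j) ≤
      ε * ‖gradL v‖ := fun v => by
    have a1 := (abs_le.1 (abs_real_inner_le_norm (gradL (w - i)) (gradL v))).2
    have a2 := (abs_le.1 (abs_bForm_le v (q - j))).2
    have a3 := mul_le_mul_of_nonneg_right h1 (norm_nonneg (gradL v))
    have a4 := mul_le_mul_of_nonneg_left h2
      (mul_nonneg (Nat.cast_nonneg (α := ℝ) d) (norm_nonneg (gradL v)))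
    rw [hε]; linarith
  have hYb : β * ‖Y‖ ≤ ε + g := by
    refine hFE.mul_norm_le hYQ (by positivity) fun v hv => ?_
    have a1 := eqn v hv
    have a2 := rhs v
    have a3 := (abs_le.1 (abs_real_inner_le_norm (gradL X) (gradL v))).1
    have a4 := mul_le_mul_of_nonneg_left (norm_gradL_le v) (add_nonneg hε0 (norm_nonneg (gradL X)))
    linarith
  -- Both `w` and `x.1` are annihilated by `b(·, Y)`, so the coupling term involves only the
  -- approximation error `w - i`.
  have hbX : bForm X Y = bForm (w - i) Y := by
    have b0 : bForm w Y = 0 := by rw [bForm, hw, inner_zero_left, neg_zero]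
    rw [hX, bForm_sub_left, bForm_sub_left, hx.2.2.2 Y hYQ, b0]
  have hY2 : ‖Y‖ ≤ (ε + g) / β := by rw [le_div_iff₀ hβ]; linarith
  have hquad : g ^ 2 ≤ ε * g + d / β * ε * (ε + g) := by
    have a1 := eqn X hXV
    have a2 := rhs X
    have a3 := (abs_le.1 (abs_bForm_le (w - i) Y)).1
    rw [real_inner_self_eq_norm_sq, hbX] at a1
    have a4 : d * ‖gradL (w - i)‖ * ‖Y‖ ≤ d * ε * ((ε + g) / β) := by
      gcongr; exact h1.trans heε
    have a5 : d * ε * ((ε + g) / β) = d / β * ε * (ε + g) := by ring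
    linarith
  have hk : (0 : ℝ) ≤ d / β := by positivity
  -- With `k = d / β`, `hquad` reads `g² ≤ (1 + k) ε g + k ε²`, which fails once `g > (2 + k) ε`.
  have hgb : g ≤ (2 + d / β) * ε := by
    by_contra hc
    rw [not_le] at hc
    have hg0 : 0 < g := lt_of_le_of_lt (by positivity) hc
    have b1 := mul_lt_mul_of_pos_right hc hg0
    have b2 := mul_le_mul_of_nonneg_left hc.le hε0
    have b3 : 0 ≤ ε * ε := mul_nonneg hε0 hε0
    nlinarith [mul_nonneg hk b3]
  constructor
  · have : w - x.1 = (w - i) - X := by rw [hX]; abel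
    rw [this, map_sub]
    refine (norm_sub_le _ _).trans ?_
    rw [hε] at hgb
    linarith
  · have : q - x.2 = (q - j) - Y := by rw [hY]; abel
    rw [this]
    refine (norm_sub_le _ _).trans ?_
    have c1 : (ε + g) / β ≤ (3 + d / β) * ε / β := by
      gcongr; linarith
    have c2 : (3 + d / β) * ε / β = (3 + d / β) * (1 + d) / β * e := by rw [hε]; ring
    linarith

/-- The error bound for the Stokes projection. -/
theorem exists_stokesProj_bound (hd : 0 < d) (hbdd : Bornology.IsBounded (Ω : Set (Pt d))) (r : ℕ)
    {β : ℝ} (hβ : 0 < β) (Ca : ℝ) :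
    ∃ CS : ℝ, 0 ≤ CS ∧ ∀ h : ℝ, 0 < h → ∀ (Vh : Submodule ℝ (VecSob Ω 1))
      (Qh : Submodule ℝ (L2 Ω)), IsFEPair Ω r β Ca h Vh Qh →
      ∀ (w : VecSob Ω (r + 1)) (q : Sob Ω r) (x : VecSob Ω 1 × L2 Ω),
      w.toH1 (Nat.le_add_left 1 r) ∈ V Ω → div (w.toH1 (Nat.le_add_left 1 r)) = 0 →
      MeanZero q.toL2 → IsStokesProj Vh Qh (w.toH1 (Nat.le_add_left 1 r)) q.toL2 x →
      ‖w.toL2 - x.1.toL2‖ ≤ CS * h ^ r * (‖w‖ + ‖q‖) ∧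
        ‖q.toL2 - x.2‖ ≤ CS * h ^ r * (‖w‖ + ‖q‖) := by
  obtain ⟨CP, hCP, hP⟩ := exists_poincare hd hbdd
  set A : ℝ := CP * (1 + (2 + d / β) * (1 + d)) with hA
  set B : ℝ := 1 + (3 + d / β) * (1 + d) / β with hB
  have hA0 : 0 ≤ A := by positivity
  have hB0 : 0 ≤ B := by positivity
  -- `A` serves the velocity, with the Poincaré constant included, and `B` the pressure. The
  -- absolute value appears because no sign of `Ca` is assumed.
  refine ⟨(A + B) * |Ca|, by positivity, fun h hh Vh Qh hFE w q x hw hdiv hq hx => ?_⟩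
  obtain ⟨i, hi, hi2⟩ := hFE.approx_V w hw
  obtain ⟨j, hj, hj2⟩ := hFE.approx_Q q hq
  have hhr : 0 < h ^ r := pow_pos hh r
  set e := |Ca| * h ^ r * (‖w‖ + ‖q‖) with he
  have he0 : 0 ≤ e := by positivity
  have e1 : ‖gradL (w.toH1 (Nat.le_add_left 1 r) - i)‖ ≤ e := by
    rw [gradNorm_eq] at hi2
    have a1 : h * ‖gradL (w.toH1 (Nat.le_add_left 1 r) - i)‖ ≤ h * (Ca * h ^ r * ‖w‖) := by
      have := norm_nonneg (w.toH1 (Nat.le_add_left 1 r) - i).toL2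
      rw [pow_succ] at hi2
      linarith
    refine (le_of_mul_le_mul_left a1 hh).trans ?_
    rw [he]
    gcongr
    · exact le_abs_self Ca
    · exact le_add_of_nonneg_right (norm_nonneg _)
  have e2 : ‖q.toL2 - j‖ ≤ e := by
    refine hj2.trans ?_
    rw [he]
    gcongr
    · exact le_abs_self Ca
    · exact le_add_of_nonneg_left (norm_nonneg _)
  obtain ⟨b1, b2⟩ := hx.quasi_optimal hβ hFE hdiv hi hj e1 e2
  have r1 : (A + B) * |Ca| * h ^ r * (‖w‖ + ‖q‖) = A * e + B * e := by rw [he]; ring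
  rw [r1]
  constructor
  · have c1 := hP _ ((V Ω).sub_mem hw (hFE.conforming_V hx.1))
    have c2 := mul_le_mul_of_nonneg_left b1 hCP.le
    have c3 : (w.toH1 (Nat.le_add_left 1 r) - x.1).toL2 = w.toL2 - x.1.toL2 := rfl
    rw [c3] at c1
    have : 0 ≤ B * e := by positivity
    rw [hA]
    linarith
  · have : 0 ≤ A * e := by positivity
    linarith

end

end StokesFE

namespace StokesFE

noncomputable section

/-! ## Error bounds for functions of time -/

section Time

theorem exists_bound_of_continuousOn {E : Type*} [NormedAddCommGroup E] {T : ℝ} {F : ℝ → E}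
    (hF : ContinuousOn F (Icc 0 T)) : ∃ K : ℝ, 0 ≤ K ∧ ∀ t ∈ Icc 0 T, ‖F t‖ ≤ K := by
  obtain ⟨K, hK⟩ := isCompact_Icc.exists_bound_of_continuousOn hF
  exact ⟨max K 0, le_max_right _ _, fun t ht => (hK t ht).trans (le_max_left _ _)⟩

variable {E : Type*} [NormedAddCommGroup E] [NormedSpace ℝ E] {T : ℝ} {F : ℝ → E}

theorem hasDerivWithinAt_of_contDiffOn {n : WithTop ℕ∞} (hn : n ≠ 0)
    (hF : ContDiffOn ℝ n F (Icc 0 T)) {t : ℝ} (ht : t ∈ Icc 0 T) :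
    HasDerivWithinAt F (derivWithin F (Icc 0 T) t) (Icc 0 T) t :=
  ((hF.differentiableOn hn) t ht).hasDerivWithinAt

theorem exists_lipschitz_of_contDiffOn (hT : 0 < T) (hF : ContDiffOn ℝ 1 F (Icc 0 T)) :
    ∃ K : ℝ, 0 ≤ K ∧ ∀ s ∈ Icc 0 T, ∀ t ∈ Icc 0 T, ‖F t - F s‖ ≤ K * |t - s| := by
  obtain ⟨K, hK0, hK⟩ := exists_bound_of_continuousOn
    (hF.continuousOn_derivWithin (uniqueDiffOn_Icc hT) le_rfl)
  exact ⟨K, hK0, fun s hs t ht => (convex_Icc 0 T).norm_image_sub_le_of_norm_hasDerivWithin_le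
    (fun x hx => hasDerivWithinAt_of_contDiffOn one_ne_zero hF hx) hK hs ht⟩

/-- Mean value inequality for `x ↦ F x - (x - s) • F' s`, whose derivative is at most `K |t - s|`
between `s` and `t`. -/
theorem norm_taylor_one_le {F' : ℝ → E} {K : ℝ} (hK : 0 ≤ K)
    (hF : ∀ t ∈ Icc 0 T, HasDerivWithinAt F (F' t) (Icc 0 T) t)
    (hF' : ∀ s ∈ Icc 0 T, ∀ t ∈ Icc 0 T, ‖F' t - F' s‖ ≤ K * |t - s|)
    {s t : ℝ} (hs : s ∈ Icc 0 T) (ht : t ∈ Icc 0 T) :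
    ‖F t - F s - (t - s) • F' s‖ ≤ K * |t - s| ^ 2 := by
  have hsub : uIcc s t ⊆ Icc 0 T := ordConnected_Icc.uIcc_subset hs ht
  have h1 : ∀ x ∈ uIcc s t, HasDerivWithinAt (fun x => F x - (x - s) • F' s)
      (F' x - (1 : ℝ) • F' s) (uIcc s t) x := fun x hx =>
    ((hF x (hsub hx)).mono hsub).sub (((hasDerivWithinAt_id x _).sub_const s).smul_const (F' s))
  have h2 : ∀ x ∈ uIcc s t, ‖F' x - (1 : ℝ) • F' s‖ ≤ K * |t - s| := fun x hx => by
    rw [one_smul]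
    exact (hF' s hs x (hsub hx)).trans
      (mul_le_mul_of_nonneg_left (abs_sub_left_of_mem_uIcc hx) hK)
  have h3 := (convex_uIcc s t).norm_image_sub_le_of_norm_hasDerivWithin_le h1 h2
    left_mem_uIcc right_mem_uIcc
  rw [sub_self, zero_smul, sub_zero, Real.norm_eq_abs] at h3
  have e : F t - F s - (t - s) • F' s = F t - (t - s) • F' s - F s := by abel
  rw [e]
  refine h3.trans (le_of_eq (by ring))

/-- Errors of the affine interpolation and of the trapezoidal rule for a `C²` function. -/
theorem exists_interp_bound (hT : 0 < T) (hF : ContDiffOn ℝ 2 F (Icc 0 T)) :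
    ∃ K : ℝ, 0 ≤ K ∧
      (∀ t ∈ Icc 0 T, ‖derivWithin F (Icc 0 T) t‖ ≤ K) ∧
      (∀ s ∈ Icc 0 T, ∀ t ∈ Icc 0 T,
        ‖derivWithin F (Icc 0 T) t - derivWithin F (Icc 0 T) s‖ ≤ K * |t - s|) ∧
      (∀ a ∈ Icc 0 T, ∀ b ∈ Icc 0 T, ∀ θ ∈ Icc (0 : ℝ) 1, a ≤ b →
        ‖F (a + θ * (b - a)) - (F a + θ • (F b - F a))‖ ≤ K * (b - a) ^ 2) ∧
      (∀ a ∈ Icc 0 T, ∀ b ∈ Icc 0 T, a ≤ b → ‖F b - F a - ((b - a) / 2) •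
        (derivWithin F (Icc 0 T) a + derivWithin F (Icc 0 T) b)‖ ≤ K * (b - a) ^ 2) := by
  have hF1 : ContDiffOn ℝ 1 (derivWithin F (Icc 0 T)) (Icc 0 T) :=
    hF.derivWithin (uniqueDiffOn_Icc hT) (by norm_num)
  set F' := derivWithin F (Icc 0 T) with hF'
  obtain ⟨K₁, hK₁, h1⟩ := exists_bound_of_continuousOn hF1.continuousOn
  obtain ⟨K₂, hK₂, h2⟩ := exists_lipschitz_of_contDiffOn hT hF1
  have tay := fun {s t : ℝ} (hs : s ∈ Icc 0 T) (ht : t ∈ Icc 0 T) => norm_taylor_one_le hK₂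
    (fun t ht => hasDerivWithinAt_of_contDiffOn two_ne_zero hF ht) h2 hs ht
  -- `K₁` bounds the derivative; `2 K₂` covers the two Taylor remainders that make up the
  -- interpolation error.
  refine ⟨K₁ + 2 * K₂, by positivity, fun t ht => (h1 t ht).trans (by linarith),
    fun s hs t ht => (h2 s hs t ht).trans ?_, fun a ha b hb θ hθ hab => ?_,
    fun a ha b hb hab => ?_⟩
  · gcongr; linarith
  · have hba : 0 ≤ b - a := sub_nonneg.2 hab
    have hθb : θ * (b - a) ≤ b - a := mul_le_of_le_one_left hba hθ.2
    have hθb0 : 0 ≤ θ * (b - a) := mul_nonneg hθ.1 hba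
    have hx : a + θ * (b - a) ∈ Icc 0 T := ⟨by linarith [ha.1], by linarith [hb.2]⟩
    have t1 := tay ha hx
    have t2 := tay ha hb
    rw [add_sub_cancel_left, abs_of_nonneg hθb0] at t1
    rw [abs_of_nonneg hba] at t2
    have e : F (a + θ * (b - a)) - (F a + θ • (F b - F a)) =
        (F (a + θ * (b - a)) - F a - (θ * (b - a)) • F' a) -
          θ • (F b - F a - (b - a) • F' a) := by module
    rw [e]
    refine (norm_sub_le _ _).trans ?_
    rw [norm_smul, Real.norm_eq_abs, abs_of_nonneg hθ.1]
    have t3 : θ * ‖F b - F a - (b - a) • F' a‖ ≤ 1 * (K₂ * (b - a) ^ 2) :=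
      mul_le_mul hθ.2 t2 (norm_nonneg _) zero_le_one
    have t4 : K₂ * (θ * (b - a)) ^ 2 ≤ K₂ * (b - a) ^ 2 := by gcongr
    nlinarith [mul_nonneg hK₁ (sq_nonneg (b - a))]
  · have hba : 0 ≤ b - a := sub_nonneg.2 hab
    have t2 := tay ha hb
    have t3 := h2 a ha b hb
    rw [abs_of_nonneg hba] at t2 t3
    have e : F b - F a - ((b - a) / 2) • (F' a + F' b) =
        (F b - F a - (b - a) • F' a) - ((b - a) / 2) • (F' b - F' a) := by module
    rw [e]
    refine (norm_sub_le _ _).trans ?_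
    rw [norm_smul, Real.norm_eq_abs, abs_of_nonneg (by linarith)]
    have t4 := mul_le_mul_of_nonneg_left t3 (show 0 ≤ (b - a) / 2 by linarith)
    nlinarith [mul_nonneg hK₁ (sq_nonneg (b - a)), mul_nonneg hK₂ (sq_nonneg (b - a))]

/-- The error of the trapezoidal rule for a `C³` function. -/
theorem exists_trapezoid_bound (hT : 0 < T) (hF : ContDiffOn ℝ 3 F (Icc 0 T)) :
    ∃ K : ℝ, 0 ≤ K ∧ ∀ a ∈ Icc 0 T, ∀ b ∈ Icc 0 T, a ≤ b → ‖F b - F a - ((b - a) / 2) •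
        (derivWithin F (Icc 0 T) a + derivWithin F (Icc 0 T) b)‖ ≤ K * (b - a) ^ 3 := by
  have hF1 : ContDiffOn ℝ 2 (derivWithin F (Icc 0 T)) (Icc 0 T) :=
    hF.derivWithin (uniqueDiffOn_Icc hT) (by norm_num)
  set F' := derivWithin F (Icc 0 T) with hF'
  have hF2 : ContDiffOn ℝ 1 (derivWithin F' (Icc 0 T)) (Icc 0 T) :=
    hF1.derivWithin (uniqueDiffOn_Icc hT) (by norm_num)
  set F'' := derivWithin F' (Icc 0 T) with hF''
  obtain ⟨K, hK, h2⟩ := exists_lipschitz_of_contDiffOn hT hF2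
  refine ⟨K, hK, fun a ha b hb hab => ?_⟩
  have hsub : Icc a b ⊆ Icc 0 T := Icc_subset_Icc ha.1 hb.2
  have hba : 0 ≤ b - a := sub_nonneg.2 hab
  have d1 : ∀ x ∈ Icc a b, HasDerivWithinAt (fun x => F x - ((x - a) / 2) • (F' a + F' x))
      (F' x - (((x - a) / 2) • F'' x + ((1 : ℝ) / 2) • (F' a + F' x))) (Icc a b) x := fun x hx => by
    have g1 := (hasDerivWithinAt_of_contDiffOn (by norm_num) hF (hsub hx)).mono hsub
    have g2 := (hasDerivWithinAt_of_contDiffOn (by norm_num) hF1 (hsub hx)).mono hsub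
    exact g1.sub ((((hasDerivWithinAt_id x _).sub_const a).div_const 2).smul (g2.const_add (F' a)))
  have d2 : ∀ x ∈ Icc a b,
      ‖F' x - (((x - a) / 2) • F'' x + ((1 : ℝ) / 2) • (F' a + F' x))‖ ≤ K * (b - a) ^ 2 :=
    fun x hx => by
      have t := norm_taylor_one_le hK
        (fun t ht => hasDerivWithinAt_of_contDiffOn two_ne_zero hF1 ht) h2 (hsub hx) ha
      -- The derivative of the trapezoidal error in its upper limit is a first-order Taylor
      -- remainder of `F'`, hence quadratic; the mean value inequality gives the third power.
      have e : F' x - (((x - a) / 2) • F'' x + ((1 : ℝ) / 2) • (F' a + F' x)) =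
          (-(1 / 2 : ℝ)) • (F' a - F' x - (a - x) • F'' x) := by module
      rw [e, norm_smul]
      have n1 : ‖(-(1 / 2 : ℝ))‖ ≤ 1 := by norm_num
      have n2 : |a - x| ≤ b - a := by
        rw [abs_sub_comm, abs_of_nonneg (sub_nonneg.2 hx.1)]; linarith [hx.2]
      have n3 : K * |a - x| ^ 2 ≤ K * (b - a) ^ 2 := by gcongr
      calc _ ≤ 1 * (K * (b - a) ^ 2) :=
            mul_le_mul n1 (t.trans n3) (norm_nonneg _) zero_le_one
        _ = _ := one_mul _
  have h3 := (convex_Icc a b).norm_image_sub_le_of_norm_hasDerivWithin_le d1 d2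
    (left_mem_Icc.2 hab) (right_mem_Icc.2 hab)
  rw [sub_self, zero_div, zero_smul, sub_zero, Real.norm_eq_abs, abs_of_nonneg hba] at h3
  have e : F b - F a - ((b - a) / 2) • (F' a + F' b) = F b - ((b - a) / 2) • (F' a + F' b) - F a := by
    abel
  rw [e]
  exact h3.trans (le_of_eq (by ring))

end Time

/-! ## Energy estimates for the trapezoidal rule -/

section Energy

variable {X L H : Type*} [AddCommGroup X] [Module ℝ X] [NormedAddCommGroup L]
  [InnerProductSpace ℝ L] [NormedAddCommGroup H] [InnerProductSpace ℝ H]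
  (J : X →ₗ[ℝ] L) (G : X →ₗ[ℝ] H) (W : Submodule ℝ X) (N : ℕ) (τ : ℕ → ℝ)
  (e E δ : ℕ → X) (ρ : ℕ → L)

/-- Here `J` stands for the embedding into `L²`, `G` for the gradient and `W` for `V_h^div`. The
average of two consecutive equations is tested with `e (n+1) - e n`: the `G` part telescopes as half
a difference of squares, and the step relation turns the `J` part into `τ n` times the squared mean
of `E`, up to `δ`. -/
theorem energy_first (hτ : ∀ n < N, 0 < τ n) (he : ∀ n ≤ N, e n ∈ W)
    (heq : ∀ n ≤ N, ∀ v ∈ W, inner ℝ (J (E n)) (J v) + inner ℝ (G (e n)) (G v) =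
      -inner ℝ (ρ n) (J v))
    (hstep : ∀ n < N, e (n + 1) - e n = τ n • ((1 / 2 : ℝ) • (E n + E (n + 1)) + δ n))
    {D : ℝ} (hρ : ∀ n ≤ N, ‖ρ n‖ ≤ D) (hδ : ∀ n < N, ‖J (δ n)‖ ≤ D) :
    ∀ n ≤ N, (∑ k ∈ Finset.range n, τ k * ‖J ((1 / 2 : ℝ) • (E k + E (k + 1)))‖ ^ 2)
      + ‖G (e n)‖ ^ 2 ≤ ‖G (e 0)‖ ^ 2 + 6 * D ^ 2 * ∑ k ∈ Finset.range n, τ k := by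
  have key : ∀ n < N, τ n * ‖J ((1 / 2 : ℝ) • (E n + E (n + 1)))‖ ^ 2 + ‖G (e (n + 1))‖ ^ 2 ≤
      ‖G (e n)‖ ^ 2 + 6 * D ^ 2 * τ n := fun n hn => by
    have hv : e (n + 1) - e n ∈ W := W.sub_mem (he _ hn) (he _ hn.le)
    have q1 := heq n hn.le _ hv
    have q2 := heq (n + 1) hn _ hv
    set S := (1 / 2 : ℝ) • (E n + E (n + 1)) with hS
    set R := (1 / 2 : ℝ) • (ρ n + ρ (n + 1)) with hR
    have hRD : ‖R‖ ≤ D := by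
      rw [hR, norm_smul]
      have := norm_add_le (ρ n) (ρ (n + 1))
      have h1 := hρ n hn.le
      have h2 := hρ (n + 1) hn
      norm_num
      linarith
    have hd := hδ n hn
    have q3 : inner ℝ (J S) (J (e (n + 1) - e n)) +
        (1 / 2) * (‖G (e (n + 1))‖ ^ 2 - ‖G (e n)‖ ^ 2) =
        -inner ℝ R (J (e (n + 1) - e n)) := by
      have g : inner ℝ (G (e n)) (G (e (n + 1) - e n)) +
          inner ℝ (G (e (n + 1))) (G (e (n + 1) - e n)) =
          ‖G (e (n + 1))‖ ^ 2 - ‖G (e n)‖ ^ 2 := by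
        rw [map_sub, inner_sub_right, inner_sub_right, real_inner_self_eq_norm_sq,
          real_inner_self_eq_norm_sq, real_inner_comm (G (e n)) (G (e (n + 1)))]
        ring
      rw [hS, hR, map_smul, map_add, real_inner_smul_left, real_inner_smul_left, inner_add_left,
        inner_add_left]
      linarith
    rw [hstep n hn, ← hS] at q3
    clear_value S
    rw [map_smul J, map_add J S, real_inner_smul_right, real_inner_smul_right,
      inner_add_right, inner_add_right, real_inner_self_eq_norm_sq] at q3
    have i1 := (abs_le.1 (abs_real_inner_le_norm (J S) (J (δ n)))).1
    have i2 := (abs_le.1 (abs_real_inner_le_norm R (J S))).1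
    have i3 := (abs_le.1 (abs_real_inner_le_norm R (J (δ n)))).1
    have hD : 0 ≤ D := (norm_nonneg _).trans hd
    have j1 := mul_le_mul_of_nonneg_left hd (norm_nonneg (J S))
    have j2 := mul_le_mul_of_nonneg_right hRD (norm_nonneg (J S))
    have j3 : ‖R‖ * ‖J (δ n)‖ ≤ D * D := mul_le_mul hRD hd (norm_nonneg _) hD
    -- After doubling `q3` there are two copies of `‖J S‖²`; one absorbs the mixed terms, leaving `4
    -- D² + 2 D² = 6 D²`.
    have young : 2 * (‖J S‖ * D) ≤ (1 / 2) * ‖J S‖ ^ 2 + 2 * D ^ 2 := by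
      nlinarith [sq_nonneg (‖J S‖ - 2 * D)]
    have fin : ‖J S‖ ^ 2 + 2 * (inner ℝ (J S) (J (δ n)) + inner ℝ R (J S) + inner ℝ R (J (δ n))) +
        6 * D ^ 2 ≥ 0 := by nlinarith
    nlinarith [mul_nonneg (hτ n hn).le fin]
  intro n
  induction n with
  | zero => intro _; simp
  | succ n ih =>
    intro hn
    have h1 := ih (by omega)
    have h2 := key n hn
    rw [Finset.sum_range_succ, Finset.sum_range_succ]
    linarith

/-- The difference of consecutive equations is tested with `E (n+1) - E n`. The step relation
replaces `e (n+1) - e n` by the mean of `E`, so that `‖G (E n)‖²` telescopes. Only `G (δ n)` as a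
functional bounded by `‖J v‖` enters. -/
theorem energy_second (hτ : ∀ n < N, 0 < τ n) (hE : ∀ n ≤ N, E n ∈ W)
    (heq : ∀ n ≤ N, ∀ v ∈ W, inner ℝ (J (E n)) (J v) + inner ℝ (G (e n)) (G v) =
      -inner ℝ (ρ n) (J v))
    (hstep : ∀ n < N, e (n + 1) - e n = τ n • ((1 / 2 : ℝ) • (E n + E (n + 1)) + δ n))
    {D₁ D₂ tm : ℝ} (htm : ∀ n < N, τ n ≤ tm) (hρ : ∀ n < N, ‖ρ (n + 1) - ρ n‖ ≤ D₁ * τ n)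
    (hδ : ∀ n < N, ∀ v ∈ W, |inner ℝ (G (δ n)) (G v)| ≤ D₂ * ‖J v‖) :
    ∀ n ≤ N, (∑ k ∈ Finset.range n, τ k * ‖J (E (k + 1) - E k)‖ ^ 2)
      + tm ^ 2 * ‖G (E n)‖ ^ 2 ≤
        tm ^ 2 * ‖G (E 0)‖ ^ 2 + tm ^ 2 * (D₁ + D₂) ^ 2 * ∑ k ∈ Finset.range n, τ k := by
  have key : ∀ n < N, τ n * ‖J (E (n + 1) - E n)‖ ^ 2 + tm ^ 2 * ‖G (E (n + 1))‖ ^ 2 ≤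
      tm ^ 2 * ‖G (E n)‖ ^ 2 + tm ^ 2 * (D₁ + D₂) ^ 2 * τ n := fun n hn => by
    have ht := hτ n hn
    have hv : E (n + 1) - E n ∈ W := W.sub_mem (hE _ hn) (hE _ hn.le)
    have q1 := heq n hn.le _ hv
    have q2 := heq (n + 1) hn _ hv
    set v := E (n + 1) - E n with hvdef
    have q3 : ‖J v‖ ^ 2 + inner ℝ (G (e (n + 1) - e n)) (G v) = -inner ℝ (ρ (n + 1) - ρ n) (J v) := by
      have : ‖J v‖ ^ 2 = inner ℝ (J (E (n + 1))) (J v) - inner ℝ (J (E n)) (J v) := by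
        rw [← inner_sub_left, ← map_sub, ← hvdef, real_inner_self_eq_norm_sq]
      rw [this, map_sub G, inner_sub_left (G _), inner_sub_left (ρ _)]
      linarith
    have g : inner ℝ (G (e (n + 1) - e n)) (G v) =
        τ n * ((1 / 2) * (‖G (E (n + 1))‖ ^ 2 - ‖G (E n)‖ ^ 2) + inner ℝ (G (δ n)) (G v)) := by
      rw [hstep n hn, map_smul, map_add, map_smul, map_add, real_inner_smul_left, inner_add_left,
        real_inner_smul_left, inner_add_left]
      have : inner ℝ (G (E n)) (G v) + inner ℝ (G (E (n + 1))) (G v) =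
          ‖G (E (n + 1))‖ ^ 2 - ‖G (E n)‖ ^ 2 := by
        rw [hvdef, map_sub, inner_sub_right, inner_sub_right, real_inner_self_eq_norm_sq,
          real_inner_self_eq_norm_sq, real_inner_comm (G (E n)) (G (E (n + 1)))]
        ring
      rw [this]
    have i1 := (abs_le.1 (abs_real_inner_le_norm (ρ (n + 1) - ρ n) (J v))).1
    have i2 := mul_le_mul_of_nonneg_right (hρ n hn) (norm_nonneg (J v))
    have i3 := mul_le_mul_of_nonneg_left (abs_le.1 (hδ n hn v hv)).1 ht.le
    set x := ‖J v‖ with hx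
    set D := D₁ + D₂ with hD
    set Y := ‖G (E (n + 1))‖ ^ 2 - ‖G (E n)‖ ^ 2 with hY
    have c1 : x ^ 2 + τ n / 2 * Y ≤ D * τ n * x := by rw [g] at q3; rw [hD]; linarith
    have c2 : x ^ 2 + τ n * Y ≤ D ^ 2 * τ n ^ 2 := by nlinarith [sq_nonneg (x - D * τ n)]
    have c4 : (x ^ 2 + τ n * Y - D ^ 2 * τ n ^ 2) * tm ^ 2 ≤ 0 :=
      mul_nonpos_of_nonpos_of_nonneg (by linarith) (sq_nonneg _)
    -- Weighting `c2` with `tm² / τ n` keeps the telescoping coefficient independent of `n`, while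
    -- the jump term still dominates `τ n * x²`. No bound on ratios of step sizes is needed.
    have c5 : τ n ^ 2 * x ^ 2 ≤ tm ^ 2 * x ^ 2 := by
      have := htm n hn
      gcongr
    have c6 : τ n * (τ n * x ^ 2 + tm ^ 2 * Y - tm ^ 2 * D ^ 2 * τ n) ≤ 0 := by nlinarith
    have c7 : τ n * x ^ 2 + tm ^ 2 * Y - tm ^ 2 * D ^ 2 * τ n ≤ 0 := by
      by_contra hc
      exact absurd (mul_pos ht (not_le.1 hc)) (not_lt.2 c6)
    rw [hY] at c7
    linarith
  intro n
  induction n with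
  | zero => intro _; simp
  | succ n ih =>
    intro hn
    have h1 := ih (by omega)
    have h2 := key n hn
    rw [Finset.sum_range_succ, Finset.sum_range_succ]
    linarith

end Energy

end

end StokesFE

namespace StokesFE

noncomputable section

/-! ## Affine trajectories -/

section Affine

variable {E : Type*} [AddCommGroup E] [Module ℝ E]

/-- The affine trajectory with the values `p` at `a` and `q` at `b`. -/
def aff (a b : ℝ) (p q : E) (s : ℝ) : E := p + ((s - a) / (b - a)) • (q - p)

theorem aff_left (a b : ℝ) (p q : E) : aff a b p q a = p := by simp [aff]

theorem aff_right {a b : ℝ} (hab : a < b) (p q : E) : aff a b p q b = q := by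
  simp [aff, div_self (sub_pos.2 hab).ne']

theorem aff_mid {a b : ℝ} (hab : a < b) (p q : E) :
    aff a b p q ((a + b) / 2) = (1 / 2 : ℝ) • (p + q) := by
  have : ((a + b) / 2 - a) / (b - a) = 1 / 2 := by
    rw [div_eq_iff (sub_pos.2 hab).ne']; ring
  rw [aff, this]
  module

theorem aff_mem {B : Submodule ℝ E} {p q : E} (hp : p ∈ B) (hq : q ∈ B) (a b s : ℝ) :
    aff a b p q s ∈ B := B.add_mem hp (B.smul_mem _ (B.sub_mem hq hp))

theorem isPolyOn_aff {B : Submodule ℝ E} {p q : E} (hp : p ∈ B) (hq : q ∈ B) (a b : ℝ) (J : Set ℝ) :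
    IsPolyOn 1 B J (aff a b p q) := by
  refine ⟨fun j => if j = 0 then p - (a * (b - a)⁻¹) • (q - p) else (b - a)⁻¹ • (q - p),
    fun j => ?_, fun s _ => ?_⟩
  · dsimp only
    split_ifs
    · exact B.sub_mem hp (B.smul_mem _ (B.sub_mem hq hp))
    · exact B.smul_mem _ (B.sub_mem hq hp)
  · simp only [aff, Finset.sum_range_succ, Finset.sum_range_zero, div_eq_mul_inv]
    simp only [if_true, one_ne_zero, if_false]
    module

theorem IsPolyOn.exists_aff {B : Submodule ℝ E} {J : Set ℝ} {w : ℝ → E} (h : IsPolyOn 1 B J w)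
    {a b : ℝ} (hab : a < b) : ∃ p ∈ B, ∃ q ∈ B, ∀ s ∈ J, w s = aff a b p q s := by
  obtain ⟨W, hW, hs⟩ := h
  refine ⟨W 0 + a • W 1, B.add_mem (hW 0) (B.smul_mem _ (hW 1)), W 0 + b • W 1,
    B.add_mem (hW 0) (B.smul_mem _ (hW 1)), fun s hsJ => ?_⟩
  rw [hs s hsJ, aff]
  have : W 0 + b • W 1 - (W 0 + a • W 1) = (b - a) • W 1 := by module
  rw [this, smul_smul, div_mul_cancel₀ _ (sub_pos.2 hab).ne']
  simp only [Finset.sum_range_succ, Finset.sum_range_zero]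
  module

theorem map_aff {F : Type*} [AddCommGroup F] [Module ℝ F] (l : E →ₗ[ℝ] F) (a b : ℝ) (p q : E)
    (s : ℝ) : l (aff a b p q s) = aff a b (l p) (l q) s := by
  simp only [aff, map_add, map_smul, map_sub]

theorem integral_aff (a b p q : ℝ) : ∫ s in a..b, aff a b p q s = (b - a) / 2 * (p + q) := by
  rcases eq_or_ne a b with rfl | hab
  · simp
  have hba : b - a ≠ 0 := sub_ne_zero.2 hab.symm
  have h : ∀ s, aff a b p q s = (p - a / (b - a) * (q - p)) + (q - p) / (b - a) * s := fun s => by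
    simp only [aff, smul_eq_mul]; ring
  simp only [h]
  rw [intervalIntegral.integral_add (by simp)
    ((by fun_prop : Continuous fun s : ℝ => (q - p) / (b - a) * s).intervalIntegrable _ _),
    intervalIntegral.integral_const, intervalIntegral.integral_const_mul, integral_id, smul_eq_mul]
  field_simp
  ring

end Affine

section AffineNormed

/-- Identities known on half-open intervals pass to the left end by continuity: `t = 0` for the
exact problem, and the left mesh point of each interval for discrete trajectories. -/
theorem eqOn_Icc_of_eqOn_Ioc {E : Type*} [TopologicalSpace E] [T2Space E] {a b : ℝ} (hab : a < b) {F G : ℝ → E} (hF : ContinuousOn F (Icc a b))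
    (hG : ContinuousOn G (Icc a b)) (h : ∀ s ∈ Ioc a b, F s = G s) :
    ∀ s ∈ Icc a b, F s = G s :=
  EqOn.of_subset_closure (s := Ioc a b) h hF hG Ioc_subset_Icc_self (closure_Ioc hab.ne).ge

variable {E : Type*} [NormedAddCommGroup E] [NormedSpace ℝ E]

theorem continuous_aff (a b : ℝ) (p q : E) : Continuous (aff a b p q) := by
  unfold aff; fun_prop

theorem hasDerivAt_aff (a b : ℝ) (p q : E) (s : ℝ) :
    HasDerivAt (aff a b p q) ((b - a)⁻¹ • (q - p)) s := by
  have := ((((hasDerivAt_id s).sub_const a).div_const (b - a)).smul_const (q - p)).const_add p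
  rw [one_div] at this
  exact this

theorem hasDerivAt_bubble (a b s : ℝ) :
    HasDerivAt (bubble a b) ((2 * s - a - b) / (a - b)) s := by
  have h := (((hasDerivAt_id s).sub_const a).mul ((hasDerivAt_id s).sub_const b)).div_const (a - b)
  have e : (1 * (id s - b) + (id s - a) * 1) / (a - b) = (2 * s - a - b) / (a - b) := by
    simp only [id]; ring
  rw [e] at h
  exact h

theorem IsPolyOn.continuousOn {k : ℕ} {B : Submodule ℝ E} {J : Set ℝ} {w : ℝ → E}
    (h : IsPolyOn k B J w) : ContinuousOn w J := by
  obtain ⟨W, _, hW⟩ := h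
  refine ContinuousOn.congr (Continuous.continuousOn ?_) hW
  fun_prop

end AffineNormed

/-! ## Time meshes -/

namespace TimeMesh

variable {T : ℝ} (M : TimeMesh T)

theorem t_mono {m n : ℕ} (hmn : m ≤ n) (hn : n ≤ M.N) : M.t m ≤ M.t n := by
  induction n, hmn using Nat.le_induction with
  | base => exact le_rfl
  | succ n _ ih => exact (ih (by omega)).trans (M.lt n hn).le

theorem t_mem {n : ℕ} (hn : n ≤ M.N) : M.t n ∈ Icc 0 T :=
  ⟨by rw [← M.first]; exact M.t_mono (Nat.zero_le n) hn, by
    conv_rhs => rw [← M.last]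
    exact M.t_mono hn le_rfl⟩

theorem Ibar_subset {n : ℕ} (hn : n < M.N) : M.Ibar n ⊆ Icc 0 T :=
  Icc_subset_Icc (M.t_mem hn.le).1 (M.t_mem hn).2

theorem N_pos (hT : 0 < T) : 0 < M.N := by
  rcases Nat.eq_zero_or_pos M.N with h | h
  · have h1 := M.first
    have h2 := M.last
    rw [h] at h2
    linarith
  · exact h

theorem le_tau {n : ℕ} (hn : n < M.N) : M.t (n + 1) - M.t n ≤ M.tau :=
  le_ciSup (f := fun k : Fin M.N => M.t (k + 1) - M.t k) (Set.finite_range _).bddAbove ⟨n, hn⟩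

theorem tau_pos (hT : 0 < T) : 0 < M.tau :=
  (sub_pos.2 (M.lt 0 (M.N_pos hT))).trans_le (M.le_tau (M.N_pos hT))

theorem tau_le (hT : 0 < T) : M.tau ≤ T := by
  have : Nonempty (Fin M.N) := ⟨⟨0, M.N_pos hT⟩⟩
  refine ciSup_le fun k => ?_
  have h1 := (M.t_mem (n := k + 1) k.2).2
  have h2 := (M.t_mem (n := k) k.2.le).1
  linarith

theorem sum_steps {n : ℕ} : ∑ k ∈ Finset.range n, (M.t (k + 1) - M.t k) = M.t n := by
  rw [Finset.sum_range_sub, M.first, sub_zero]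

theorem index_unique {m n : ℕ} (hm : m < M.N) (hn : n < M.N) {s : ℝ} (h₁ : s ∈ M.I m)
    (h₂ : s ∈ M.I n) : m = n := by
  rcases lt_trichotomy m n with h | h | h
  · have := M.t_mono (m := m + 1) h hn.le
    exact absurd (h₁.2.trans this) (not_le.2 h₂.1)
  · exact h
  · have := M.t_mono (m := n + 1) h hm.le
    exact absurd (h₂.2.trans this) (not_le.2 h₁.1)

section Glue

variable {E : Type*} (w : ℕ → ℝ → E)

theorem glue_of_mem {n : ℕ} (hn : n < M.N) {s : ℝ} (hs : s ∈ M.I n) : M.glue w s = w n s := by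
  have h : ∃ n < M.N, s ∈ M.I n := ⟨n, hn, hs⟩
  rw [glue, dif_pos h, M.index_unique h.choose_spec.1 hn h.choose_spec.2 hs]

theorem glue_zero : M.glue w 0 = w 0 0 := by
  rw [glue, dif_neg]
  rintro ⟨n, hn, hs⟩
  exact absurd (M.t_mem hn.le).1 (not_le.2 hs.1)

/-- An interior mesh point belongs to the interval on its left, so matching of neighbours is
required there; at `0` the default branch of `glue` already selects the first piece. -/
theorem glue_of_mem_Ibar (hw : ∀ n, n + 1 < M.N → w n (M.t (n + 1)) = w (n + 1) (M.t (n + 1)))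
    {n : ℕ} (hn : n < M.N) {s : ℝ} (hs : s ∈ M.Ibar n) : M.glue w s = w n s := by
  rcases eq_or_lt_of_le hs.1 with h | h
  · cases n with
    | zero => rw [← h, M.first, glue_zero]
    | succ k =>
      have hk : k < M.N := by omega
      rw [← h, M.glue_of_mem w hk ⟨M.lt k hk, le_rfl⟩, hw k hn]
  · exact M.glue_of_mem w hn ⟨h, hs.2⟩

theorem exists_mem_I {s : ℝ} (hs : s ∈ Ioc 0 T) : ∃ n < M.N, s ∈ M.I n := by
  have key : ∀ n ≤ M.N, s ≤ M.t n → ∃ n < M.N, s ∈ M.I n := fun n => by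
    induction n with
    | zero => intro _ h; rw [M.first] at h; exact absurd hs.1 (not_lt.2 h)
    | succ n ih =>
      intro hn h
      rcases le_or_gt s (M.t n) with h' | h'
      · exact ih (by omega) h'
      · exact ⟨n, hn, h', h⟩
  exact key M.N le_rfl (by rw [M.last]; exact hs.2)

theorem continuousOn_of_Ibar [TopologicalSpace E] {g : ℝ → E}
    (hg : ∀ n < M.N, ContinuousOn g (M.Ibar n)) : ContinuousOn g (Icc 0 T) := by
  have key : ∀ n ≤ M.N, ContinuousOn g (Icc 0 (M.t n)) := fun n => by
    induction n with
    | zero => intro _; rw [M.first, Icc_self]; exact continuousOn_singleton _ _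
    | succ n ih =>
      intro hn
      rw [← Icc_union_Icc_eq_Icc (M.t_mem (n := n) (by omega)).1 (M.lt n hn).le]
      exact (ih (by omega)).union_of_isClosed (hg n hn) isClosed_Icc isClosed_Icc
  have := key M.N le_rfl
  rwa [M.last] at this

end Glue

theorem interp_zero {E : Type*} [AddCommGroup E] [Module ℝ E] (w : ℝ → E) :
    M.interp w 0 = w 0 := by
  rw [interp, glue_zero, M.first]
  simp

end TimeMesh

/-! ## The discrete scheme on one time interval -/

variable {d : ℕ} {Ω : Opens (Pt d)} {Vh : Submodule ℝ (VecSob Ω 1)} {Qh : Submodule ℝ (L2 Ω)}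

/-- The form `a(·, v)` as a linear map. -/
def aLin (v : VecSob Ω 1) : VecSob Ω 1 →ₗ[ℝ] ℝ := (innerₗ _ (gradL v)).comp gradL.toLinearMap

theorem aLin_apply (u v : VecSob Ω 1) : aLin v u = aForm u v := by
  rw [aForm_eq_inner, real_inner_comm]; rfl

theorem integral_scheme {a b : ℝ} (hab : a < b) {U : ℝ → VecSob Ω 1} {P : ℝ → L2 Ω}
    {x y : VecSob Ω 1} {p q : L2 Ω} (hU : ∀ s ∈ Icc a b, U s = aff a b x y s)
    (hP : ∀ s ∈ Ioc a b, P s = aff a b p q s) (v : VecSob Ω 1) :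
    ∫ s in a..b, (inner ℝ (deriv U s).toL2 v.toL2 + aForm (U s) v + bForm v (P s)) =
      (b - a) / 2 * (2 * inner ℝ ((b - a)⁻¹ • (y - x)).toL2 v.toL2 + (aForm x v + aForm y v) +
        (bForm v p + bForm v q)) := by
  set m := inner ℝ ((b - a)⁻¹ • (y - x)).toL2 v.toL2 with hm
  have h1 : ∫ s in a..b, (inner ℝ (deriv U s).toL2 v.toL2 + aForm (U s) v + bForm v (P s)) =
      ∫ s in a..b, aff a b (m + aForm x v + bForm v p) (m + aForm y v + bForm v q) s := by
    -- The right end point is discarded as a null set, since `U` may have a kink there and `deriv U`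
    -- need not be its slope on this interval.
    refine intervalIntegral.integral_congr_ae ?_
    have hne : ∀ᵐ s : ℝ, s ≠ b := by simp [ae_iff]
    filter_upwards [hne] with s hsb hs
    rw [uIoc_of_le hab.le] at hs
    have hs' : s ∈ Ioo a b := ⟨hs.1, lt_of_le_of_ne hs.2 hsb⟩
    have hd : deriv U s = (b - a)⁻¹ • (y - x) := by
      refine HasDerivAt.deriv ((hasDerivAt_aff a b x y s).congr_of_eventuallyEq ?_)
      filter_upwards [Icc_mem_nhds hs'.1 hs'.2] with z hz
      exact hU z hz
    rw [hd, hU s (Ioc_subset_Icc_self hs), hP s hs, ← aLin_apply, ← bLin_apply, map_aff, map_aff,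
      aLin_apply, aLin_apply, bLin_apply, bLin_apply]
    simp only [aff, smul_eq_mul]
    ring
  rw [h1, integral_aff]
  ring

theorem integral_incompressible {a b : ℝ} (hab : a < b) {U : ℝ → VecSob Ω 1}
    {x y : VecSob Ω 1} (hU : ∀ s ∈ Icc a b, U s = aff a b x y s) (q : L2 Ω) :
    ∫ s in a..b, bForm (U s) q = (b - a) / 2 * (bForm x q + bForm y q) := by
  have h1 : ∫ s in a..b, bForm (U s) q = ∫ s in a..b, aff a b (bForm x q) (bForm y q) s := by
    refine intervalIntegral.integral_congr fun s hs => ?_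
    rw [uIcc_of_le hab.le] at hs
    rw [hU s hs, ← bLin_apply, ← LinearMap.flip_apply, map_aff, LinearMap.flip_apply,
      LinearMap.flip_apply, bLin_apply, bLin_apply]
  rw [h1, integral_aff]

/-- The nodal values of a local post-processing: the collocation conditions also hold at the
right end point. -/
theorem IsLocalPostProcessing.nodal {a b : ℝ} (hab : a < b) {f : ℝ → VecL2 Ω} {U : ℝ → VecSob Ω 1}
    {P : ℝ → L2 Ω} {Ut : ℝ → VecSob Ω 1} {Pt : ℝ → L2 Ω} {x y : VecSob Ω 1} {p q : L2 Ω}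
    (hx : x ∈ discDivFree Vh Qh) (hy : y ∈ discDivFree Vh Qh)
    (hU : ∀ s ∈ Icc a b, U s = aff a b x y s) (hP : ∀ s ∈ Ioc a b, P s = aff a b p q s)
    (heq : ∀ v ∈ Vh, 2 * inner ℝ ((b - a)⁻¹ • (y - x)).toL2 v.toL2 + (aForm x v + aForm y v) +
      (bForm v p + bForm v q) = inner ℝ (f a) v.toL2 + inner ℝ (f b) v.toL2)
    (h : IsLocalPostProcessing a b Vh Qh f U P Ut Pt) :
    derivWithin Ut (Icc a b) a ∈ discDivFree Vh Qh ∧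
    derivWithin Ut (Icc a b) b ∈ discDivFree Vh Qh ∧
    y - x = ((b - a) / 2) • (derivWithin Ut (Icc a b) a + derivWithin Ut (Icc a b) b) ∧
    Pt a ∈ Qh ∧ Pt b ∈ Qh ∧ (∀ s ∈ Icc a b, Pt s = aff a b (Pt a) (Pt b) s) ∧
    (∀ v ∈ Vh, inner ℝ (derivWithin Ut (Icc a b) a).toL2 v.toL2 + aForm x v + bForm v (Pt a) =
      inner ℝ (f a) v.toL2) ∧
    (∀ v ∈ Vh, inner ℝ (derivWithin Ut (Icc a b) b).toL2 v.toL2 + aForm y v + bForm v (Pt b) =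
      inner ℝ (f b) v.toL2) := by
  have hba : a - b ≠ 0 := (sub_neg.2 hab).ne
  have hba' : b - a ≠ 0 := (sub_pos.2 hab).ne'
  have ha : a ∈ Icc a b := left_mem_Icc.2 hab.le
  have hb : b ∈ Icc a b := right_mem_Icc.2 hab.le
  obtain ⟨c, hc, hUt⟩ := h.velocity_eq
  obtain ⟨e, he, hPt⟩ := h.pressure_eq
  have hbc : Continuous fun s => bubble a b s • c :=
    (continuous_iff_continuousAt.2 fun s => (hasDerivAt_bubble a b s).continuousAt).smul
      continuous_const
  have hUt' : ∀ s ∈ Icc a b, Ut s = aff a b x y s + bubble a b s • c :=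
    eqOn_Icc_of_eqOn_Ioc hab h.velocity.continuousOn
      ((continuous_aff a b x y).add hbc).continuousOn fun s hs => by
        rw [hUt s hs, hU s (Ioc_subset_Icc_self hs)]
  have hder : ∀ s ∈ Icc a b, derivWithin Ut (Icc a b) s =
      (b - a)⁻¹ • (y - x) + ((2 * s - a - b) / (a - b)) • c := fun s hs => by
    refine HasDerivWithinAt.derivWithin ?_ (uniqueDiffOn_Icc hab s hs)
    exact (((hasDerivAt_aff a b x y s).add
      ((hasDerivAt_bubble a b s).smul_const c)).hasDerivWithinAt).congr hUt' (hUt' s hs)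
  have za : derivWithin Ut (Icc a b) a = (b - a)⁻¹ • (y - x) + c := by
    rw [hder a ha, show (2 * a - a - b) / (a - b) = 1 by rw [div_eq_iff hba]; ring, one_smul]
  have zb : derivWithin Ut (Icc a b) b = (b - a)⁻¹ • (y - x) - c := by
    rw [hder b hb, show (2 * b - a - b) / (a - b) = -1 by rw [div_eq_iff hba]; ring, neg_one_smul,
      ← sub_eq_add_neg]
  have hUa : Ut a = x := by rw [hUt' a ha, aff_left]; simp [bubble]
  obtain ⟨p', hp', q', hq', hPt'⟩ := h.pressure.exists_aff hab
  have hPa : Pt a = p' := by rw [hPt' a ha, aff_left]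
  have hPb : Pt b = q' := by rw [hPt' b hb, aff_right hab]
  -- `bubble` has zero slope at the midpoint, so `Pt` and `P` agree there, and midpoint values of
  -- affine functions are half the sums of the end values.
  have hsum : p' + q' = p + q := by
    have hm : (a + b) / 2 ∈ Ioc a b := ⟨by linarith, by linarith⟩
    have h1 := hPt _ hm
    rw [hPt' _ (Ioc_subset_Icc_self hm), hP _ hm, (hasDerivAt_bubble a b _).deriv, aff_mid hab,
      aff_mid hab, show 2 * ((a + b) / 2) - a - b = 0 by ring, zero_div, zero_smul, add_zero] at h1
    exact smul_right_injective _ (by norm_num : (1 / 2 : ℝ) ≠ 0) h1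
  have hD : (b - a)⁻¹ • (y - x) ∈ discDivFree Vh Qh :=
    Submodule.smul_mem _ _ (Submodule.sub_mem _ hy hx)
  have colla : ∀ v ∈ Vh, inner ℝ ((b - a)⁻¹ • (y - x) + c).toL2 v.toL2 + aForm x v + bForm v p' =
      inner ℝ (f a) v.toL2 := fun v hv => by
    have := h.collocation v hv
    rwa [za, hUa, hPa] at this
  rw [za, zb, hPa, hPb]
  refine ⟨Submodule.add_mem _ hD hc, Submodule.sub_mem _ hD hc, ?_, hp', hq', hPt', colla,
    fun v hv => ?_⟩
  · have : (b - a)⁻¹ • (y - x) + c + ((b - a)⁻¹ • (y - x) - c) = (2 * (b - a)⁻¹) • (y - x) := by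
      module
    rw [this, smul_smul, show (b - a) / 2 * (2 * (b - a)⁻¹) = 1 by field_simp, one_smul]
  · have h1 := colla v hv
    have h2 := heq v hv
    have h3 : bForm v p' + bForm v q' = bForm v p + bForm v q := by
      rw [← bForm_add_right, ← bForm_add_right, hsum]
    simp only [← VecSob.toL2L_apply, map_add, map_sub, inner_add_left, inner_sub_left] at *
    linarith

/-- At `a` the correction `bubble • c` vanishes while its derivative is `c`. Collocation is thus a
saddle point problem with the `L²` product for `c` and the pressure value `z` at `a`. -/
theorem exists_isLocalPostProcessing [FiniteDimensional ℝ Vh] [FiniteDimensional ℝ Qh] {a b : ℝ}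
    (hab : a < b) (f : ℝ → VecL2 Ω) {U : ℝ → VecSob Ω 1}
    {P : ℝ → L2 Ω} {x y : VecSob Ω 1} {p q : L2 Ω}
    (hx : x ∈ discDivFree Vh Qh) (hy : y ∈ discDivFree Vh Qh) (hp : p ∈ Qh) (hq : q ∈ Qh)
    (hU : ∀ s ∈ Icc a b, U s = aff a b x y s) (hP : ∀ s ∈ Ioc a b, P s = aff a b p q s) :
    ∃ Ut Pt, IsLocalPostProcessing a b Vh Qh f U P Ut Pt := by
  have hba : a - b ≠ 0 := (sub_neg.2 hab).ne
  have ha : a ∈ Icc a b := left_mem_Icc.2 hab.le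
  let l : VecSob Ω 1 →ₗ[ℝ] ℝ :=
    (innerₗ _ (f a - VecSob.toL2L ((b - a)⁻¹ • (y - x)))).comp VecSob.toL2L.toLinearMap - aLin x
  obtain ⟨c, hc, hcl⟩ := exists_inner_representative VecSob.toL2L.toLinearMap (discDivFree Vh Qh)
    (fun v _ hv => VecSob.eq_zero_of_toL2 hv) l
  obtain ⟨z, hz, hzl⟩ := exists_pressure (Vh := Vh) (Qh := Qh)
    (l - (innerₗ _ (VecSob.toL2L c)).comp VecSob.toL2L.toLinearMap)
    fun v hv => sub_eq_zero.2 (hcl v hv).symm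
  have hz' : ∀ v ∈ Vh, bForm v z = inner ℝ (f a - VecSob.toL2L ((b - a)⁻¹ • (y - x)))
      (VecSob.toL2L v) - aForm v x - inner ℝ (VecSob.toL2L c) (VecSob.toL2L v) := fun v hv => by
    rw [hzl v hv, ← aLin_apply]; rfl
  -- The new pressure has value `z` at `a` and an unchanged midpoint value, hence `p + q - z` at
  -- `b`; its correction coefficient is `z - p`.
  refine ⟨fun s => aff a b x y s + bubble a b s • c, aff a b z (p + q - z), ⟨c, hc, fun s hs => ?_⟩,
    ⟨z - p, Qh.sub_mem hz hp, fun s hs => ?_⟩, ?_, ?_, fun v hv => ?_, fun s hs => ?_⟩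
  · rw [hU s (Ioc_subset_Icc_self hs)]
  · rw [hP s hs, (hasDerivAt_bubble a b s).deriv]
    have h1 : (2 * s - a - b) / (a - b) = 1 - 2 * ((s - a) / (b - a)) := by
      have hba' : b - a ≠ 0 := (sub_pos.2 hab).ne'
      rw [← neg_sub b a]
      field_simp
      ring
    rw [h1]
    simp only [aff]
    module
  · refine ⟨fun j => if j = 0 then x - (a * (b - a)⁻¹) • (y - x) + (a * b * (a - b)⁻¹) • c else
      if j = 1 then (b - a)⁻¹ • (y - x) - ((a + b) * (a - b)⁻¹) • c else (a - b)⁻¹ • c,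
      fun j => ?_, fun s _ => ?_⟩
    · dsimp only
      have hyx := Submodule.sub_mem _ hy hx
      split_ifs
      · exact Submodule.add_mem _ (Submodule.sub_mem _ hx (Submodule.smul_mem _ _ hyx))
          (Submodule.smul_mem _ _ hc)
      · exact Submodule.sub_mem _ (Submodule.smul_mem _ _ hyx) (Submodule.smul_mem _ _ hc)
      · exact Submodule.smul_mem _ _ hc
    · simp only [aff, bubble, Finset.sum_range_succ, Finset.sum_range_zero, div_eq_mul_inv]
      simp only [if_true, one_ne_zero, if_false, OfNat.ofNat_ne_zero, OfNat.ofNat_ne_one]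
      module
  · exact isPolyOn_aff hz (Qh.sub_mem (Qh.add_mem hp hq) hz) a b _
  · have hd : derivWithin (fun s => aff a b x y s + bubble a b s • c) (Icc a b) a =
        (b - a)⁻¹ • (y - x) + c := by
      have := (((hasDerivAt_aff a b x y a).add ((hasDerivAt_bubble a b a).smul_const
        c)).hasDerivWithinAt (s := Icc a b)).derivWithin (uniqueDiffOn_Icc hab a ha)
      rw [show (2 * a - a - b) / (a - b) = 1 by rw [div_eq_iff hba]; ring, one_smul] at this
      exact this
    have hb0 : bubble a b a = 0 := by simp [bubble]
    rw [hd, aff_left, aff_left, hb0, zero_smul, add_zero, hz' v hv]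
    have hsym : aForm v x = aForm x v := by rw [aForm_eq_inner, aForm_eq_inner, real_inner_comm]
    simp only [← VecSob.toL2L_apply, map_add, inner_add_left, inner_sub_left, hsym]
    ring
  · have hb0 : bubble a b a = 0 := by simp [bubble]
    simp only [aff_left, hb0, zero_smul, add_zero]
    exact hx.2 s hs

end

end StokesFE

namespace StokesFE

noncomputable section

variable {d : ℕ} {Ω : Opens (Pt d)} {Vh : Submodule ℝ (VecSob Ω 1)} {Qh : Submodule ℝ (L2 Ω)}
  {T : ℝ} {M : TimeMesh T} {f : ℝ → VecL2 Ω} {u0h : VecSob Ω 1} {U : ℝ → VecSob Ω 1}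
  {P : ℝ → L2 Ω}

/-! ## Discrete solutions and their post-processing -/

theorem IsDiscreteSolution.affine (h : IsDiscreteSolution M Vh Qh f u0h U P) {n : ℕ}
    (hn : n < M.N) : ∀ s ∈ Icc (M.t n) (M.t (n + 1)),
      U s = aff (M.t n) (M.t (n + 1)) (U (M.t n)) (U (M.t (n + 1))) s := by
  have hlt := M.lt n hn
  obtain ⟨p, _, q, _, hpq⟩ := (h.velocity.2.2 n hn).exists_aff hlt
  have hU := eqOn_Icc_of_eqOn_Ioc hlt (h.velocity.2.1.mono (M.Ibar_subset hn))
    (continuous_aff _ _ p q).continuousOn hpq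
  have h1 := hU _ (left_mem_Icc.2 hlt.le)
  have h2 := hU _ (right_mem_Icc.2 hlt.le)
  rw [aff_left] at h1
  rw [aff_right hlt] at h2
  rw [h1, h2]
  exact hU

/-- The integrated constraint only controls the sum of the two end values, so divergence-freeness
propagates from the initial value. -/
theorem IsDiscreteSolution.mem_discDivFree (h : IsDiscreteSolution M Vh Qh f u0h U P)
    (h0 : u0h ∈ discDivFree Vh Qh) : ∀ n ≤ M.N, U (M.t n) ∈ discDivFree Vh Qh := fun n => by
  induction n with
  | zero => intro _; rw [M.first, h.initial]; exact h0
  | succ n ih =>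
    intro hn
    have hlt := M.lt n hn
    have h1 := ih (by omega)
    refine ⟨h.velocity.1 _ (M.t_mem hn), fun q hq => ?_⟩
    have h2 := h.incompressible n hn q hq
    rw [integral_incompressible hlt (h.affine hn), h1.2 q hq, zero_add] at h2
    exact (mul_eq_zero.1 h2).resolve_left (by linarith)

theorem IsDiscreteSolution.interval_eq (h : IsDiscreteSolution M Vh Qh f u0h U P) {n : ℕ}
    (hn : n < M.N) {p q : L2 Ω}
    (hP : ∀ s ∈ Ioc (M.t n) (M.t (n + 1)), P s = aff (M.t n) (M.t (n + 1)) p q s) :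
    ∀ v ∈ Vh, 2 * inner ℝ ((M.t (n + 1) - M.t n)⁻¹ • (U (M.t (n + 1)) - U (M.t n))).toL2 v.toL2 +
      (aForm (U (M.t n)) v + aForm (U (M.t (n + 1))) v) + (bForm v p + bForm v q) =
        inner ℝ (f (M.t n)) v.toL2 + inner ℝ (f (M.t (n + 1))) v.toL2 := fun v hv => by
  have hlt := M.lt n hn
  have h1 := h.momentum n hn v hv
  rw [integral_scheme hlt (h.affine hn) hP, gaussLobatto] at h1
  exact mul_left_cancel₀ (by linarith) h1

theorem IsDiscreteSolution.exists_isPostProcessing [FiniteDimensional ℝ Vh]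
    [FiniteDimensional ℝ Qh] (h : IsDiscreteSolution M Vh Qh f u0h U P)
    (h0 : u0h ∈ discDivFree Vh Qh) : ∃ Ut Pt, IsPostProcessing M Vh Qh f U P Ut Pt := by
  have hloc : ∀ n, ∃ Ut Pt, n < M.N →
      IsLocalPostProcessing (M.t n) (M.t (n + 1)) Vh Qh f U P Ut Pt := fun n => by
    by_cases hn : n < M.N
    · obtain ⟨p, hp, q, hq, hpq⟩ := (h.pressure n hn).exists_aff (M.lt n hn)
      obtain ⟨Ut, Pt, hUP⟩ := exists_isLocalPostProcessing (M.lt n hn) f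
        (h.mem_discDivFree h0 n hn.le) (h.mem_discDivFree h0 (n + 1) hn) hp hq (h.affine hn) hpq
      exact ⟨Ut, Pt, fun _ => hUP⟩
    -- Indices beyond the mesh carry no condition; any value serves for the choice.
    · exact ⟨0, 0, fun hn' => absurd hn' hn⟩
  choose Ut Pt hUP using hloc
  exact ⟨Ut, Pt, fun n hn => hUP n hn⟩

/-- Testing the difference with `z - z'` removes the pressure and gives `z = z'`; the inf-sup
condition then gives `π = π'`. This uniqueness is what makes the post-processed pressure continuous.
-/
theorem nodal_unique {r : ℕ} {β Ca h : ℝ} (hβ : 0 < β) (hFE : IsFEPair Ω r β Ca h Vh Qh)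
    {z z' : VecSob Ω 1} (hz : z ∈ discDivFree Vh Qh) (hz' : z' ∈ discDivFree Vh Qh) {π π' : L2 Ω}
    (hπ : π ∈ Qh) (hπ' : π' ∈ Qh) {x : VecSob Ω 1} {g : VecL2 Ω}
    (h : ∀ v ∈ Vh, inner ℝ z.toL2 v.toL2 + aForm x v + bForm v π = inner ℝ g v.toL2)
    (h' : ∀ v ∈ Vh, inner ℝ z'.toL2 v.toL2 + aForm x v + bForm v π' = inner ℝ g v.toL2) :
    z = z' ∧ π = π' := by
  have hd : ∀ v ∈ Vh, inner ℝ (z - z').toL2 v.toL2 + bForm v (π - π') = 0 := fun v hv => by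
    have h1 := h v hv
    have h2 := h' v hv
    simp only [← VecSob.toL2L_apply, map_sub, inner_sub_left, bForm_sub_right] at *
    linarith
  have hzd : z - z' ∈ discDivFree Vh Qh := Submodule.sub_mem _ hz hz'
  have hπd : π - π' ∈ Qh := Qh.sub_mem hπ hπ'
  have e1 : z - z' = 0 := by
    have := hd _ hzd.1
    rw [hzd.2 _ hπd, add_zero] at this
    exact VecSob.eq_zero_of_toL2 (inner_self_eq_zero.1 this)
  have e2 : π - π' = 0 := hFE.eq_zero_of_bForm hβ hπd fun v hv => by
    have := hd v hv
    rw [e1, ← VecSob.toL2L_apply, map_zero, inner_zero_left, zero_add] at this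
    exact this
  exact ⟨sub_eq_zero.1 e1, sub_eq_zero.1 e2⟩

/-- The nodal values `z n = ∂ₜũ(t n)`, `π n = p̃(t n)` of the post-processed trajectories. -/
structure IsNodal (M : TimeMesh T) (Vh : Submodule ℝ (VecSob Ω 1)) (Qh : Submodule ℝ (L2 Ω))
    (f : ℝ → VecL2 Ω) (U : ℝ → VecSob Ω 1) (Pt : ℕ → ℝ → L2 Ω) (z : ℕ → VecSob Ω 1)
    (π : ℕ → L2 Ω) : Prop where
  velocity_mem : ∀ n ≤ M.N, z n ∈ discDivFree Vh Qh
  pressure_mem : ∀ n ≤ M.N, π n ∈ Qh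
  eqn : ∀ n ≤ M.N, ∀ v ∈ Vh,
    inner ℝ (z n).toL2 v.toL2 + aForm (U (M.t n)) v + bForm v (π n) = inner ℝ (f (M.t n)) v.toL2
  step : ∀ n < M.N, U (M.t (n + 1)) - U (M.t n) =
    ((M.t (n + 1) - M.t n) / 2) • (z n + z (n + 1))
  pressure_eq : ∀ n < M.N, ∀ s ∈ M.Ibar n, Pt n s = aff (M.t n) (M.t (n + 1)) (π n) (π (n + 1)) s

theorem IsPostProcessing.exists_nodal (hT : 0 < T) {r : ℕ} {β Ca h : ℝ} (hβ : 0 < β)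
    (hFE : IsFEPair Ω r β Ca h Vh Qh) (hsol : IsDiscreteSolution M Vh Qh f u0h U P)
    (h0 : u0h ∈ discDivFree Vh Qh) {Ut : ℕ → ℝ → VecSob Ω 1} {Pt : ℕ → ℝ → L2 Ω}
    (hpp : IsPostProcessing M Vh Qh f U P Ut Pt) :
    ∃ z π, IsNodal M Vh Qh f U Pt z π ∧ z 0 = derivWithin (Ut 0) (M.Ibar 0) 0 := by
  have hex := fun n (hn : n < M.N) => (hsol.pressure n hn).exists_aff (M.lt n hn)
  choose p _ q _ hpq using hex
  have loc := fun n (hn : n < M.N) =>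
    (hpp n hn).nodal (M.lt n hn) (hsol.mem_discDivFree h0 n hn.le)
      (hsol.mem_discDivFree h0 (n + 1) hn) (hsol.affine hn) (hpq n hn)
      (hsol.interval_eq hn (hpq n hn))
  -- Nodal values are taken from the interval on the left, except at the first mesh point.
  let z : ℕ → VecSob Ω 1 := fun n => Nat.casesOn n (derivWithin (Ut 0) (M.Ibar 0) (M.t 0))
    fun k => derivWithin (Ut k) (M.Ibar k) (M.t (k + 1))
  let π : ℕ → L2 Ω := fun n => Nat.casesOn n (Pt 0 (M.t 0)) fun k => Pt k (M.t (k + 1))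
  have hN := M.N_pos hT
  have hzm : ∀ n ≤ M.N, z n ∈ discDivFree Vh Qh := fun n hn => by
    cases n with
    | zero => exact (loc 0 hN).1
    | succ k => exact (loc k hn).2.1
  have hπm : ∀ n ≤ M.N, π n ∈ Qh := fun n hn => by
    cases n with
    | zero => exact (loc 0 hN).2.2.2.1
    | succ k => exact (loc k hn).2.2.2.2.1
  have heqn : ∀ n ≤ M.N, ∀ v ∈ Vh, inner ℝ (z n).toL2 v.toL2 + aForm (U (M.t n)) v +
      bForm v (π n) = inner ℝ (f (M.t n)) v.toL2 := fun n hn => by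
    cases n with
    | zero => exact (loc 0 hN).2.2.2.2.2.2.1
    | succ k => exact (loc k hn).2.2.2.2.2.2.2
  -- One-sided values from the left and from the right solve the same nodal equation, hence
  -- coincide.
  have hright : ∀ n < M.N, z n = derivWithin (Ut n) (M.Ibar n) (M.t n) ∧ π n = Pt n (M.t n) :=
    fun n hn => nodal_unique hβ hFE (hzm n hn.le) (loc n hn).1 (hπm n hn.le) (loc n hn).2.2.2.1
      (heqn n hn.le) (loc n hn).2.2.2.2.2.2.1
  refine ⟨z, π, ⟨hzm, hπm, heqn, fun n hn => ?_, fun n hn s hs => ?_⟩, ?_⟩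
  · rw [(hright n hn).1]
    exact (loc n hn).2.2.1
  · rw [(hright n hn).2]
    exact (loc n hn).2.2.2.2.2.1 s hs
  · change derivWithin (Ut 0) (M.Ibar 0) (M.t 0) = _
    rw [M.first]

theorem IsNodal.glue_eq {Pt : ℕ → ℝ → L2 Ω} {z : ℕ → VecSob Ω 1} {π : ℕ → L2 Ω}
    (hz : IsNodal M Vh Qh f U Pt z π) {n : ℕ} (hn : n < M.N) {s : ℝ} (hs : s ∈ M.Ibar n) :
    M.glue Pt s = aff (M.t n) (M.t (n + 1)) (π n) (π (n + 1)) s := by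
  rw [M.glue_of_mem_Ibar Pt (fun k hk => ?_) hn hs, hz.pressure_eq n hn s hs]
  have hk' : k < M.N := by omega
  rw [hz.pressure_eq k hk' _ (right_mem_Icc.2 (M.lt k hk').le), aff_right (M.lt k hk'),
    hz.pressure_eq (k + 1) hk _ (left_mem_Icc.2 (M.lt _ hk).le), aff_left]

theorem IsNodal.continuousOn_glue {Pt : ℕ → ℝ → L2 Ω} {z : ℕ → VecSob Ω 1} {π : ℕ → L2 Ω}
    (hz : IsNodal M Vh Qh f U Pt z π) : ContinuousOn (M.glue Pt) (Icc 0 T) :=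
  M.continuousOn_of_Ibar fun _ hn =>
    (continuous_aff _ _ _ _).continuousOn.congr fun _ hs => hz.glue_eq hn hs

theorem IsNodal.inX (hT : 0 < T) {Pt : ℕ → ℝ → L2 Ω} {z : ℕ → VecSob Ω 1} {π : ℕ → L2 Ω}
    (hz : IsNodal M Vh Qh f U Pt z π) : InX M 1 Qh (M.glue Pt) := by
  refine ⟨fun s hs => ?_, hz.continuousOn_glue, fun n hn => ?_⟩
  · have : ∃ n < M.N, s ∈ M.Ibar n := by
      rcases eq_or_lt_of_le hs.1 with h | h
      · have hN := M.N_pos hT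
        refine ⟨0, hN, ?_⟩
        rw [← h, ← M.first]
        exact left_mem_Icc.2 (M.lt 0 hN).le
      · obtain ⟨n, hn, hsn⟩ := M.exists_mem_I ⟨h, hs.2⟩
        exact ⟨n, hn, Ioc_subset_Icc_self hsn⟩
    obtain ⟨n, hn, hsn⟩ := this
    rw [hz.glue_eq hn hsn]
    exact aff_mem (hz.pressure_mem n hn.le) (hz.pressure_mem _ hn) _ _ _
  · obtain ⟨W, hW, hs⟩ := isPolyOn_aff (hz.pressure_mem n hn.le) (hz.pressure_mem (n + 1) hn)
      (M.t n) (M.t (n + 1)) (M.I n)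
    exact ⟨W, hW, fun s hsI => by rw [hz.glue_eq hn (Ioc_subset_Icc_self hsI), hs s hsI]⟩

/-- All trajectories are affine on an interval, so the integral in the scheme is a trapezoidal sum,
namely the average of the nodal equations at its ends times the step. -/
theorem IsNodal.isDiscreteSolution (hT : 0 < T) (hsol : IsDiscreteSolution M Vh Qh f u0h U P)
    {Pt : ℕ → ℝ → L2 Ω} {z : ℕ → VecSob Ω 1} {π : ℕ → L2 Ω} (hz : IsNodal M Vh Qh f U Pt z π) :
    IsDiscreteSolution M Vh Qh f u0h U (M.glue Pt) := by
  refine ⟨hsol.velocity, (hz.inX hT).2.2, hsol.initial, fun n hn v hv => ?_, hsol.incompressible⟩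
  have hlt := M.lt n hn
  have hne : M.t (n + 1) - M.t n ≠ 0 := (sub_pos.2 hlt).ne'
  rw [integral_scheme hlt (hsol.affine hn) fun s hs => hz.glue_eq hn (Ioc_subset_Icc_self hs),
    gaussLobatto, hz.step n hn, smul_smul,
    show (M.t (n + 1) - M.t n)⁻¹ * ((M.t (n + 1) - M.t n) / 2) = 1 / 2 by field_simp]
  have h1 := hz.eqn n hn.le v hv
  have h2 := hz.eqn (n + 1) hn v hv
  simp only [← VecSob.toL2L_apply, map_add, map_smul, inner_add_left, real_inner_smul_left] at *
  rw [← h1, ← h2]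
  ring

end

end StokesFE

namespace StokesFE

noncomputable section

variable {d : ℕ} {Ω : Opens (Pt d)} {r : ℕ}

/-! ## The continuous problem in weak form -/

/-- The space of pairs of a velocity in `H^{r+1}(Ω)^d` and a pressure in `H^r(Ω)`. -/
abbrev VelPres (Ω : Opens (Pt d)) (r : ℕ) := VecSob Ω (r + 1) × Sob Ω r

/-- The velocity of a pair in `H^1(Ω)^d`. -/
def velH1 : VelPres Ω r →L[ℝ] VecSob Ω 1 :=
  (VecSob.toH1L (Nat.le_add_left 1 r)).comp (ContinuousLinearMap.fst ℝ _ _)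

/-- The velocity of a pair in `L²(Ω)^d`. -/
def velL2 : VelPres Ω r →L[ℝ] VecL2 Ω :=
  VecSob.toL2L.comp (ContinuousLinearMap.fst ℝ _ _)

/-- The pressure of a pair in `L²(Ω)`. -/
def presL2 : VelPres Ω r →L[ℝ] L2 Ω :=
  (Sob.jetL (DerivIdx.zero d r)).comp (ContinuousLinearMap.snd ℝ _ _)

theorem norm_presL2_le (y : VelPres Ω r) : ‖presL2 y‖ ≤ ‖y‖ :=
  ((PiLp.norm_apply_le y.2.jet (DerivIdx.zero d r)).trans (Sob.jet.norm_map y.2).le).trans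
    (norm_snd_le y)

/-- Divergence-free velocities in `V` with pressures in `L²_0(Ω)`. -/
def IsAdmissible (y : VelPres Ω r) : Prop :=
  velH1 y ∈ V Ω ∧ divL (velH1 y) = 0 ∧ MeanZero (presL2 y)

/-- The integral over a bounded set as a continuous functional on `L²`. -/
def meanL [IsFiniteMeasure (volume.restrict (Ω : Set (Pt d)))] : L2 Ω →L[ℝ] ℝ :=
  innerSL ℝ (indicatorConstLp 2 MeasurableSet.univ (measure_ne_top _ _) (1 : ℝ))

theorem meanL_eq_zero_iff [IsFiniteMeasure (volume.restrict (Ω : Set (Pt d)))] (q : L2 Ω) :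
    meanL q = 0 ↔ MeanZero q := by
  rw [meanL, innerSL_apply_apply, L2.inner_indicatorConstLp_one, Measure.restrict_univ]
  rfl

/-- The closed subspace of the admissible pairs. -/
def admissible (Ω : Opens (Pt d)) [IsFiniteMeasure (volume.restrict (Ω : Set (Pt d)))] (r : ℕ) :
    Submodule ℝ (VelPres Ω r) :=
  (V Ω).comap (velH1 (Ω := Ω) (r := r)).toLinearMap ⊓
    ((divL.comp (velH1 (Ω := Ω) (r := r))).toLinearMap.ker ⊓
      (meanL.comp (presL2 (Ω := Ω) (r := r))).toLinearMap.ker)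

theorem mem_admissible_iff [IsFiniteMeasure (volume.restrict (Ω : Set (Pt d)))]
    (y : VelPres Ω r) : y ∈ admissible Ω r ↔ IsAdmissible y := by
  rw [IsAdmissible, ← meanL_eq_zero_iff]
  rfl

theorem isClosed_admissible [IsFiniteMeasure (volume.restrict (Ω : Set (Pt d)))] :
    IsClosed (admissible Ω r : Set (VelPres Ω r)) :=
  (isClosed_V.preimage (velH1 (Ω := Ω) (r := r)).continuous).inter
    ((divL.comp (velH1 (Ω := Ω) (r := r))).isClosed_ker.inter
      (meanL.comp (presL2 (Ω := Ω) (r := r))).isClosed_ker)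

/-- Derivatives lie in the closed span of the values. Thus `(∂ₜu, ∂ₜp)` inherits boundary values,
zero divergence and zero mean, and its Stokes projection has the same error bound. -/
theorem derivWithin_mem_of_isClosed {E : Type*} [NormedAddCommGroup E] [NormedSpace ℝ E]
    {Z : Submodule ℝ E} (hZ : IsClosed (Z : Set E)) {s : Set ℝ} {g : ℝ → E}
    (hg : ∀ t ∈ s, g t ∈ Z) (t : ℝ) : derivWithin g s t ∈ Z := by
  have h1 := range_derivWithin_subset_closure_span_image g (s := s) (t := s)
    (by rw [inter_self]; exact subset_closure) (mem_range_self t)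
  have h2 : Submodule.span ℝ (g '' s) ≤ Z := Submodule.span_le.2 (by
    rintro _ ⟨x, hx, rfl⟩; exact hg x hx)
  exact closure_minimal h2 hZ h1

section Exact

variable {T : ℝ} {hr : 1 ≤ r} {f : ℝ → VecL2 Ω} {u₀ : VecL2 Ω} {u : ℝ → VecSob Ω (r + 1)}
  {p : ℝ → Sob Ω r}

theorem IsRegular.contDiffOn_pair (hreg : IsRegular T f u p) :
    ContDiffOn ℝ 2 (fun t => (u t, p t)) (Icc 0 T) := hreg.velocity.prodMk hreg.pressure

theorem IsRegular.derivWithin_pair (hT : 0 < T) (hreg : IsRegular T f u p) {t : ℝ}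
    (ht : t ∈ Icc 0 T) : derivWithin (fun t => (u t, p t)) (Icc 0 T) t =
      (derivWithin u (Icc 0 T) t, derivWithin p (Icc 0 T) t) :=
  ((hasDerivWithinAt_of_contDiffOn two_ne_zero hreg.velocity ht).prodMk
    (hasDerivWithinAt_of_contDiffOn two_ne_zero hreg.pressure ht)).derivWithin
      (uniqueDiffOn_Icc hT t ht)

theorem ContDiffOn.derivWithin_velL2 (hT : 0 < T) {y : ℝ → VelPres Ω r}
    (hy : ContDiffOn ℝ 2 y (Icc 0 T)) {t : ℝ} (ht : t ∈ Icc 0 T) :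
    derivWithin (fun t => velL2 (y t)) (Icc 0 T) t = velL2 (derivWithin y (Icc 0 T) t) :=
  ((velL2 (r := r)).hasFDerivAt.comp_hasDerivWithinAt t
    (hasDerivWithinAt_of_contDiffOn two_ne_zero hy ht)).derivWithin (uniqueDiffOn_Icc hT t ht)

theorem IsStokesSolution.isAdmissible (hT : 0 < T) (hsol : IsStokesSolution Ω T hr f u₀ u p)
    (hreg : IsRegular T f u p) {t : ℝ} (ht : t ∈ Icc 0 T) : IsAdmissible (u t, p t) := by
  refine ⟨hsol.boundary t ht, ?_, hsol.mean_zero t ht⟩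
  refine eqOn_Icc_of_eqOn_Ioc hT (F := fun t => divL (velH1 (u t, p t))) (G := fun _ => 0)
    ((divL.comp velH1).continuous.comp_continuousOn hreg.contDiffOn_pair.continuousOn)
    continuousOn_const (fun s hs => ?_) t ht
  rw [divL_apply]
  exact hsol.incompressible s hs

theorem IsStokesSolution.strong (hT : 0 < T) (hsol : IsStokesSolution Ω T hr f u₀ u p)
    (hreg : IsRegular T f u p) {t : ℝ} (ht : t ∈ Icc 0 T) :
    derivWithin (fun t => velL2 (u t, p t)) (Icc 0 T) t + stokesOp hr (u t, p t) = f t := by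
  have hv : ContDiffOn ℝ 4 (fun t => velL2 (u t, p t)) (Icc 0 T) := hreg.velocity_L2
  refine eqOn_Icc_of_eqOn_Ioc hT
    (F := fun t => derivWithin (fun t => velL2 (u t, p t)) (Icc 0 T) t + stokesOp hr (u t, p t))
    (G := f)
    ((hv.continuousOn_derivWithin (uniqueDiffOn_Icc hT) (by norm_num)).add
      ((stokesOp hr).continuous.comp_continuousOn hreg.contDiffOn_pair.continuousOn))
    hreg.force.continuousOn (fun s hs => ?_) t ht
  ext1 i
  rw [PiLp.add_apply, stokesOp_apply, ← hsol.momentum s hs i]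
  change (derivWithin (fun s => (u s).toL2) (Icc 0 T) s) i + _ = _
  abel

/-- The weak form of the momentum equation. -/
theorem IsStokesSolution.weak (hT : 0 < T) (hsol : IsStokesSolution Ω T hr f u₀ u p)
    (hreg : IsRegular T f u p) {t : ℝ} (ht : t ∈ Icc 0 T) {v : VecSob Ω 1} (hv : v ∈ V Ω) :
    inner ℝ (velL2 (derivWithin (fun t => (u t, p t)) (Icc 0 T) t)) v.toL2 +
      aForm (velH1 (u t, p t)) v + bForm v (presL2 (u t, p t)) = inner ℝ (f t) v.toL2 := by
  rw [← hsol.strong hT hreg ht, inner_add_left, inner_stokesOp hr _ _ hv,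
    ContDiffOn.derivWithin_velL2 hT hreg.contDiffOn_pair ht, add_assoc]
  rfl

end Exact

end

end StokesFE

namespace StokesFE

noncomputable section

variable {d : ℕ} {Ω : Opens (Pt d)} {r : ℕ}

/-! ## Error estimates -/

/-- The bounds for an exact trajectory `y` with derivative `y'` on which the error analysis of
the scheme depends. -/
structure ExactBounds [IsFiniteMeasure (volume.restrict (Ω : Set (Pt d)))] (T : ℝ)
    (f : ℝ → VecL2 Ω) (y y' : ℝ → VelPres Ω r) (K Kt S : ℝ) : Prop where
  mem : ∀ t ∈ Icc 0 T, y t ∈ admissible Ω r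
  deriv_mem : ∀ t ∈ Icc 0 T, y' t ∈ admissible Ω r
  weak : ∀ t ∈ Icc 0 T, ∀ v ∈ V Ω, inner ℝ (velL2 (y' t)) v.toL2 + aForm (velH1 (y t)) v +
    bForm v (presL2 (y t)) = inner ℝ (f t) v.toL2
  continuousOn : ContinuousOn y (Icc 0 T)
  K_nonneg : 0 ≤ K
  Kt_nonneg : 0 ≤ Kt
  S_nonneg : 0 ≤ S
  bound : ∀ t ∈ Icc 0 T, ‖y t‖ ≤ K
  deriv_bound : ∀ t ∈ Icc 0 T, ‖y' t‖ ≤ K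
  deriv_lipschitz : ∀ s ∈ Icc 0 T, ∀ t ∈ Icc 0 T, ‖y' t - y' s‖ ≤ K * |t - s|
  interp : ∀ a ∈ Icc 0 T, ∀ b ∈ Icc 0 T, ∀ θ ∈ Icc (0 : ℝ) 1, a ≤ b →
    ‖y (a + θ * (b - a)) - (y a + θ • (y b - y a))‖ ≤ K * (b - a) ^ 2
  trapezoid : ∀ a ∈ Icc 0 T, ∀ b ∈ Icc 0 T, a ≤ b →
    ‖y b - y a - ((b - a) / 2) • (y' a + y' b)‖ ≤ K * (b - a) ^ 2
  trapezoid_L2 : ∀ a ∈ Icc 0 T, ∀ b ∈ Icc 0 T, a ≤ b →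
    ‖velL2 (y b - y a - ((b - a) / 2) • (y' a + y' b))‖ ≤ Kt * (b - a) ^ 3
  stokes : ∀ w : VelPres Ω r, ∀ v ∈ V Ω,
    |aForm (velH1 w) v + bForm v (presL2 w)| ≤ S * ‖w‖ * ‖v.toL2‖

theorem exists_exactBounds [IsFiniteMeasure (volume.restrict (Ω : Set (Pt d)))] {T : ℝ}
    (hT : 0 < T) {hr : 1 ≤ r} {f : ℝ → VecL2 Ω} {u₀ : VecL2 Ω} {u : ℝ → VecSob Ω (r + 1)}
    {p : ℝ → Sob Ω r} (hsol : IsStokesSolution Ω T hr f u₀ u p) (hreg : IsRegular T f u p) :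
    ∃ K Kt S : ℝ, ExactBounds T f (fun t => (u t, p t))
      (derivWithin (fun t => (u t, p t)) (Icc 0 T)) K Kt S := by
  have hy := hreg.contDiffOn_pair
  set y : ℝ → VelPres Ω r := fun t => (u t, p t) with hydef
  obtain ⟨K₀, hK₀, b0⟩ := exists_bound_of_continuousOn hy.continuousOn
  obtain ⟨K₁, hK₁, b1, b2, b3, b4⟩ := exists_interp_bound hT hy
  have hyL : ContDiffOn ℝ 3 (fun t => velL2 (y t)) (Icc 0 T) :=
    hreg.velocity_L2.of_le (by norm_num)
  obtain ⟨Kt, hKt, b5⟩ := exists_trapezoid_bound hT hyL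
  have hmem : ∀ t ∈ Icc 0 T, y t ∈ admissible Ω r := fun t ht =>
    (mem_admissible_iff _).2 (hsol.isAdmissible hT hreg ht)
  have hle : K₁ ≤ K₀ + K₁ := by linarith
  -- `K` collects the bounds in `H^{r+1} × H^r`, where two time derivatives exist; `Kt` is the
  -- third-order trapezoidal bound available only in `L²`; `S` is the norm of the Stokes operator.
  refine ⟨K₀ + K₁, Kt, ‖stokesOp (Ω := Ω) hr‖, hmem,
    fun t _ => derivWithin_mem_of_isClosed isClosed_admissible hmem t,
    fun t ht v hv => hsol.weak hT hreg ht hv, hy.continuousOn, by positivity, hKt,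
    (stokesOp hr).opNorm_nonneg,
    fun t ht => (b0 t ht).trans (by linarith), fun t ht => (b1 t ht).trans hle,
    fun s hs t ht => (b2 s hs t ht).trans (mul_le_mul_of_nonneg_right hle (abs_nonneg _)),
    fun a ha b hb θ hθ hab => (b3 a ha b hb θ hθ hab).trans
      (mul_le_mul_of_nonneg_right hle (sq_nonneg _)),
    fun a ha b hb hab => (b4 a ha b hb hab).trans (mul_le_mul_of_nonneg_right hle (sq_nonneg _)),
    fun a ha b hb hab => ?_, fun w v hv => ?_⟩
  · have := b5 a ha b hb hab
    rw [ContDiffOn.derivWithin_velL2 hT hy ha, ContDiffOn.derivWithin_velL2 hT hy hb] at this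
    simpa only [map_sub, map_smul, map_add] using this
  · have h1 : aForm (velH1 w) v + bForm v (presL2 w) = inner ℝ (stokesOp hr w) v.toL2 :=
      (inner_stokesOp hr w.1 w.2 hv).symm
    rw [h1]
    exact (abs_real_inner_le_norm _ _).trans
      (mul_le_mul_of_nonneg_right ((stokesOp hr).le_opNorm w) (norm_nonneg _))

variable {Vh : Submodule ℝ (VecSob Ω 1)} {Qh : Submodule ℝ (L2 Ω)}

/-- The Stokes projection of admissible pairs has errors at most `c`, relative to the norm. -/
def HasStokesBound (Vh : Submodule ℝ (VecSob Ω 1)) (Qh : Submodule ℝ (L2 Ω)) (r : ℕ) (c : ℝ) :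
    Prop :=
  ∀ (w : VelPres Ω r) (x : VecSob Ω 1 × L2 Ω), IsAdmissible w →
    IsStokesProj Vh Qh (velH1 w) (presL2 w) x →
    ‖velL2 w - x.1.toL2‖ ≤ c * ‖w‖ ∧ ‖presL2 w - x.2‖ ≤ c * ‖w‖

/-- By linearity the trapezoidal defect of the projections is the projection of the exact defect.
Both the projection error bound and the defining identity then apply to `δ`. -/
theorem IsStokesProj.defect {w₀ w₁ w₀' w₁' : VelPres Ω r} {x₀ x₁ x₀' x₁' : VecSob Ω 1 × L2 Ω}
    (h₀ : IsStokesProj Vh Qh (velH1 w₀) (presL2 w₀) x₀)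
    (h₁ : IsStokesProj Vh Qh (velH1 w₁) (presL2 w₁) x₁)
    (h₀' : IsStokesProj Vh Qh (velH1 w₀') (presL2 w₀') x₀')
    (h₁' : IsStokesProj Vh Qh (velH1 w₁') (presL2 w₁') x₁') (k l : ℝ) :
    IsStokesProj Vh Qh (velH1 (k • (w₁ - w₀ - l • (w₀' + w₁'))))
      (presL2 (k • (w₁ - w₀ - l • (w₀' + w₁')))) (k • (x₁ - x₀ - l • (x₀' + x₁'))) := by
  have := ((h₁.sub h₀).sub ((h₀'.add h₁').smul l)).smul k
  simpa only [map_smul, map_sub, map_add] using this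

theorem trapezoidal_error_step {X : Type*} [AddCommGroup X] [Module ℝ X] {τ : ℝ} (hτ : τ ≠ 0)
    (x₀ x₁ x₀' x₁' U₀ z₀ z₁ : X) :
    x₁ - (U₀ + (τ / 2) • (z₀ + z₁)) - (x₀ - U₀) =
      τ • ((1 / 2 : ℝ) • (x₀' - z₀ + (x₁' - z₁)) + τ⁻¹ • (x₁ - x₀ - (τ / 2) • (x₀' + x₁'))) := by
  rw [smul_add τ, smul_smul τ τ⁻¹, mul_inv_cancel₀ hτ, one_smul]
  module

theorem aff_error_split {X : Type*} [AddCommGroup X] [Module ℝ X] (a b s : ℝ)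
    (x p₀ p₁ r₀ r₁ π₀ π₁ : X) : x - aff a b π₀ π₁ s =
      x - aff a b p₀ p₁ s + aff a b (p₀ - r₀) (p₁ - r₁) s + aff a b (r₀ - π₀) (r₁ - π₁) s := by
  simp only [aff]
  module

section Estimates

variable [IsFiniteMeasure (volume.restrict (Ω : Set (Pt d)))] {T : ℝ} {M : TimeMesh T}
  {f : ℝ → VecL2 Ω} {U : ℝ → VecSob Ω 1} {Pt : ℕ → ℝ → L2 Ω} {z : ℕ → VecSob Ω 1} {π : ℕ → L2 Ω}
  {y y' : ℝ → VelPres Ω r} {K Kt S c : ℝ} {R R' : ℕ → VecSob Ω 1 × L2 Ω}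

/-- The Stokes projection reproduces `a(u, ·) + b(·, p)` on `V_h`, so only the time derivative
leaves a residual. -/
theorem IsNodal.error_eqn (hz : IsNodal M Vh Qh f U Pt z π) (hex : ExactBounds T f y y' K Kt S)
    (hV : Vh ≤ V Ω)
    (hR : ∀ n ≤ M.N, IsStokesProj Vh Qh (velH1 (y (M.t n))) (presL2 (y (M.t n))) (R n))
    {n : ℕ} (hn : n ≤ M.N) {v : VecSob Ω 1} (hv : v ∈ Vh) :
    inner ℝ ((R' n).1 - z n).toL2 v.toL2 + aForm ((R n).1 - U (M.t n)) v +
      bForm v ((R n).2 - π n) = -inner ℝ (velL2 (y' (M.t n)) - (R' n).1.toL2) v.toL2 := by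
  have h1 := hex.weak _ (M.t_mem hn) v (hV hv)
  have h2 := hz.eqn n hn v hv
  have h3 := (hR n hn).2.2.1 v hv
  simp only [← VecSob.toL2L_apply, aForm_eq_inner, map_sub, inner_sub_left, bForm_sub_right] at *
  linarith

set_option maxHeartbeats 2000000 in
theorem IsNodal.velocity_error_bounds (hT : 0 < T) (hz : IsNodal M Vh Qh f U Pt z π)
    (hex : ExactBounds T f y y' K Kt S) (hV : Vh ≤ V Ω)
    (hU : ∀ n ≤ M.N, U (M.t n) ∈ discDivFree Vh Qh) (hc : 0 ≤ c) (hst : HasStokesBound Vh Qh r c)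
    (hR : ∀ n ≤ M.N, IsStokesProj Vh Qh (velH1 (y (M.t n))) (presL2 (y (M.t n))) (R n))
    (hR' : ∀ n ≤ M.N, IsStokesProj Vh Qh (velH1 (y' (M.t n))) (presL2 (y' (M.t n))) (R' n))
    {e E : ℕ → VecSob Ω 1} (he : ∀ n, e n = (R n).1 - U (M.t n))
    (hE : ∀ n, E n = (R' n).1 - z n) :
    (∀ n ≤ M.N, (∑ k ∈ Finset.range n, (M.t (k + 1) - M.t k) *
        ‖((1 / 2 : ℝ) • (E k + E (k + 1))).toL2‖ ^ 2) + ‖gradL (e n)‖ ^ 2 ≤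
      ‖gradL (e 0)‖ ^ 2 + 6 * (Kt * M.tau ^ 2 + c * K * (T + 1)) ^ 2 * T) ∧
    (∑ k ∈ Finset.range M.N, (M.t (k + 1) - M.t k) * ‖(E (k + 1) - E k).toL2‖ ^ 2) ≤
      M.tau ^ 2 * ‖gradL (E 0)‖ ^ 2 + M.tau ^ 2 * (c * K + S * K * M.tau) ^ 2 * T := by
  have hK := hex.K_nonneg
  have hKt := hex.Kt_nonneg
  have hS := hex.S_nonneg
  have htau := (M.tau_pos hT).le
  have hτpos : ∀ n < M.N, 0 < M.t (n + 1) - M.t n := fun n hn => sub_pos.2 (M.lt n hn)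
  set W := discDivFree Vh Qh with hW
  set ρ : ℕ → VecL2 Ω := fun n => velL2 (y' (M.t n)) - (R' n).1.toL2 with hρ
  set δ : ℕ → VecSob Ω 1 := fun n => (M.t (n + 1) - M.t n)⁻¹ •
    ((R (n + 1)).1 - (R n).1 - ((M.t (n + 1) - M.t n) / 2) • ((R' n).1 + (R' (n + 1)).1)) with hδ
  have heW : ∀ n ≤ M.N, e n ∈ W := fun n hn => by
    rw [he]; exact W.sub_mem (hR n hn).mem_discDivFree (hU n hn)
  have hEW : ∀ n ≤ M.N, E n ∈ W := fun n hn => by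
    rw [hE]; exact W.sub_mem (hR' n hn).mem_discDivFree (hz.velocity_mem n hn)
  have heq : ∀ n ≤ M.N, ∀ v ∈ W,
      inner ℝ (VecSob.toL2L.toLinearMap (E n)) (VecSob.toL2L.toLinearMap v) +
        inner ℝ (gradL.toLinearMap (e n)) (gradL.toLinearMap v) =
      -inner ℝ (ρ n) (VecSob.toL2L.toLinearMap v) := fun n hn v hv => by
    have h1 := hz.error_eqn (R' := R') hex hV hR hn hv.1
    rw [hv.2 _ (Qh.sub_mem (hR n hn).2.1 (hz.pressure_mem n hn)), add_zero, aForm_eq_inner,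
      ← he, ← hE] at h1
    exact h1
  have hstep : ∀ n < M.N, e (n + 1) - e n =
      (M.t (n + 1) - M.t n) • ((1 / 2 : ℝ) • (E n + E (n + 1)) + δ n) := fun n hn => by
    have h1 := hz.step n hn
    have h2 : U (M.t (n + 1)) = U (M.t n) +
      ((M.t (n + 1) - M.t n) / 2) • (z n + z (n + 1)) := by rw [← h1]; abel
    rw [he, he, hE, hE, h2]
    exact trapezoidal_error_step (hτpos n hn).ne' _ _ _ _ _ _ _
  have hdef : ∀ n < M.N, IsStokesProj Vh Qh
      (velH1 ((M.t (n + 1) - M.t n)⁻¹ • (y (M.t (n + 1)) - y (M.t n) -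
        ((M.t (n + 1) - M.t n) / 2) • (y' (M.t n) + y' (M.t (n + 1))))))
      (presL2 ((M.t (n + 1) - M.t n)⁻¹ • (y (M.t (n + 1)) - y (M.t n) -
        ((M.t (n + 1) - M.t n) / 2) • (y' (M.t n) + y' (M.t (n + 1))))))
      ((M.t (n + 1) - M.t n)⁻¹ • (R (n + 1) - R n -
        ((M.t (n + 1) - M.t n) / 2) • (R' n + R' (n + 1)))) := fun n hn =>
    (hR n hn.le).defect (hR (n + 1) hn) (hR' n hn.le) (hR' (n + 1) hn) _ _
  have hadm : ∀ n < M.N, (M.t (n + 1) - M.t n)⁻¹ • (y (M.t (n + 1)) - y (M.t n) -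
        ((M.t (n + 1) - M.t n) / 2) • (y' (M.t n) + y' (M.t (n + 1)))) ∈ admissible Ω r :=
    fun n hn => Submodule.smul_mem _ _ (Submodule.sub_mem _ (Submodule.sub_mem _
      (hex.mem _ (M.t_mem hn)) (hex.mem _ (M.t_mem hn.le))) (Submodule.smul_mem _ _
        (Submodule.add_mem _ (hex.deriv_mem _ (M.t_mem hn.le)) (hex.deriv_mem _ (M.t_mem hn)))))
  have hw : ∀ n < M.N, ‖(M.t (n + 1) - M.t n)⁻¹ • (y (M.t (n + 1)) - y (M.t n) -
        ((M.t (n + 1) - M.t n) / 2) • (y' (M.t n) + y' (M.t (n + 1))))‖ ≤ K * M.tau :=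
    fun n hn => by
      have h1 := hex.trapezoid _ (M.t_mem hn.le) _ (M.t_mem hn) (M.lt n hn).le
      have hp := hτpos n hn
      rw [norm_smul, Real.norm_eq_abs, abs_of_pos (inv_pos.2 hp), inv_mul_le_iff₀ hp]
      refine h1.trans ?_
      have := mul_le_mul_of_nonneg_left (M.le_tau hn) (mul_nonneg hK hp.le)
      linarith
  have hwL : ∀ n < M.N, ‖velL2 ((M.t (n + 1) - M.t n)⁻¹ • (y (M.t (n + 1)) - y (M.t n) -
        ((M.t (n + 1) - M.t n) / 2) • (y' (M.t n) + y' (M.t (n + 1)))))‖ ≤ Kt * M.tau ^ 2 :=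
    fun n hn => by
      have h1 := hex.trapezoid_L2 _ (M.t_mem hn.le) _ (M.t_mem hn) (M.lt n hn).le
      have hp := hτpos n hn
      rw [map_smul, norm_smul, Real.norm_eq_abs, abs_of_pos (inv_pos.2 hp), inv_mul_le_iff₀ hp]
      refine h1.trans ?_
      have h2 : (M.t (n + 1) - M.t n) ^ 2 ≤ M.tau ^ 2 := pow_le_pow_left₀ hp.le (M.le_tau hn) 2
      have := mul_le_mul_of_nonneg_left h2 (mul_nonneg hKt hp.le)
      linarith
  -- One constant serves both `ρ` and `δ`: `ρ` contributes `c K`, while the projection error in `δ`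
  -- is at most `c K τ ≤ c K T`.
  have hρD : ∀ n ≤ M.N, ‖ρ n‖ ≤ Kt * M.tau ^ 2 + c * K * (T + 1) := fun n hn => by
    have h1 := (hst _ _ ((mem_admissible_iff _).1 (hex.deriv_mem _ (M.t_mem hn))) (hR' n hn)).1
    have h2 := mul_le_mul_of_nonneg_left (hex.deriv_bound _ (M.t_mem hn)) hc
    have : 0 ≤ Kt * M.tau ^ 2 + c * K * T := by positivity
    refine h1.trans ?_
    linarith
  have hδD : ∀ n < M.N, ‖VecSob.toL2L.toLinearMap (δ n)‖ ≤ Kt * M.tau ^ 2 + c * K * (T + 1) :=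
    fun n hn => by
      have h1 := (hst _ _ ((mem_admissible_iff _).1 (hadm n hn)) (hdef n hn)).1
      have h2 := mul_le_mul_of_nonneg_left (hw n hn) hc
      have h3 := hwL n hn
      have h4 := mul_le_mul_of_nonneg_left (M.tau_le hT) (mul_nonneg hc hK)
      have h5 : 0 ≤ c * K := mul_nonneg hc hK
      have h6 := norm_sub_norm_le (VecSob.toL2L.toLinearMap (δ n))
        (velL2 ((M.t (n + 1) - M.t n)⁻¹ • (y (M.t (n + 1)) - y (M.t n) -
        ((M.t (n + 1) - M.t n) / 2) • (y' (M.t n) + y' (M.t (n + 1))))))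
      rw [norm_sub_rev] at h6
      have h7 := h6.trans h1
      linarith
  have hρ2 : ∀ n < M.N, ‖ρ (n + 1) - ρ n‖ ≤ c * K * (M.t (n + 1) - M.t n) := fun n hn => by
    have hp := (hR' (n + 1) hn).sub (hR' n hn.le)
    rw [← map_sub, ← map_sub] at hp
    have h1 := (hst _ _ ((mem_admissible_iff _).1 (Submodule.sub_mem _
      (hex.deriv_mem _ (M.t_mem hn)) (hex.deriv_mem _ (M.t_mem hn.le)))) hp).1
    have h2 := hex.deriv_lipschitz _ (M.t_mem hn.le) _ (M.t_mem hn)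
    rw [abs_of_pos (hτpos n hn)] at h2
    have h3 := mul_le_mul_of_nonneg_left h2 hc
    have h4 : ρ (n + 1) - ρ n = velL2 (y' (M.t (n + 1)) - y' (M.t n)) -
        (R' (n + 1) - R' n).1.toL2 := by
      simp only [hρ, ← VecSob.toL2L_apply, Prod.fst_sub, map_sub]
      abel
    rw [h4]
    refine h1.trans (h3.trans (le_of_eq (by ring)))
  -- On `V_h^div` the projection identity replaces `a(δ n, v)` by the Stokes functional of the exact
  -- defect, which is bounded by `‖v‖` in `L²`. An inverse estimate is thereby avoided.
  have hδ2 : ∀ n < M.N, ∀ v ∈ W,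
      |inner ℝ (gradL.toLinearMap (δ n)) (gradL.toLinearMap v)| ≤
        S * K * M.tau * ‖VecSob.toL2L.toLinearMap v‖ := fun n hn v hv => by
    have h1 := (hdef n hn).2.2.1 v hv.1
    rw [hv.2 _ (hdef n hn).2.1, add_zero, aForm_eq_inner] at h1
    have h2 := hex.stokes ((M.t (n + 1) - M.t n)⁻¹ • (y (M.t (n + 1)) - y (M.t n) -
        ((M.t (n + 1) - M.t n) / 2) • (y' (M.t n) + y' (M.t (n + 1))))) v (hV hv.1)
    rw [← h1] at h2
    refine le_trans h2 ?_
    have h3 := mul_le_mul_of_nonneg_left (hw n hn) hS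
    have h4 := mul_le_mul_of_nonneg_right h3 (norm_nonneg v.toL2)
    refine h4.trans (le_of_eq ?_)
    rw [← mul_assoc]
    rfl
  constructor
  · intro n hn
    have h1 := energy_first VecSob.toL2L.toLinearMap gradL.toLinearMap W M.N
      (fun n => M.t (n + 1) - M.t n) e E δ ρ hτpos heW heq hstep hρD hδD n hn
    rw [M.sum_steps] at h1
    refine h1.trans ?_
    have := (M.t_mem hn).2
    gcongr
    exact le_rfl
  · have h1 := energy_second VecSob.toL2L.toLinearMap gradL.toLinearMap W M.N
      (fun n => M.t (n + 1) - M.t n) e E δ ρ hτpos hEW heq hstep (fun n hn => M.le_tau hn) hρ2 hδ2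
      M.N le_rfl
    rw [M.sum_steps, M.last] at h1
    exact (le_add_of_nonneg_right (by positivity)).trans h1

theorem norm_aff_le {F : Type*} [NormedAddCommGroup F] [NormedSpace ℝ F] {a b : ℝ} (hab : a < b)
    {p q : F} {B : ℝ} (hp : ‖p‖ ≤ B) (hq : ‖q‖ ≤ B) {s : ℝ} (hs : s ∈ Icc a b) :
    ‖aff a b p q s‖ ≤ B := by
  have hba := sub_pos.2 hab
  have h0 : 0 ≤ (s - a) / (b - a) := div_nonneg (sub_nonneg.2 hs.1) hba.le
  have h1 : (s - a) / (b - a) ≤ 1 := (div_le_one hba).2 (by linarith [hs.2])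
  have e : aff a b p q s = (1 - (s - a) / (b - a)) • p + ((s - a) / (b - a)) • q := by
    rw [aff]; module
  rw [e]
  refine (norm_add_le _ _).trans ?_
  rw [norm_smul, norm_smul, Real.norm_eq_abs, Real.norm_eq_abs, abs_of_nonneg h0,
    abs_of_nonneg (sub_nonneg.2 h1)]
  nlinarith [mul_le_mul_of_nonneg_left hp (sub_nonneg.2 h1), mul_le_mul_of_nonneg_left hq h0]

/-- Expansion about the midpoint: the energy estimates control mean and jump of `E`, not its nodal
values separately. -/
theorem norm_aff_le_mid {F : Type*} [NormedAddCommGroup F] [NormedSpace ℝ F] {a b : ℝ}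
    (hab : a < b) (p q : F) {s : ℝ} (hs : s ∈ Icc a b) :
    ‖aff a b p q s‖ ≤ ‖(1 / 2 : ℝ) • (p + q)‖ + ‖q - p‖ := by
  have hba := sub_pos.2 hab
  have h0 : 0 ≤ (s - a) / (b - a) := div_nonneg (sub_nonneg.2 hs.1) hba.le
  have h1 : (s - a) / (b - a) ≤ 1 := (div_le_one hba).2 (by linarith [hs.2])
  have e : aff a b p q s = (1 / 2 : ℝ) • (p + q) + ((s - a) / (b - a) - 1 / 2) • (q - p) := by
    rw [aff]; module
  rw [e]
  refine (norm_add_le _ _).trans ?_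
  rw [norm_smul ((s - a) / (b - a) - 1 / 2)]
  have h2 : ‖(s - a) / (b - a) - 1 / 2‖ ≤ 1 := by
    rw [Real.norm_eq_abs, abs_le]; constructor <;> linarith
  have := mul_le_mul_of_nonneg_right h2 (norm_nonneg (q - p))
  linarith

set_option maxHeartbeats 2000000 in
/-- The pointwise bound of the pressure error by the velocity errors. -/
theorem IsNodal.pressure_error_le {β Ca h : ℝ} (hβ : 0 < β) (hFE : IsFEPair Ω r β Ca h Vh Qh)
    (hz : IsNodal M Vh Qh f U Pt z π)
    (hex : ExactBounds T f y y' K Kt S) (hc : 0 ≤ c) (hst : HasStokesBound Vh Qh r c)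
    (hR : ∀ n ≤ M.N, IsStokesProj Vh Qh (velH1 (y (M.t n))) (presL2 (y (M.t n))) (R n))
    (hR' : ∀ n ≤ M.N, IsStokesProj Vh Qh (velH1 (y' (M.t n))) (presL2 (y' (M.t n))) (R' n))
    {e E : ℕ → VecSob Ω 1} (he : ∀ n, e n = (R n).1 - U (M.t n))
    (hE : ∀ n, E n = (R' n).1 - z n) {B : ℝ} (hB : ∀ n ≤ M.N, ‖gradL (e n)‖ ≤ B)
    {n : ℕ} (hn : n < M.N) {s : ℝ} (hs : s ∈ M.Ibar n) :
    ‖presL2 (y s) - M.glue Pt s‖ ≤ K * M.tau ^ 2 + c * K + β⁻¹ * (c * K + B) +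
      β⁻¹ * (‖((1 / 2 : ℝ) • (E n + E (n + 1))).toL2‖ + ‖(E (n + 1) - E n).toL2‖) := by
  have hlt := M.lt n hn
  have hba := sub_pos.2 hlt
  have hK := hex.K_nonneg
  set a := M.t n with ha
  set b := M.t (n + 1) with hb
  set η : ℕ → L2 Ω := fun n => (R n).2 - π n with hη
  set ξ : ℕ → L2 Ω := fun n => presL2 (y (M.t n)) - (R n).2 with hξ
  set ρ : ℕ → VecL2 Ω := fun n => velL2 (y' (M.t n)) - (R' n).1.toL2 with hρ
  -- Interpolation error in time, interpolated projection error `ξ`, and interpolated discrete error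
  -- `η`.
  have hsplit : presL2 (y s) - M.glue Pt s = presL2 (y s - aff a b (y a) (y b) s) +
      aff a b (ξ n) (ξ (n + 1)) s + aff a b (η n) (η (n + 1)) s := by
    rw [hz.glue_eq hn hs, map_sub]
    have : presL2 (aff a b (y a) (y b) s) = aff a b (presL2 (y a)) (presL2 (y b)) s :=
      map_aff presL2.toLinearMap a b _ _ s
    rw [this]
    exact aff_error_split a b s _ _ _ _ _ _ _
  have b1 : ‖presL2 (y s - aff a b (y a) (y b) s)‖ ≤ K * M.tau ^ 2 := by
    refine (norm_presL2_le _).trans ?_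
    have hθ : (s - a) / (b - a) ∈ Icc (0 : ℝ) 1 :=
      ⟨div_nonneg (sub_nonneg.2 hs.1) hba.le, (div_le_one hba).2 (by linarith [hs.2])⟩
    have h1 := hex.interp a (M.t_mem hn.le) b (M.t_mem hn) _ hθ hlt.le
    rw [div_mul_cancel₀ _ hba.ne', add_sub_cancel] at h1
    refine h1.trans (mul_le_mul_of_nonneg_left ?_ hK)
    exact pow_le_pow_left₀ hba.le (M.le_tau hn) 2
  have hξb : ∀ k ≤ M.N, ‖ξ k‖ ≤ c * K := fun k hk =>
    (hst _ _ ((mem_admissible_iff _).1 (hex.mem _ (M.t_mem hk))) (hR k hk)).2.trans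
      (mul_le_mul_of_nonneg_left (hex.bound _ (M.t_mem hk)) hc)
  have hρb : ∀ k ≤ M.N, ‖ρ k‖ ≤ c * K := fun k hk =>
    (hst _ _ ((mem_admissible_iff _).1 (hex.deriv_mem _ (M.t_mem hk))) (hR' k hk)).1.trans
      (mul_le_mul_of_nonneg_left (hex.deriv_bound _ (M.t_mem hk)) hc)
  have hηQ : ∀ k ≤ M.N, η k ∈ Qh := fun k hk => Qh.sub_mem (hR k hk).2.1 (hz.pressure_mem k hk)
  have b3 : β * ‖aff a b (η n) (η (n + 1)) s‖ ≤
      ‖aff a b (VecSob.toL2L (E n)) (VecSob.toL2L (E (n + 1))) s + aff a b (ρ n) (ρ (n + 1)) s‖ +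
        ‖gradL (aff a b (e n) (e (n + 1)) s)‖ := by
    refine hFE.mul_norm_pressure_le (aff_mem (hηQ n hn.le) (hηQ _ hn) _ _ _) _ _ fun v hv => ?_
    have h1 := hz.error_eqn (R' := R') hex hFE.conforming_V hR hn.le hv
    have h2 := hz.error_eqn (R' := R') hex hFE.conforming_V hR (n := n + 1) hn hv
    rw [← he, ← hE] at h1 h2
    simp only [aff, aForm_eq_inner, map_add, map_sub, map_smul, inner_add_left, inner_sub_left,
      real_inner_smul_left, bForm_add_right, bForm_sub_right, bForm_smul_right, hη, hρ,
      ← VecSob.toL2L_apply] at *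
    -- The nodal error equations are linear, so their convex combination is the error equation for
    -- the affine interpolants at time `s`.
    linear_combination (1 - (s - a) / (b - a)) * h1 + (s - a) / (b - a) * h2
  have b4 : ‖aff a b (VecSob.toL2L (E n)) (VecSob.toL2L (E (n + 1))) s‖ ≤
      ‖((1 / 2 : ℝ) • (E n + E (n + 1))).toL2‖ + ‖(E (n + 1) - E n).toL2‖ :=
    norm_aff_le_mid hlt _ _ hs
  have b5 := norm_aff_le hlt (hρb n hn.le) (hρb _ hn) hs
  have b6 : ‖gradL (aff a b (e n) (e (n + 1)) s)‖ ≤ B := by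
    have : gradL (aff a b (e n) (e (n + 1)) s) = aff a b (gradL (e n)) (gradL (e (n + 1))) s :=
      map_aff gradL.toLinearMap a b _ _ s
    rw [this]
    exact norm_aff_le hlt (hB n hn.le) (hB _ hn) hs
  have b7 := norm_aff_le hlt (hξb n hn.le) (hξb _ hn) hs
  have b8 : ‖aff a b (η n) (η (n + 1)) s‖ ≤ β⁻¹ *
      ((‖((1 / 2 : ℝ) • (E n + E (n + 1))).toL2‖ + ‖(E (n + 1) - E n).toL2‖) + c * K + B) := by
    rw [le_inv_mul_iff₀ hβ]
    have := norm_add_le (aff a b (VecSob.toL2L (E n)) (VecSob.toL2L (E (n + 1))) s)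
      (aff a b (ρ n) (ρ (n + 1)) s)
    linarith
  rw [hsplit]
  have t1 := norm_add_le (presL2 (y s - aff a b (y a) (y b) s) + aff a b (ξ n) (ξ (n + 1)) s)
    (aff a b (η n) (η (n + 1)) s)
  have t2 := norm_add_le (presL2 (y s - aff a b (y a) (y b) s)) (aff a b (ξ n) (ξ (n + 1)) s)
  linarith

set_option maxHeartbeats 2000000 in
/-- The bound of the pressure error in `L²(0,T; L²(Ω))`. -/
theorem IsNodal.integral_pressure_error_le (hT : 0 < T) {β Ca h : ℝ} (hβ : 0 < β)
    (hFE : IsFEPair Ω r β Ca h Vh Qh) (hz : IsNodal M Vh Qh f U Pt z π)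
    (hex : ExactBounds T f y y' K Kt S)
    (hU : ∀ n ≤ M.N, U (M.t n) ∈ discDivFree Vh Qh) (hc : 0 ≤ c) (hst : HasStokesBound Vh Qh r c)
    (hR : ∀ n ≤ M.N, IsStokesProj Vh Qh (velH1 (y (M.t n))) (presL2 (y (M.t n))) (R n))
    (hR' : ∀ n ≤ M.N, IsStokesProj Vh Qh (velH1 (y' (M.t n))) (presL2 (y' (M.t n))) (R' n))
    {G : ℝ} (hG : G = ‖gradL ((R 0).1 - U (M.t 0))‖ ^ 2 +
      6 * (Kt * M.tau ^ 2 + c * K * (T + 1)) ^ 2 * T) :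
    ∫ t in (0 : ℝ)..T, ‖presL2 (y t) - M.glue Pt t‖ ^ 2 ≤
      3 * T * (K * M.tau ^ 2 + c * K + β⁻¹ * (c * K + Real.sqrt G)) ^ 2 +
        3 * β⁻¹ ^ 2 * G + 3 * β⁻¹ ^ 2 * (M.tau ^ 2 * ‖gradL ((R' 0).1 - z 0)‖ ^ 2 +
          M.tau ^ 2 * (c * K + S * K * M.tau) ^ 2 * T) := by
  obtain ⟨en1, en2⟩ := hz.velocity_error_bounds hT hex hFE.conforming_V hU hc hst hR hR'
    (e := fun n => (R n).1 - U (M.t n)) (E := fun n => (R' n).1 - z n) (fun _ => rfl) fun _ => rfl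
  rw [← hG] at en1
  set e : ℕ → VecSob Ω 1 := fun n => (R n).1 - U (M.t n) with he
  set E : ℕ → VecSob Ω 1 := fun n => (R' n).1 - z n with hE
  have hB : ∀ n ≤ M.N, ‖gradL (e n)‖ ≤ Real.sqrt G := fun n hn => by
    refine Real.le_sqrt_of_sq_le (le_trans (le_add_of_nonneg_left ?_) (en1 n hn))
    refine Finset.sum_nonneg fun k hk => mul_nonneg ?_ (sq_nonneg _)
    exact (sub_pos.2 (M.lt k ((Finset.mem_range.1 hk).trans_le hn))).le
  have en1' : (∑ k ∈ Finset.range M.N, (M.t (k + 1) - M.t k) *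
      ‖((1 / 2 : ℝ) • (E k + E (k + 1))).toL2‖ ^ 2) ≤ G :=
    (le_add_of_nonneg_right (sq_nonneg _)).trans (en1 M.N le_rfl)
  have hpt := fun {n} (hn : n < M.N) {s} (hs : s ∈ M.Ibar n) =>
    hz.pressure_error_le hβ hFE hex hc hst hR hR' (e := e) (E := E) (fun _ => rfl) (fun _ => rfl)
      hB hn hs
  set Q := K * M.tau ^ 2 + c * K + β⁻¹ * (c * K + Real.sqrt G) with hQ
  have hcont : ContinuousOn (fun t => ‖presL2 (y t) - M.glue Pt t‖ ^ 2) (Icc 0 T) :=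
    (((presL2 (r := r)).continuous.comp_continuousOn hex.continuousOn).sub
      hz.continuousOn_glue).norm.pow 2
  have hint : ∀ k < M.N, IntervalIntegrable (fun t => ‖presL2 (y t) - M.glue Pt t‖ ^ 2) volume
      (M.t k) (M.t (k + 1)) := fun k hk => by
    refine ContinuousOn.intervalIntegrable (hcont.mono ?_)
    rw [uIcc_of_le (M.lt k hk).le]
    exact M.Ibar_subset hk
  have hsum := intervalIntegral.sum_integral_adjacent_intervals hint
  rw [M.first, M.last] at hsum
  rw [← hsum]
  have hloc : ∀ k ∈ Finset.range M.N, ∫ t in M.t k..M.t (k + 1),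
      ‖presL2 (y t) - M.glue Pt t‖ ^ 2 ≤ 3 * Q ^ 2 * (M.t (k + 1) - M.t k) +
        3 * β⁻¹ ^ 2 * ((M.t (k + 1) - M.t k) * ‖((1 / 2 : ℝ) • (E k + E (k + 1))).toL2‖ ^ 2) +
        3 * β⁻¹ ^ 2 * ((M.t (k + 1) - M.t k) * ‖(E (k + 1) - E k).toL2‖ ^ 2) := fun k hk => by
    have hk' := Finset.mem_range.1 hk
    have hlt := (M.lt k hk').le
    set x₁ := ‖((1 / 2 : ℝ) • (E k + E (k + 1))).toL2‖
    set x₂ := ‖(E (k + 1) - E k).toL2‖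
    have h1 : ∫ t in M.t k..M.t (k + 1), ‖presL2 (y t) - M.glue Pt t‖ ^ 2 ≤
        ∫ _t in M.t k..M.t (k + 1), (3 * Q ^ 2 + 3 * β⁻¹ ^ 2 * x₁ ^ 2 + 3 * β⁻¹ ^ 2 * x₂ ^ 2) := by
      refine intervalIntegral.integral_mono_on hlt (hint k hk') (by simp) fun s hs => ?_
      refine (pow_le_pow_left₀ (norm_nonneg _) (hpt hk' hs) 2).trans ?_
      -- The square of a sum of three terms is at most three times the sum of squares.
      nlinarith [sq_nonneg (Q - β⁻¹ * x₁), sq_nonneg (Q - β⁻¹ * x₂),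
        sq_nonneg (β⁻¹ * x₁ - β⁻¹ * x₂)]
    rw [intervalIntegral.integral_const, smul_eq_mul] at h1
    linarith
  refine (Finset.sum_le_sum hloc).trans ?_
  rw [Finset.sum_add_distrib, Finset.sum_add_distrib, ← Finset.mul_sum, ← Finset.mul_sum,
    ← Finset.mul_sum, M.sum_steps, M.last]
  have hb : 0 ≤ 3 * β⁻¹ ^ 2 := by positivity
  have m1 := mul_le_mul_of_nonneg_left en1' hb
  have m2 := mul_le_mul_of_nonneg_left en2 hb
  linarith

end Estimates

end

end StokesFE

/-! ### Collecting the constants -/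

namespace StokesFE

noncomputable section

/-- Every term is the square of a quantity linear in `g₀`, `τ G₀`, `τ²` and `κ`, each at most `L`;
the product `τ κ` is reduced by `τ ≤ T`. Here `κ` stands for `h ^ r` and `b` for `β⁻¹`. -/
theorem exists_error_constant {K Kt S CS T b : ℝ} (hK : 0 ≤ K) (hKt : 0 ≤ Kt) (hS : 0 ≤ S)
    (hCS : 0 ≤ CS) (hT : 0 ≤ T) (hb : 0 ≤ b) :
    ∃ A : ℝ, 0 ≤ A ∧ ∀ g₀ G₀ τ κ G : ℝ, 0 ≤ g₀ → 0 ≤ G₀ → 0 ≤ τ → τ ≤ T → 0 ≤ κ →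
      G = g₀ ^ 2 + 6 * (Kt * τ ^ 2 + CS * κ * K * (T + 1)) ^ 2 * T →
      3 * T * (K * τ ^ 2 + CS * κ * K + b * (CS * κ * K + Real.sqrt G)) ^ 2 + 3 * b ^ 2 * G +
        3 * b ^ 2 * (τ ^ 2 * G₀ ^ 2 + τ ^ 2 * (CS * κ * K + S * K * τ) ^ 2 * T) ≤
      A * (g₀ + τ * G₀ + τ ^ 2 + κ) ^ 2 := by
  set A₁ := Kt + CS * K * (T + 1) with hA₁
  set A₂ := 1 + 6 * A₁ ^ 2 * T with hA₂
  set A₃ := K + CS * K + b * (CS * K + Real.sqrt A₂) with hA₃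
  set A₄ := CS * K * T + S * K with hA₄
  have p1 : 0 ≤ A₁ := by positivity
  have p2 : 0 ≤ A₂ := by positivity
  have p3 : 0 ≤ A₃ := by positivity
  have p4 : 0 ≤ A₄ := by positivity
  refine ⟨3 * T * A₃ ^ 2 + 3 * b ^ 2 * A₂ + 3 * b ^ 2 * (1 + A₄ ^ 2 * T), by positivity,
    fun g₀ G₀ τ κ G hg hG₀ hτ hτT hκ hG => ?_⟩
  set L := g₀ + τ * G₀ + τ ^ 2 + κ with hL
  have hτG : 0 ≤ τ * G₀ := mul_nonneg hτ hG₀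
  have hτ2 : 0 ≤ τ ^ 2 := sq_nonneg τ
  have l0 : 0 ≤ L := by positivity
  have l1 : g₀ ≤ L := by linarith
  have l2 : τ * G₀ ≤ L := by linarith
  have l3 : τ ^ 2 ≤ L := by linarith
  have l4 : κ ≤ L := by linarith
  have d1 : Kt * τ ^ 2 + CS * κ * K * (T + 1) ≤ A₁ * L := by
    have a1 := mul_le_mul_of_nonneg_left l3 hKt
    have a2 := mul_le_mul_of_nonneg_left l4 (show 0 ≤ CS * K * (T + 1) by positivity)
    rw [hA₁]; linarith
  have d2 : G ≤ A₂ * L ^ 2 := by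
    have a1 : (Kt * τ ^ 2 + CS * κ * K * (T + 1)) ^ 2 ≤ (A₁ * L) ^ 2 :=
      pow_le_pow_left₀ (by positivity) d1 2
    have a2 : g₀ ^ 2 ≤ L ^ 2 := pow_le_pow_left₀ hg l1 2
    have a3 := mul_le_mul_of_nonneg_right a1 hT
    rw [hG, hA₂]
    linarith
  have d3 : Real.sqrt G ≤ Real.sqrt A₂ * L := by
    rw [← Real.sqrt_sq l0, ← Real.sqrt_mul p2]
    exact Real.sqrt_le_sqrt d2
  have d4 : K * τ ^ 2 + CS * κ * K + b * (CS * κ * K + Real.sqrt G) ≤ A₃ * L := by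
    have a1 := mul_le_mul_of_nonneg_left l3 hK
    have a2 := mul_le_mul_of_nonneg_left l4 (show 0 ≤ CS * K by positivity)
    have a3 : b * (CS * κ * K + Real.sqrt G) ≤ b * (CS * K * L + Real.sqrt A₂ * L) :=
      mul_le_mul_of_nonneg_left (by linarith) hb
    rw [hA₃]; linarith
  have d5 : τ * (CS * κ * K + S * K * τ) ≤ A₄ * L := by
    have a1 := mul_le_mul_of_nonneg_left l3 (show 0 ≤ S * K by positivity)
    have a2 : CS * K * (τ * κ) ≤ CS * K * (T * L) := by gcongr
    rw [hA₄]; linarith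
  have q1 : (K * τ ^ 2 + CS * κ * K + b * (CS * κ * K + Real.sqrt G)) ^ 2 ≤ (A₃ * L) ^ 2 :=
    pow_le_pow_left₀ (by positivity) d4 2
  have q2 : (τ * (CS * κ * K + S * K * τ)) ^ 2 ≤ (A₄ * L) ^ 2 :=
    pow_le_pow_left₀ (by positivity) d5 2
  have q3 : (τ * G₀) ^ 2 ≤ L ^ 2 := pow_le_pow_left₀ hτG l2 2
  have m1 := mul_le_mul_of_nonneg_left q1 (show 0 ≤ 3 * T by positivity)
  have m2 := mul_le_mul_of_nonneg_left d2 (show 0 ≤ 3 * b ^ 2 by positivity)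
  have m3 : 3 * b ^ 2 * ((τ * G₀) ^ 2 + (τ * (CS * κ * K + S * K * τ)) ^ 2 * T) ≤
      3 * b ^ 2 * (L ^ 2 + (A₄ * L) ^ 2 * T) := by gcongr
  calc _ = 3 * T * (K * τ ^ 2 + CS * κ * K + b * (CS * κ * K + Real.sqrt G)) ^ 2 + 3 * b ^ 2 * G +
        3 * b ^ 2 * ((τ * G₀) ^ 2 + (τ * (CS * κ * K + S * K * τ)) ^ 2 * T) := by ring
    _ ≤ 3 * T * (A₃ * L) ^ 2 + 3 * b ^ 2 * (A₂ * L ^ 2) +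
        3 * b ^ 2 * (L ^ 2 + (A₄ * L) ^ 2 * T) := by linarith
    _ = _ := by ring

theorem exists_hasStokesBound {d : ℕ} {Ω : Opens (Pt d)} (hd : 0 < d)
    (hbdd : Bornology.IsBounded (Ω : Set (Pt d))) (r : ℕ) {β : ℝ} (hβ : 0 < β) (Ca : ℝ) :
    ∃ CS : ℝ, 0 ≤ CS ∧ ∀ h : ℝ, 0 < h → ∀ (Vh : Submodule ℝ (VecSob Ω 1))
      (Qh : Submodule ℝ (L2 Ω)), IsFEPair Ω r β Ca h Vh Qh →
      HasStokesBound Vh Qh r (CS * h ^ r) := by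
  obtain ⟨CS, hCS, hb⟩ := exists_stokesProj_bound hd hbdd r hβ Ca
  refine ⟨2 * CS, by positivity, fun h hh Vh Qh hFE w x hw hx => ?_⟩
  have hdiv : div (w.1.toH1 (Nat.le_add_left 1 r)) = 0 := by rw [← divL_apply]; exact hw.2.1
  obtain ⟨b1, b2⟩ := hb h hh Vh Qh hFE w.1 w.2 x hw.1 hdiv hw.2.2 hx
  -- The norm on pairs is the maximum, hence the factor 2.
  have n1 : ‖w.1‖ + ‖w.2‖ ≤ 2 * ‖w‖ := by linarith [norm_fst_le w, norm_snd_le w]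
  have n2 := mul_le_mul_of_nonneg_left n1 (mul_nonneg hCS (pow_pos hh r).le)
  exact ⟨b1.trans (n2.trans (le_of_eq (by ring))), b2.trans (n2.trans (le_of_eq (by ring)))⟩

end

end StokesFE

/-! ### The error estimate for the post-processed pressure -/

open StokesFE in
theorem mainTheorem4 {d : ℕ} (hd : d = 2 ∨ d = 3) (Ω : Opens (StokesFE.Pt d))
    (hbdd : Bornology.IsBounded (Ω : Set (StokesFE.Pt d)))
    (hconn : IsConnected (Ω : Set (StokesFE.Pt d)))
    (T : ℝ) (hT : 0 < T) (r : ℕ) (hr : 1 ≤ r)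
    (f : ℝ → StokesFE.VecL2 Ω) (u₀ : StokesFE.VecL2 Ω)
    (u : ℝ → StokesFE.VecSob Ω (r + 1)) (p : ℝ → StokesFE.Sob Ω r)
    (hsol : StokesFE.IsStokesSolution Ω T hr f u₀ u p) (hreg : StokesFE.IsRegular T f u p)
    (β Ca : ℝ) (hβ : 0 < β) :
    ∃ C : ℝ, ∀ (h : ℝ), 0 < h → ∀ (Vh : Submodule ℝ (StokesFE.VecSob Ω 1))
      (Qh : Submodule ℝ (StokesFE.L2 Ω)), StokesFE.IsFEPair Ω r β Ca h Vh Qh →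
      ∀ (M : StokesFE.TimeMesh T), ∀ u0h ∈ StokesFE.discDivFree Vh Qh,
      ∀ (U : ℝ → StokesFE.VecSob Ω 1) (P : ℝ → StokesFE.L2 Ω),
      StokesFE.IsDiscreteSolution M Vh Qh f u0h U P →
      (∃ Ut Pt, StokesFE.IsPostProcessing M Vh Qh f U P Ut Pt) ∧
      ∀ Ut Pt, StokesFE.IsPostProcessing M Vh Qh f U P Ut Pt →
        StokesFE.InX M 1 Qh (M.glue Pt) ∧
        StokesFE.IsDiscreteSolution M Vh Qh f u0h U (M.glue Pt) ∧
        Real.sqrt (∫ t in (0 : ℝ)..T, ‖(p t).toL2 - M.glue Pt t‖ ^ 2) ≤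
          C * (StokesFE.gradNorm (StokesFE.discreteError M Vh Qh u p U 0)
            + M.tau * StokesFE.gradNorm (StokesFE.discreteDerivError M Vh Qh u p Ut 0)
            + M.tau ^ 2 + h ^ r) := by
  have hd0 : 0 < d := by omega
  have hfin : IsFiniteMeasure (volume.restrict (Ω : Set (Pt d))) :=
    ⟨by rw [Measure.restrict_apply_univ]; exact hbdd.measure_lt_top⟩
  obtain ⟨CP, _, hP⟩ := exists_poincare hd0 hbdd
  obtain ⟨CS, hCS, hst⟩ := exists_hasStokesBound hd0 hbdd r hβ Ca
  obtain ⟨K, Kt, S, hex⟩ := exists_exactBounds hT hsol hreg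
  obtain ⟨A, hA, hbound⟩ := exists_error_constant hex.K_nonneg hex.Kt_nonneg hex.S_nonneg hCS
    hT.le (inv_pos.2 hβ).le
  refine ⟨Real.sqrt A, fun h hh Vh Qh hFE M u0h h0 U P hds => ?_⟩
  have hfV := hFE.finite_V
  have hfQ := hFE.finite_Q
  refine ⟨hds.exists_isPostProcessing h0, fun Ut Pt hpp => ?_⟩
  obtain ⟨z, π, hz, hz0⟩ := hpp.exists_nodal hT hβ hFE hds h0
  refine ⟨hz.inX hT, hz.isDiscreteSolution hT hds, ?_⟩
  set y : ℝ → VelPres Ω r := fun t => (u t, p t) with hy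
  set y' := derivWithin y (Icc 0 T) with hy'
  have hVinj : ∀ v ∈ Vh, gradL v = 0 → v = 0 := fun v hv h0 => by
    have := hP v (hFE.conforming_V hv)
    rw [h0, norm_zero, mul_zero] at this
    exact VecSob.eq_zero_of_toL2 (norm_le_zero_iff.1 this)
  -- `stokesProj` is a choice, so its defining relations require existence; injectivity of the
  -- gradient on `V_h` comes from the Poincaré inequality.
  have hproj : ∀ w : VelPres Ω r, IsStokesProj Vh Qh (velH1 w) (presL2 w)
      (stokesProj Vh Qh (velH1 w) (presL2 w)) := fun w =>
    Classical.epsilon_spec (exists_isStokesProj hVinj _ _)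
  have key := hz.integral_pressure_error_le hT hβ hFE hex (hds.mem_discDivFree h0)
    (mul_nonneg hCS (pow_pos hh r).le) (hst h hh Vh Qh hFE)
    (R := fun n => stokesProj Vh Qh (velH1 (y (M.t n))) (presL2 (y (M.t n))))
    (R' := fun n => stokesProj Vh Qh (velH1 (y' (M.t n))) (presL2 (y' (M.t n))))
    (fun n _ => hproj _) (fun n _ => hproj _) rfl
  -- At time 0 the interpolants take the exact values, so the initial errors in the theorem are the
  -- nodal errors with index 0.
  have e1 : gradNorm (discreteError M Vh Qh u p U 0) =
      ‖gradL ((stokesProj Vh Qh (velH1 (y (M.t 0))) (presL2 (y (M.t 0)))).1 - U (M.t 0))‖ := by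
    rw [gradNorm_eq, discreteError, TimeMesh.interp_zero, TimeMesh.interp_zero, M.first]
    rfl
  have e2 : gradNorm (discreteDerivError M Vh Qh u p Ut 0) =
      ‖gradL ((stokesProj Vh Qh (velH1 (y' (M.t 0))) (presL2 (y' (M.t 0)))).1 - z 0)‖ := by
    rw [gradNorm_eq, discreteDerivError, TimeMesh.interp_zero, TimeMesh.interp_zero,
      TimeMesh.glue_zero, M.first, hz0, hy', hreg.derivWithin_pair hT (left_mem_Icc.2 hT.le)]
    rfl
  have hfinal := hbound _ _ M.tau (h ^ r) _ (norm_nonneg (gradL ((stokesProj Vh Qh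
    (velH1 (y (M.t 0))) (presL2 (y (M.t 0)))).1 - U (M.t 0)))) (norm_nonneg (gradL ((stokesProj
    Vh Qh (velH1 (y' (M.t 0))) (presL2 (y' (M.t 0)))).1 - z 0))) (M.tau_pos hT).le (M.tau_le hT)
    (pow_pos hh r).le rfl
  rw [e1, e2]
  have hL : 0 ≤ ‖gradL ((stokesProj Vh Qh (velH1 (y (M.t 0))) (presL2 (y (M.t 0)))).1 - U (M.t 0))‖
      + M.tau * ‖gradL ((stokesProj Vh Qh (velH1 (y' (M.t 0))) (presL2 (y' (M.t 0)))).1 - z 0)‖ +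
        M.tau ^ 2 + h ^ r := by
    have := (M.tau_pos hT).le
    positivity
  refine (Real.sqrt_le_sqrt (key.trans hfinal)).trans (le_of_eq ?_)
  rw [Real.sqrt_mul hA, Real.sqrt_sq hL]
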